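/- For an integer $d\ge 1$ and $\mu\in\mathbb R$ put $\varphi_s=\frac{(6s-1)\pi}{6d}-\frac{\mu}{d}$ for $s=-\lfloor\frac{d-2}{2}\rfloor,\dots,\lfloor\frac{d+1}{2}\rfloor$, let $L_s(x,y)=y+(\cos 2\varphi_s-x)\tan\varphi_s+\sin 2\varphi_s$ if $\cos\varphi_s\neq 0$ and $L_s(x,y)=x+1$ if $\cos\varphi_s=0$, and let $$P_d(x,y,\mu)=\lambda_{d,\mu}\prod_s L_s(x,y),$$ where $\lambda_{d,\mu}=(-1)^m\,2d$ if $\mu=(6m-3d-1)\frac{\pi}{6}$ with $m\in\mathbb Z$, and $\lambda_{d,\mu}=2\cos(\mu+\frac{d\pi}{2}+\frac{2\pi}{3})$ if $\mu$ is not of this form. Consider the family of Hamiltonian systems $$\dot x=\partial_yP_d(x,y,\mu),\qquad \dot y=-\partial_xP_d(x,y,\mu).$$ A *bifurcation point* is a value $\mu_0\in\mathbb R$ such that the number of stationary points of the system is not constant on any neighbourhood of $\mu_0$. Two parameters are *rotation equivalent* if some rotation of the plane about the origin carries the system of the first to the system of the second. (a) If $d\ge 4$ and $3\nmid d$, then $\mu$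 and $\mu+\frac{2\pi}{3}$ are rotation equivalent for every $\mu$; the bifurcation points in $[0,\frac{2\pi}{3})$ are exactly the two values $\frac{\pi}{6}$ and $\frac{\pi}{2}$; and every bifurcation point in $\mathbb R$ is rotation equivalent to exactly one of these two. (b) If $d\ge 4$ and $3\mid d$, then the system is $2\pi$-periodic in $\mu$; the bifurcation points in $[0,2\pi)$ are exactly the six values $(2l+1)\frac{\pi}{6}$, $l=0,1,\dots,5$; and every bifurcation point in $\mathbb R$ is rotation equivalent to exactly one of these six. (c) For every $d\ge1$ and every bifurcation point $\mu_0$, the function $P_d(\cdot,\cdot,\mu_0)$ has a degenerate critical point, and each of its degenerate critical points $p$ is a singularity of type $D_4$ with three real branches (in suitable smooth local coordinates $(X,Y)$ centred at $p$ the function is $P_d(p,\mu_0)+X^2Y-Y^3$) and splits into three saddles and one center: for every sufficiently small $\varepsilon>0$ there is $\delta>0$ such that for $0<|\mu-\mu_0|<\delta$ the system has exactly four stationary points at distance less than $\varepsilon$ from $p$ (distance in the maximum norm), three of them saddles and one a center. Here a saddle is a stationary point whose linearization has one negative and one positive real eigenvalue, and a center is a stationary point such that the orbit of every other point near it is a closed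 orbit surrounding it. -/

import Mathlib

open Set Filter Topology
open scoped ContDiff

noncomputable section

namespace DeltoidHamiltonian

/-- The angle (in radians) `φ = (6s - 1)π/(6d) - μ/d` of the line with index `s`. -/
def angle (d : ℕ) (μ : ℝ) (s : ℤ) : ℝ :=
  (6 * (s : ℝ) - 1) * Real.pi / (6 * (d : ℝ)) - μ / (d : ℝ)

open Classical in
/-- The affine form `y + (cos 2φ - x) tan φ + sin 2φ`; a vertical line (`cos φ = 0`) is read as
`x + 1`. -/
def lineForm (d : ℕ) (μ : ℝ) (s : ℤ) (p : ℝ × ℝ) : ℝ :=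
  if Real.cos (angle d μ s) = 0 then p.1 + 1
  else p.2 + (Real.cos (2 * angle d μ s) - p.1) * Real.tan (angle d μ s)
    + Real.sin (2 * angle d μ s)

/-- `μ = (6m - 3d - 1)π/6`: the parameters for which one of the lines is vertical. -/
def IsVerticalParam (d : ℕ) (μ : ℝ) (m : ℤ) : Prop :=
  μ = (6 * (m : ℝ) - 3 * (d : ℝ) - 1) * Real.pi / 6

open Classical in
/-- The normalising factor: `(-1)^m 2d` if `μ = (6m - 3d - 1)π/6` for an integer `m` (which is then
unique), and `2 cos(μ + dπ/2 + 2π/3)` otherwise. -/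
def scale (d : ℕ) (μ : ℝ) : ℝ :=
  if h : ∃ m : ℤ, IsVerticalParam d μ m then (-1 : ℝ) ^ (Classical.choose h) * (2 * (d : ℝ))
  else 2 * Real.cos (μ + (d : ℝ) * Real.pi / 2 + 2 * Real.pi / 3)

/-- The polynomial `P_d(x, y, μ)`, with `s` running over
`-⌊(d-2)/2⌋, …, ⌊(d+1)/2⌋` (integer division by 2 is the floor). -/
def P (d : ℕ) (μ : ℝ) (p : ℝ × ℝ) : ℝ :=
  scale d μ * ∏ s ∈ Finset.Icc (-(((d : ℤ) - 2) / 2)) (((d : ℤ) + 1) / 2), lineForm d μ s p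

/-- The Hamiltonian vector field `(∂_y H, -∂_x H)`. -/
def hamiltonianField (H : ℝ × ℝ → ℝ) (p : ℝ × ℝ) : ℝ × ℝ :=
  (fderiv ℝ H p (0, 1), -fderiv ℝ H p (1, 0))

/-- The Hamiltonian system `ẋ = ∂_y P_d`, `ẏ = -∂_x P_d`. -/
def system (d : ℕ) (μ : ℝ) : ℝ × ℝ → ℝ × ℝ :=
  hamiltonianField (P d μ)

/-- Stationary points of `ṙ = f r`. -/
def stationaryPoints (f : ℝ × ℝ → ℝ × ℝ) : Set (ℝ × ℝ) :=
  {p | f p = 0}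

/-- `μ₀` is a bifurcation point of the family `ṙ = f μ r`: the number of stationary points is not
constant on any neighbourhood of `μ₀`. -/
def IsBifurcationPoint (f : ℝ → ℝ × ℝ → ℝ × ℝ) (μ₀ : ℝ) : Prop :=
  ¬ ∀ᶠ μ in 𝓝 μ₀, (stationaryPoints (f μ)).encard = (stationaryPoints (f μ₀)).encard

/-- The rotation of the plane by the angle `θ` about the origin. -/
def rotation (θ : ℝ) (p : ℝ × ℝ) : ℝ × ℝ :=
  (Real.cos θ * p.1 - Real.sin θ * p.2, Real.sin θ * p.1 + Real.cos θ * p.2)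

/-- Some rotation about the origin carries the system `ṙ = f r` to the system `ṙ = g r`. -/
def RotationEquivalent (f g : ℝ × ℝ → ℝ × ℝ) : Prop :=
  ∃ θ : ℝ, ∀ p, g (rotation θ p) = rotation θ (f p)

/-- `p` is a saddle of `ṙ = f r`: a stationary point whose linearization has a negative and a
positive real eigenvalue. -/
def IsSaddle (f : ℝ × ℝ → ℝ × ℝ) (p : ℝ × ℝ) : Prop :=
  f p = 0 ∧ DifferentiableAt ℝ f p ∧
    ∃ a b : ℝ, a < 0 ∧ 0 < b ∧
      Module.End.HasEigenvalue (fderiv ℝ f p : (ℝ × ℝ) →ₗ[ℝ] (ℝ × ℝ)) a ∧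
      Module.End.HasEigenvalue (fderiv ℝ f p : (ℝ × ℝ) →ₗ[ℝ] (ℝ × ℝ)) b

/-- `p` is a center of `ṙ = f r`: a stationary point such that the orbit of every other point near
`p` is a closed orbit surrounding `p`, that is, `p` lies in a bounded component of the complement
of the orbit. -/
def IsCenter (f : ℝ × ℝ → ℝ × ℝ) (p : ℝ × ℝ) : Prop :=
  f p = 0 ∧ ∀ᶠ q in 𝓝[≠] p, ∃ γ : ℝ → ℝ × ℝ,
    γ 0 = q ∧ (∀ t, HasDerivAt γ (f (γ t)) t) ∧ (∃ T : ℝ, 0 < T ∧ Function.Periodic γ T) ∧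
      p ∉ range γ ∧ Bornology.IsBounded (connectedComponentIn (range γ)ᶜ p)

/-- `p` is a degenerate critical point of `H`: the differential vanishes and the Hessian is a
degenerate bilinear form. -/
def IsDegenerateCriticalPoint (H : ℝ × ℝ → ℝ) (p : ℝ × ℝ) : Prop :=
  fderiv ℝ H p = 0 ∧ ¬ Function.Injective (fderiv ℝ (fderiv ℝ H) p)

/-- `H` has a singularity of type `D₄` (with three real branches, `D₄⁻`) at `p`: in suitable smooth
local coordinates `(X, Y)` centred at `p` it is `H(p) + X²Y - Y³`. -/
def IsD4 (H : ℝ × ℝ → ℝ) (p : ℝ × ℝ) : Prop :=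
  ∃ Φ : OpenPartialHomeomorph (ℝ × ℝ) (ℝ × ℝ),
    p ∈ Φ.source ∧ Φ p = 0 ∧ ContDiffOn ℝ ∞ Φ Φ.source ∧ ContDiffOn ℝ ∞ Φ.symm Φ.target ∧
      ∀ q ∈ Φ.source, H q = H p + ((Φ q).1 ^ 2 * (Φ q).2 - (Φ q).2 ^ 3)

/-- At `μ₀` the point `p` splits into three saddles and one center: in each sufficiently small ball
about `p`, for all `μ ≠ μ₀` close enough to `μ₀`, the stationary points are exactly four, three
of them saddles and one of them a center. -/
def SplitsIntoThreeSaddlesOneCenter (f : ℝ → ℝ × ℝ → ℝ × ℝ) (μ₀ : ℝ) (p : ℝ × ℝ) : Prop :=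
  ∀ᶠ ε in 𝓝[>] (0 : ℝ), ∀ᶠ μ in 𝓝[≠] μ₀,
    ∃ (s : Fin 3 → ℝ × ℝ) (c : ℝ × ℝ), Function.Injective s ∧ c ∉ range s ∧
      stationaryPoints (f μ) ∩ Metric.ball p ε = insert c (range s) ∧
      (∀ i, IsSaddle (f μ) (s i)) ∧ IsCenter (f μ) c

end DeltoidHamiltonian

end

noncomputable section

namespace DeltoidHamiltonian

open Real

/-! ### Products of sines and Chebyshev polynomials -/

/-! Put κ = μ + π/6. Up to nonzero factors the lines are those tangents cos φ·y − sin φ·x + sin 3φ =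
0 of a fixed deltoid whose direction satisfies sin(dφ + κ) = 0. At the point e^{-2iφ} + 2t e^{iφ} of
the tangent of direction φ, the form of direction ψ equals 2 sin(φ − ψ)(t − cos(φ + 2ψ)).
Multiplying over all lines turns both factors into classical products, and P = −4 sin(dφ + κ)(T_d(t)
− cos(dφ − 2κ)) with T_d the Chebyshev polynomial (`P_chord`). The rest is read off this formula.

Three tangents of distinct directions φ, ψ, χ concur iff sin(φ + ψ + χ) = 0. Hence triple points of
the line system force sin 3κ = 0, and for d ≥ 4 this also suffices. The stationary points are the
crossings of two lines together with all points that are triple for some phase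
(`stationaryPoints_system`); the second set is finite and does not depend on μ. A triple point
determines its phase modulo π, so the two sets meet exactly in the triple points of phase κ. The
count is thus a constant, the number of pairs of lines plus the size of the second set, when there
is no triple point of phase κ, and strictly smaller otherwise: bifurcation means that triple points
appear (`isBifurcationPoint_iff`).

Rotations by multiples of 2π/3 preserve the deltoid and shift φ, so they realise the shifts of μ by
(3n − dj)·2π/3 with integers j, n. For d ≥ 4 there are no others, because an equivalence carries
lines to lines (`exists_of_rotationEquivalent`). Among the points (2l + 1)π/6 the class is therefore
l modulo 2 or l modulo 6, according as 3 does not or does divide d.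

At a triple point P is a product of three pairwise independent linear forms and a nonvanishing
function whose cube root is absorbed into the coordinates, which gives D₄. For nearby μ the three
lines cross pairwise at three distinct simple crossings, which are saddles, while the old point
stays stationary with definite Hessian (`hessian_definite`); a definite critical point of a planar
Hamiltonian is a center (`isCenter_of_posDef`). -/

lemma pow_sub_pow_eq_prod_range {d : ℕ} (hd : 0 < d) {ζ : ℂ} (hζ : IsPrimitiveRoot ζ d) (x y : ℂ) :
    x ^ d - y ^ d = ∏ k ∈ Finset.range d, (x - ζ ^ k * y) := by
  have h := congrArg (Polynomial.eval x) (X_pow_sub_C_eq_prod hζ hd (rfl : y ^ d = y ^ d))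
  simpa [Polynomial.eval_prod] using h

/-- Apply the factorisation of x^d − y^d to x = e^{i(φ−α)}, y = e^{−i(φ−α)}. Only the nonvanishing
of the constant is needed, since it later cancels against the normalisation of `P`. -/
lemma prod_sin_sub {d : ℕ} (hd : 0 < d) (α : ℝ) :
    ∃ c : ℝ, c ≠ 0 ∧ ∀ φ : ℝ, ∏ k ∈ Finset.range d, sin (φ - (α + k * π / d)) =
      c * sin (d * (φ - α)) := by
  have hdr : (d : ℝ) ≠ 0 := by exact_mod_cast hd.ne'
  obtain ⟨C, hC0, hC⟩ : ∃ C : ℂ, C ≠ 0 ∧ ∀ φ : ℝ,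
      ((∏ k ∈ Finset.range d, sin (φ - (α + k * π / d)) : ℝ) : ℂ) =
      C * (sin (d * (φ - α)) : ℝ) := by
    refine ⟨(∏ k ∈ Finset.range d, (-(Complex.I / 2) * Complex.exp (-(k * π / d) * Complex.I))) *
      (2 * Complex.I), ?_, fun φ => ?_⟩
    · refine mul_ne_zero (Finset.prod_ne_zero_iff.2 fun k _ => ?_) (by simp)
      simp [Complex.exp_ne_zero]
    · have hζ := Complex.isPrimitiveRoot_exp d hd.ne'
      have key := pow_sub_pow_eq_prod_range hd hζ (Complex.exp ((φ - α) * Complex.I))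
        (Complex.exp (-(φ - α) * Complex.I))
      have hk : ∀ k ∈ Finset.range d, ((sin (φ - (α + k * π / d)) : ℝ) : ℂ) =
          (-(Complex.I / 2) * Complex.exp (-(k * π / d) * Complex.I)) *
          (Complex.exp ((φ - α) * Complex.I) - Complex.exp (2 * π * Complex.I / d) ^ k *
          Complex.exp (-(φ - α) * Complex.I)) := by
        intro k _
        rw [← Complex.exp_nat_mul, ← Complex.exp_add, mul_assoc, mul_sub, ← Complex.exp_add,
          ← Complex.exp_add, Complex.ofReal_sin, Complex.sin]
        have e1 : -((φ - (α + k * π / d) : ℝ) : ℂ) * Complex.I =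
          -(k * π / d) * Complex.I + (k * (2 * π * Complex.I / d) + -(φ - α) * Complex.I) := by
          push_cast; ring
        have e2 : ((φ - (α + k * π / d) : ℝ) : ℂ) * Complex.I =
          -(k * π / d) * Complex.I + (φ - α) * Complex.I := by push_cast; ring
        rw [e1, e2]
        ring
      rw [Complex.ofReal_prod, Finset.prod_congr rfl hk, Finset.prod_mul_distrib, ← key,
        ← Complex.exp_nat_mul, ← Complex.exp_nat_mul, mul_assoc, Complex.ofReal_sin, Complex.sin]
      have e1 : -((d * (φ - α) : ℝ) : ℂ) * Complex.I = d * (-(φ - α) * Complex.I) := by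
        push_cast; ring
      have e2 : ((d * (φ - α) : ℝ) : ℂ) * Complex.I = d * ((φ - α) * Complex.I) := by
        push_cast; ring
      rw [e1, e2]
      congr 1
      linear_combination (Complex.exp (d * (-(φ - α) * Complex.I)) -
        Complex.exp (d * ((φ - α) * Complex.I))) * -Complex.I_sq
  -- The complex constant is the value of the real product at φ = α + π/(2d), where the sine on the
  -- right is 1; hence it is real.
  refine ⟨∏ k ∈ Finset.range d, sin ((α + π / 2 / d) - (α + k * π / d)), ?_, fun φ => ?_⟩
  · intro h
    have := hC (α + π / 2 / d)
    rw [h] at this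
    have e : (d : ℝ) * (α + π / 2 / d - α) = π / 2 := by field_simp; ring
    rw [e] at this
    simp at this
    exact hC0 this.symm
  · have h1 := hC (α + π / 2 / d)
    have e : (d : ℝ) * (α + π / 2 / d - α) = π / 2 := by field_simp; ring
    rw [e, sin_pi_div_two, Complex.ofReal_one, mul_one] at h1
    have h2 := hC φ
    rw [← h1] at h2
    exact_mod_cast h2

/-- With t = cos z one has t − cos b = (e^{−iz}/2)(e^{iz} − e^{ib})(e^{iz} − e^{−ib}), and each of
the two families of factors multiplies to a difference of d-th powers. -/
lemma two_pow_mul_prod_sub_cos {d : ℕ} (hd : 0 < d) (t a : ℝ) :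
    2 ^ d * ∏ k ∈ Finset.range d, (t - cos (a + 2 * (k * π / d))) =
      2 * ((Polynomial.Chebyshev.T ℝ d).eval t - cos (d * a)) := by
  have hd0 : (d : ℂ) ≠ 0 := by exact_mod_cast hd.ne'
  -- A complex angle is needed because t may lie outside [−1, 1].
  obtain ⟨z, hz⟩ := Complex.cos_surjective (t : ℂ)
  have hT : (((Polynomial.Chebyshev.T ℝ d).eval t : ℝ) : ℂ) = Complex.cos (d * z) := by
    have h := Polynomial.Chebyshev.algebraMap_eval_T (R' := ℂ) t d
    rw [Complex.coe_algebraMap, ← hz, Polynomial.Chebyshev.T_complex_cos] at h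
    simpa using h
  have hζ := Complex.isPrimitiveRoot_exp d hd.ne'
  have h1 := pow_sub_pow_eq_prod_range hd hζ (Complex.exp (z * Complex.I))
    (Complex.exp (a * Complex.I))
  have h2 := pow_sub_pow_eq_prod_range hd hζ.inv (Complex.exp (z * Complex.I))
    (Complex.exp (-a * Complex.I))
  have hk : ∀ k ∈ Finset.range d, ((t - cos (a + 2 * (k * π / d)) : ℝ) : ℂ) =
      (Complex.exp (-z * Complex.I) / 2) *
      ((Complex.exp (z * Complex.I) - Complex.exp (2 * π * Complex.I / d) ^ k *
        Complex.exp (a * Complex.I)) *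
      (Complex.exp (z * Complex.I) - (Complex.exp (2 * π * Complex.I / d))⁻¹ ^ k *
        Complex.exp (-a * Complex.I))) := by
    intro k _
    rw [Complex.ofReal_sub, Complex.ofReal_cos, ← hz, ← Complex.exp_neg, ← Complex.exp_nat_mul,
      ← Complex.exp_nat_mul, ← Complex.exp_add, ← Complex.exp_add, Complex.cos, Complex.cos]
    have e1 : ((a + 2 * (k * π / d) : ℝ) : ℂ) * Complex.I =
      k * (2 * π * Complex.I / d) + a * Complex.I := by push_cast; ring
    have e2 : -((a + 2 * (k * π / d) : ℝ) : ℂ) * Complex.I =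
      k * -(2 * π * Complex.I / d) + -a * Complex.I := by push_cast; ring
    rw [e1, e2]
    have f1 : Complex.exp (-z * Complex.I) * Complex.exp (z * Complex.I) = 1 := by
      rw [← Complex.exp_add]; simp
    have f2 : Complex.exp (k * (2 * π * Complex.I / d) + a * Complex.I) *
        Complex.exp (k * -(2 * π * Complex.I / d) + -a * Complex.I) = 1 := by
      rw [← Complex.exp_add]; ring_nf; simp
    generalize Complex.exp (k * (2 * π * Complex.I / d) + a * Complex.I) = A at *
    generalize Complex.exp (k * -(2 * π * Complex.I / d) + -a * Complex.I) = B at *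
    generalize Complex.exp (-z * Complex.I) = W at *
    generalize Complex.exp (z * Complex.I) = V at *
    linear_combination (-V / 2 + A / 2 + B / 2) * f1 - W / 2 * f2
  have : ((2 ^ d * ∏ k ∈ Finset.range d, (t - cos (a + 2 * (k * π / d))) : ℝ) : ℂ) =
      ((2 * ((Polynomial.Chebyshev.T ℝ d).eval t - cos (d * a)) : ℝ) : ℂ) := by
    rw [Complex.ofReal_mul, Complex.ofReal_prod, Finset.prod_congr rfl hk, Finset.prod_mul_distrib,
      Finset.prod_mul_distrib, ← h1, ← h2, Finset.prod_const, Finset.card_range,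
      Complex.ofReal_mul, Complex.ofReal_sub, hT, div_pow, ← Complex.exp_nat_mul,
      ← Complex.exp_nat_mul, ← Complex.exp_nat_mul, ← Complex.exp_nat_mul, Complex.ofReal_cos,
      Complex.cos, Complex.cos]
    have e1 : ((d * a : ℝ) : ℂ) * Complex.I = d * (a * Complex.I) := by push_cast; ring
    have e2 : -((d * a : ℝ) : ℂ) * Complex.I = d * (-a * Complex.I) := by push_cast; ring
    have e3 : (d * z) * Complex.I = d * (z * Complex.I) := by ring
    have e4 : -(d * z) * Complex.I = d * (-z * Complex.I) := by ring
    rw [e1, e2, e3, e4]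
    have f1 : Complex.exp (d * (-z * Complex.I)) * Complex.exp (d * (z * Complex.I)) = 1 := by
      rw [← Complex.exp_add]; ring_nf; simp
    have f2 : Complex.exp (d * (a * Complex.I)) * Complex.exp (d * (-a * Complex.I)) = 1 := by
      rw [← Complex.exp_add]; ring_nf; simp
    generalize Complex.exp (d * (a * Complex.I)) = A at *
    generalize Complex.exp (d * (-a * Complex.I)) = B at *
    generalize Complex.exp (d * (-z * Complex.I)) = W at *
    generalize Complex.exp (d * (z * Complex.I)) = V at *
    have hp : ((2 ^ d : ℝ) : ℂ) ≠ 0 := by simp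
    push_cast at hp ⊢
    field_simp
    linear_combination (V - A - B) * f1 + W * f2
  exact_mod_cast this

/-! ### The lines and their product -/

/-- The affine form `cos φ y - sin φ x + sin 3φ`, vanishing on the line of direction `φ`
tangent to the deltoid. -/
def tangentForm (φ : ℝ) (p : ℝ × ℝ) : ℝ := cos φ * p.2 - sin φ * p.1 + sin (3 * φ)

/-- The point `e^{-2iφ} + 2t e^{iφ}` of the tangent line of direction `φ`. -/
def chord (φ t : ℝ) : ℝ × ℝ := (cos (2 * φ) + 2 * t * cos φ, -sin (2 * φ) + 2 * t * sin φ)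

/-- The phase `μ + π/6`. -/
def phase (μ : ℝ) : ℝ := μ + π / 6

/-- The index set of the lines. -/
def idx (d : ℕ) : Finset ℤ := Finset.Icc (-(((d : ℤ) - 2) / 2)) (((d : ℤ) + 1) / 2)

/-- Along the tangent of direction φ the form of direction ψ is affine in t, with slope 2 sin(φ − ψ)
and zero at the crossing of the two tangents. The split into a factor free of t and one depending
only on t − cos(φ + 2ψ) makes the product over all lines computable. -/
lemma tangentForm_chord (ψ φ t : ℝ) :
    tangentForm ψ (chord φ t) = 2 * sin (φ - ψ) * (t - cos (φ + 2 * ψ)) := by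
  simp only [tangentForm, chord, sin_sub, cos_add, cos_two_mul, sin_two_mul, sin_three_mul]
  have h1 := sin_sq_add_cos_sq φ
  have h2 := sin_sq_add_cos_sq ψ
  generalize sin φ = a at *
  generalize cos φ = b at *
  generalize sin ψ = u at *
  generalize cos ψ = v at *
  linear_combination (4 * a * b * v - 4 * u) * h2 - 4 * u * v ^ 2 * h1

/-- The parameter is half the component of p − e^{−2iφ} along e^{iφ}, and e^{−2iφ} has component cos
3φ. -/
lemma eq_chord_of_tangentForm_eq_zero {φ : ℝ} {p : ℝ × ℝ} (h : tangentForm φ p = 0) :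
    p = chord φ ((cos φ * p.1 + sin φ * p.2 - cos (3 * φ)) / 2) := by
  simp only [tangentForm, chord, cos_two_mul, sin_two_mul, sin_three_mul, cos_three_mul] at *
  have h1 := sin_sq_add_cos_sq φ
  ext
  · simp only
    generalize sin φ = a at *
    generalize cos φ = b at *
    linear_combination (-a) * h + (-p.1 - 4 * a ^ 2 + 4 * b ^ 2 - 1) * h1
  · simp only
    generalize sin φ = a at *
    generalize cos φ = b at *
    linear_combination b * h + (-p.2 + 4 * a * b) * h1

lemma tangentForm_add_pi (φ : ℝ) (p : ℝ × ℝ) : tangentForm (φ + π) p = -tangentForm φ p := by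
  have : 3 * (φ + π) = 3 * φ + π + 2 * π := by ring
  simp only [tangentForm, this, sin_add_two_pi, sin_add_pi, cos_add_pi]
  ring

/-- The form changes sign under φ ↦ φ + π, so by continuity some tangent passes through every point
of the plane. -/
lemma exists_eq_chord (p : ℝ × ℝ) : ∃ φ t, p = chord φ t := by
  have hc : Continuous fun φ => tangentForm φ p := by unfold tangentForm; fun_prop
  have h := tangentForm_add_pi 0 p
  rw [zero_add] at h
  obtain ⟨φ, hφ⟩ : ∃ φ, tangentForm φ p = 0 := by
    apply mem_range_of_exists_le_of_exists_ge hc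
    · rcases le_total (tangentForm 0 p) 0 with h0 | h0
      · exact ⟨0, h0⟩
      · exact ⟨π, by linarith⟩
    · rcases le_total (tangentForm 0 p) 0 with h0 | h0
      · exact ⟨π, by linarith⟩
      · exact ⟨0, h0⟩
  exact ⟨φ, _, eq_chord_of_tangentForm_eq_zero hφ⟩

lemma prod_idx {M : Type*} [CommMonoid M] {d : ℕ} (hd : 1 ≤ d) (f : ℤ → M) :
    ∏ s ∈ idx d, f s = ∏ k ∈ Finset.range d, f (-(((d : ℤ) - 2) / 2) + k) := by
  symm
  refine Finset.prod_nbij' (fun k : ℕ => -(((d : ℤ) - 2) / 2) + k)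
    (fun s => (s + (((d : ℤ) - 2) / 2)).toNat) ?_ ?_ ?_ ?_ ?_
  · intro k hk
    simp only [idx, Finset.mem_range, Finset.mem_Icc] at *
    omega
  · intro k hk
    simp only [idx, Finset.mem_range, Finset.mem_Icc] at *
    omega
  · intro k hk
    simp
  · intro k hk
    simp only [idx, Finset.mem_Icc] at *
    omega
  · intros; rfl

lemma card_idx {d : ℕ} (hd : 1 ≤ d) : (idx d).card = d := by
  simp only [idx, Int.card_Icc]; omega

lemma mul_angle {d : ℕ} (hd : 1 ≤ d) (μ : ℝ) (s : ℤ) : d * angle d μ s = s * π - phase μ := by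
  have hdr : (d : ℝ) ≠ 0 := by positivity
  simp only [angle, phase]; field_simp; ring

lemma angle_add (d : ℕ) (hd : 1 ≤ d) (μ : ℝ) (s k : ℤ) :
    angle d μ (s + k) = angle d μ s + k * π / d := by
  have hdr : (d : ℝ) ≠ 0 := by positivity
  simp only [angle]; push_cast; field_simp; ring

lemma prod_sin_sub_angle {d : ℕ} (hd : 1 ≤ d) (μ : ℝ) :
    ∃ c : ℝ, c ≠ 0 ∧ ∀ φ : ℝ, ∏ s ∈ idx d, sin (φ - angle d μ s) =
      c * sin (d * φ + phase μ) := by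
  obtain ⟨c, hc, h⟩ := prod_sin_sub hd (angle d μ (-(((d : ℤ) - 2) / 2)))
  refine ⟨c * (-1) ^ (-(((d : ℤ) - 2) / 2)), mul_ne_zero hc (zpow_ne_zero _ (by norm_num)),
    fun φ => ?_⟩
  rw [prod_idx hd]
  have := h φ
  rw [mul_sub, mul_angle hd, show d * φ - ((-(((d : ℤ) - 2) / 2) : ℤ) * π - phase μ) =
    d * φ + phase μ - (-(((d : ℤ) - 2) / 2) : ℤ) * π by ring, sin_sub_int_mul_pi] at this
  rw [mul_assoc, ← this]
  refine Finset.prod_congr rfl fun k _ => ?_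
  rw [angle_add d hd]
  simp

lemma two_pow_mul_prod_sub_cos_angle {d : ℕ} (hd : 1 ≤ d) (μ t φ : ℝ) :
    2 ^ d * ∏ s ∈ idx d, (t - cos (φ + 2 * angle d μ s)) =
      2 * ((Polynomial.Chebyshev.T ℝ d).eval t - cos (d * φ - 2 * phase μ)) := by
  have h := two_pow_mul_prod_sub_cos hd t (φ + 2 * angle d μ (-(((d : ℤ) - 2) / 2)))
  rw [show d * (φ + 2 * angle d μ (-(((d : ℤ) - 2) / 2))) =
    d * φ - 2 * phase μ + (-(((d : ℤ) - 2) / 2) : ℤ) * (2 * π) by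
      rw [mul_add, mul_left_comm, mul_angle hd]; ring, cos_add_int_mul_two_pi] at h
  rw [← h, prod_idx hd]
  congr 1
  refine Finset.prod_congr rfl fun k _ => ?_
  rw [angle_add d hd]
  push_cast
  ring_nf

lemma lineForm_of_cos_ne_zero {d : ℕ} {μ : ℝ} {s : ℤ} (h : cos (angle d μ s) ≠ 0) (p : ℝ × ℝ) :
    lineForm d μ s p = tangentForm (angle d μ s) p / cos (angle d μ s) := by
  rw [lineForm, if_neg h, tangentForm, tan_eq_sin_div_cos, cos_two_mul, sin_two_mul, sin_three_mul]
  have h1 := sin_sq_add_cos_sq (angle d μ s)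
  field_simp
  generalize sin (angle d μ s) = a at *
  generalize cos (angle d μ s) = b at *
  linear_combination (4 * a) * h1

lemma lineForm_of_cos_eq_zero {d : ℕ} {μ : ℝ} {s : ℤ} (h : cos (angle d μ s) = 0) (p : ℝ × ℝ) :
    lineForm d μ s p = -sin (angle d μ s) * tangentForm (angle d μ s) p := by
  rw [lineForm, if_pos h, tangentForm, sin_three_mul, h]
  have h1 := sin_sq_add_cos_sq (angle d μ s)
  rw [h] at h1
  generalize sin (angle d μ s) = a at *
  linear_combination (-(p.1) -4 * a^2-1) * h1

lemma sin_sub_angle_ne_zero {d : ℕ} (hd : 1 ≤ d) (μ : ℝ) {s r : ℤ} (hs : s ∈ idx d) (hr : r ∈ idx d)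
    (h : s ≠ r) : sin (angle d μ s - angle d μ r) ≠ 0 := by
  have hdr : (d : ℝ) ≠ 0 := by positivity
  intro h0
  obtain ⟨n, hn⟩ := sin_eq_zero_iff.1 h0
  have h1 := mul_angle hd μ s
  have h2 := mul_angle hd μ r
  have h3 : (d * n : ℝ) * π = (s - r) * π := by linear_combination h1 - h2 + d * hn
  have h4 := mul_right_cancel₀ pi_ne_zero h3
  have h5 : (d : ℤ) * n = s - r := by exact_mod_cast h4
  simp only [idx, Finset.mem_Icc] at hs hr
  have : n = 0 := by
    by_contra hn0
    have h6 : |(d : ℤ) * n| = d * |n| := by rw [abs_mul]; simp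
    have h7 : 1 ≤ |n| := Int.one_le_abs hn0
    have h8 : (d : ℤ) ≤ |s - r| := by rw [← h5, h6]; nlinarith
    have h9 : |s - r| < d := by rw [abs_lt]; omega
    omega
  simp [this] at h5
  omega

/-- Each affine form is a tangent form divided by cos φ_s, so the claim is that the normalising
factor equals −2/c times the product of these cosines. A vertical line replaces its cosine by a
derivative of the sine product; this is the reason for the special value ±2d. -/
lemma exists_P_eq_prod {d : ℕ} (hd : 1 ≤ d) (μ : ℝ) :
    ∃ c : ℝ, c ≠ 0 ∧ (∀ φ : ℝ, ∏ s ∈ idx d, sin (φ - angle d μ s) = c * sin (d * φ + phase μ)) ∧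
      ∀ p, P d μ p = -2 / c * ∏ s ∈ idx d, tangentForm (angle d μ s) p := by
  obtain ⟨c, hc, h⟩ := prod_sin_sub_angle hd μ
  refine ⟨c, hc, h, fun p => ?_⟩
  have hdr : (d : ℝ) ≠ 0 := by positivity
  change scale d μ * ∏ s ∈ idx d, lineForm d μ s p = _
  by_cases hv : ∃ s₀ ∈ idx d, cos (angle d μ s₀) = 0
  · obtain ⟨s₀, hs₀, hcos⟩ := hv
    have hsq : sin (angle d μ s₀) ^ 2 = 1 := by
      have := sin_sq_add_cos_sq (angle d μ s₀); rw [hcos] at this; linarith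
    -- Both sides are the derivative of the sine product at its simple zero φ_{s₀}.
    have hrest : ∏ s ∈ (idx d).erase s₀, sin (angle d μ s₀ - angle d μ s) =
        c * (cos (s₀ * π) * d) := by
      have h1 : HasDerivAt (fun φ => c * sin (d * φ + phase μ)) (c * (cos (s₀ * π) * d))
          (angle d μ s₀) := by
        have h2 : HasDerivAt (fun φ => d * φ + phase μ) (d : ℝ) (angle d μ s₀) := by
          simpa using ((hasDerivAt_id (angle d μ s₀)).const_mul (d : ℝ)).add_const (phase μ)
        have h3 := (h2.sin).const_mul c
        rwa [show d * angle d μ s₀ + phase μ = s₀ * π by rw [mul_angle hd]; ring] at h3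
      have h4 : DifferentiableAt ℝ (fun φ => ∏ s ∈ (idx d).erase s₀, sin (φ - angle d μ s))
          (angle d μ s₀) := by fun_prop
      have h5 : HasDerivAt (fun φ => sin (φ - angle d μ s₀)) (1 : ℝ) (angle d μ s₀) := by
        simpa using ((hasDerivAt_id (angle d μ s₀)).sub_const (angle d μ s₀)).sin
      have h6 := h5.mul h4.hasDerivAt
      have h7 : (fun φ => c * sin (d * φ + phase μ)) = (fun φ => sin (φ - angle d μ s₀)) *
          fun φ => ∏ s ∈ (idx d).erase s₀, sin (φ - angle d μ s) := by
        funext φ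
        rw [← h, ← Finset.mul_prod_erase _ _ hs₀]; rfl
      rw [h7] at h1
      have h8 := h6.unique h1
      simpa using h8
    have hcosne : ∀ s ∈ (idx d).erase s₀, cos (angle d μ s) ≠ 0 := by
      intro s hs h0
      have h1 := sin_sub_angle_ne_zero hd μ hs₀ (Finset.mem_of_mem_erase hs)
        (Finset.ne_of_mem_erase hs).symm
      rw [sin_sub, h0, hcos] at h1
      simp at h1
    have hprodcos : sin (angle d μ s₀) ^ (d - 1) * ∏ s ∈ (idx d).erase s₀, cos (angle d μ s) =
        c * (cos (s₀ * π) * d) := by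
      rw [← hrest, show sin (angle d μ s₀) ^ (d - 1) =
        ∏ _s ∈ (idx d).erase s₀, sin (angle d μ s₀) by
          rw [Finset.prod_const, Finset.card_erase_of_mem hs₀, card_idx hd],
        ← Finset.prod_mul_distrib]
      refine Finset.prod_congr rfl fun s _ => ?_
      rw [sin_sub, hcos]; ring
    have hscale : scale d μ = sin (angle d μ s₀) ^ d * cos (s₀ * π) * (2 * d) := by
      obtain ⟨k, hk⟩ := cos_eq_zero_iff.1 hcos
      have hμ := mul_angle hd μ s₀
      have hm : IsVerticalParam d μ (s₀ - d * k) := by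
        rw [IsVerticalParam]
        rw [hk, phase] at hμ
        push_cast
        linear_combination hμ
      have hex : ∃ m : ℤ, IsVerticalParam d μ m := ⟨_, hm⟩
      have huniq : Classical.choose hex = s₀ - d * k := by
        have h1 := Classical.choose_spec hex
        rw [IsVerticalParam] at h1 hm
        have h2 : ((Classical.choose hex : ℤ) : ℝ) * π = ((s₀ - d * k : ℤ) : ℝ) * π := by
          linear_combination hm - h1
        exact_mod_cast mul_right_cancel₀ pi_ne_zero h2
      have hsin : sin (angle d μ s₀) = (-1) ^ k := by
        rw [hk, show (2 * (k : ℝ) + 1) * π / 2 = π / 2 + k * π by ring, sin_add_int_mul_pi]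
        simp
      rw [scale, dif_pos hex, huniq, hsin, cos_int_mul_pi, zpow_sub₀ (by norm_num), mul_comm (d : ℤ),
        zpow_mul, zpow_natCast]
      have h3 : (((-1 : ℝ) ^ k) ^ d) * ((-1 : ℝ) ^ k) ^ d = 1 := by
        rw [← mul_pow, ← mul_zpow]; simp
      have h4 : ((-1 : ℝ) ^ k) ^ d ≠ 0 := fun h => by simp [h] at h3
      field_simp
      linear_combination (-1) * h3
    rw [← Finset.mul_prod_erase _ _ hs₀, ← Finset.mul_prod_erase _ _ hs₀,
      lineForm_of_cos_eq_zero hcos, Finset.prod_congr rfl fun s hs =>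
        lineForm_of_cos_ne_zero (hcosne s hs) p, Finset.prod_div_distrib, hscale]
    have hne : ∏ s ∈ (idx d).erase s₀, cos (angle d μ s) ≠ 0 := Finset.prod_ne_zero_iff.2 hcosne
    have hcc : cos (s₀ * π) * cos (s₀ * π) = 1 := by
      rw [cos_int_mul_pi, ← mul_zpow]; simp
    have hdpow : sin (angle d μ s₀) ^ d = sin (angle d μ s₀) ^ (d - 1) * sin (angle d μ s₀) := by
      rw [← pow_succ]; congr 1; omega
    generalize ∏ s ∈ (idx d).erase s₀, cos (angle d μ s) = Q at *
    generalize ∏ s ∈ (idx d).erase s₀, tangentForm (angle d μ s) p = R at *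
    generalize tangentForm (angle d μ s₀) p = N at *
    have hs1 : (sin (angle d μ s₀) ^ (d - 1)) ^ 2 = 1 := by
      rw [← pow_mul, mul_comm, pow_mul, hsq, one_pow]
    rw [hdpow]
    generalize sin (angle d μ s₀) ^ (d - 1) = u at *
    generalize sin (angle d μ s₀) = e at *
    generalize cos (s₀ * π) = g at *
    have hQ : Q = u * (c * (g * d)) := by linear_combination u * hprodcos - Q * hs1
    have hu : u ≠ 0 := fun h => by simp [h] at hs1
    have hg : g ≠ 0 := fun h => by simp [h] at hcc
    rw [hQ]
    field_simp
    linear_combination (-N * R) * hsq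
  · push Not at hv
    -- Evaluate the sine product at φ = −π/2, where each factor is −cos φ_s.
    have hcosprod : ∏ s ∈ idx d, cos (angle d μ s) = (-1) ^ d * (c * sin (d * (-(π / 2)) + phase μ)) := by
      rw [← h, show ((-1 : ℝ)) ^ d = ∏ _s ∈ idx d, (-1 : ℝ) by rw [Finset.prod_const, card_idx hd],
        ← Finset.prod_mul_distrib]
      refine Finset.prod_congr rfl fun s _ => ?_
      rw [show -(π / 2) - angle d μ s = -(angle d μ s + π / 2) by ring, sin_neg, sin_add_pi_div_two]
      ring
    have hne : ∏ s ∈ idx d, cos (angle d μ s) ≠ 0 := Finset.prod_ne_zero_iff.2 hv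
    have hscale : scale d μ = -2 * ((-1) ^ d * sin (d * (-(π / 2)) + phase μ)) := by
      have : ¬ ∃ m : ℤ, IsVerticalParam d μ m := by
        rintro ⟨m, hm⟩
        apply hne
        rw [hcosprod, IsVerticalParam] at *
        rw [show d * (-(π / 2)) + phase μ = ((m - d : ℤ) : ℝ) * π by
          rw [phase, hm]; push_cast; ring, sin_int_mul_pi]
        ring
      rw [scale, dif_neg this, show μ + d * π / 2 + 2 * π / 3 = d * (-(π / 2)) + phase μ + π / 2 +
        d * π by rw [phase]; ring, cos_add_nat_mul_pi, cos_add_pi_div_two]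
      ring
    rw [Finset.prod_congr rfl fun s hs => lineForm_of_cos_ne_zero (hv s hs) p,
      Finset.prod_div_distrib]
    have h2 : -2 / c * (∏ s ∈ idx d, cos (angle d μ s)) = scale d μ := by
      rw [hcosprod, hscale]; field_simp
    rw [← h2]
    field_simp

lemma P_chord {d : ℕ} (hd : 1 ≤ d) (μ φ t : ℝ) :
    P d μ (chord φ t) = -4 * sin (d * φ + phase μ) *
      ((Polynomial.Chebyshev.T ℝ d).eval t - cos (d * φ - 2 * phase μ)) := by
  obtain ⟨c, hc, h, hP⟩ := exists_P_eq_prod hd μ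
  have h2 := two_pow_mul_prod_sub_cos_angle hd μ t φ
  rw [hP]
  simp only [tangentForm_chord, Finset.prod_mul_distrib]
  rw [h, Finset.prod_const, card_idx hd]
  field_simp
  linear_combination -2 * sin (d * φ + phase μ) * h2

/-! ### Crossings of the lines -/

/-- The common point of the tangent lines of directions `φ` and `ψ`. -/
def crossPoint (φ ψ : ℝ) : ℝ × ℝ :=
  (cos (2 * φ) + cos (2 * ψ) + cos (2 * φ + 2 * ψ), -sin (2 * φ) - sin (2 * ψ) + sin (2 * φ + 2 * ψ))

/-- `φ` is the direction of a line of the system of phase `κ` through `p`. -/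
def IsLineThrough (d : ℕ) (κ φ : ℝ) (p : ℝ × ℝ) : Prop :=
  sin (d * φ + κ) = 0 ∧ tangentForm φ p = 0

/-- `p` lies on the three lines of directions `φ₁, φ₂, φ₃` of the system of phase `κ`. -/
structure IsTriplePoint (d : ℕ) (κ φ₁ φ₂ φ₃ : ℝ) (p : ℝ × ℝ) : Prop where
  ne₁₂ : sin (φ₁ - φ₂) ≠ 0
  ne₂₃ : sin (φ₂ - φ₃) ≠ 0
  ne₃₁ : sin (φ₃ - φ₁) ≠ 0
  line₁ : IsLineThrough d κ φ₁ p
  line₂ : IsLineThrough d κ φ₂ p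
  line₃ : IsLineThrough d κ φ₃ p

/-- Points on at least three lines of the system of phase `κ`. -/
def triplePoints (d : ℕ) (κ : ℝ) : Set (ℝ × ℝ) := {p | ∃ φ₁ φ₂ φ₃, IsTriplePoint d κ φ₁ φ₂ φ₃ p}

/-- Points that are triple points for some phase. -/
def allTriplePoints (d : ℕ) : Set (ℝ × ℝ) := {p | ∃ κ, p ∈ triplePoints d κ}

/-- Points on at least two lines of the system of phase `κ`. -/
def crossings (d : ℕ) (κ : ℝ) : Set (ℝ × ℝ) :=
  {p | ∃ φ ψ, sin (φ - ψ) ≠ 0 ∧ IsLineThrough d κ φ p ∧ IsLineThrough d κ ψ p}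

lemma chord_eq_crossPoint (φ ψ : ℝ) : chord φ (cos (φ + 2 * ψ)) = crossPoint φ ψ := by
  have h1 := sin_sq_add_cos_sq φ
  simp only [chord, crossPoint, cos_add, sin_add, cos_two_mul, sin_two_mul]
  ext <;> simp only <;> generalize sin φ = a at * <;> generalize cos φ = b at *
  · ring
  · linear_combination (-4 * sin ψ * cos ψ) * h1

lemma crossPoint_comm (φ ψ : ℝ) : crossPoint φ ψ = crossPoint ψ φ := by
  simp only [crossPoint, add_comm (2 * φ) (2 * ψ)]; ext <;> simp only <;> ring

lemma crossPoint_add_int_mul_pi (φ ψ : ℝ) (n : ℤ) :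
    crossPoint (φ + n * π) ψ = crossPoint φ ψ := by
  have h1 : 2 * (φ + n * π) = 2 * φ + n * (2 * π) := by ring
  have h2 : 2 * φ + n * (2 * π) + 2 * ψ = 2 * φ + 2 * ψ + n * (2 * π) := by ring
  simp only [crossPoint, h1, h2, cos_add_int_mul_two_pi, sin_add_int_mul_two_pi]

lemma crossPoint_congr {φ φ' ψ ψ' : ℝ} (h : sin (φ - φ') = 0) (h' : sin (ψ - ψ') = 0) :
    crossPoint φ ψ = crossPoint φ' ψ' := by
  obtain ⟨n, hn⟩ := sin_eq_zero_iff.1 h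
  obtain ⟨m, hm⟩ := sin_eq_zero_iff.1 h'
  rw [show φ = φ' + n * π by linarith, show ψ = ψ' + m * π by linarith, crossPoint_add_int_mul_pi,
    crossPoint_comm, crossPoint_add_int_mul_pi, crossPoint_comm]

lemma tangentForm_crossPoint_left (φ ψ : ℝ) : tangentForm φ (crossPoint φ ψ) = 0 := by
  rw [← chord_eq_crossPoint, tangentForm_chord]; simp

lemma tangentForm_crossPoint_right (φ ψ : ℝ) : tangentForm ψ (crossPoint φ ψ) = 0 := by
  rw [crossPoint_comm, tangentForm_crossPoint_left]

lemma eq_crossPoint {φ ψ : ℝ} {p : ℝ × ℝ} (h : sin (φ - ψ) ≠ 0) (h₁ : tangentForm φ p = 0)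
    (h₂ : tangentForm ψ p = 0) : p = crossPoint φ ψ := by
  rw [eq_chord_of_tangentForm_eq_zero h₁] at h₂ ⊢
  generalize (cos φ * p.1 + sin φ * p.2 - cos (3 * φ)) / 2 = t at *
  rw [tangentForm_chord] at h₂
  have : t = cos (φ + 2 * ψ) := by
    rcases mul_eq_zero.1 h₂ with h3 | h3
    · simp [h] at h3
    · linarith
  rw [this, chord_eq_crossPoint]

/-- The concurrency criterion: for pairwise distinct directions modulo π, only the symmetric factor
sin(φ + ψ + χ) can vanish. -/
lemma tangentForm_crossPoint (φ ψ χ : ℝ) :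
    tangentForm χ (crossPoint φ ψ) = -4 * sin (χ - φ) * sin (χ - ψ) * sin (φ + ψ + χ) := by
  rw [← chord_eq_crossPoint, tangentForm_chord, cos_sub_cos,
    show (φ + 2 * ψ + (φ + 2 * χ)) / 2 = φ + ψ + χ by ring,
    show (φ + 2 * ψ - (φ + 2 * χ)) / 2 = -(χ - ψ) by ring, show φ - χ = -(χ - φ) by ring,
    sin_neg, sin_neg]
  ring

lemma tangentForm_congr {φ ψ : ℝ} (h : sin (φ - ψ) = 0) (p : ℝ × ℝ) :
    tangentForm φ p = 0 ↔ tangentForm ψ p = 0 := by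
  have key : ∀ {φ ψ : ℝ}, sin (φ - ψ) = 0 → tangentForm ψ p = 0 → tangentForm φ p = 0 := by
    intro φ ψ h h1
    rw [eq_chord_of_tangentForm_eq_zero h1, tangentForm_chord, show ψ - φ = -(φ - ψ) by ring,
      sin_neg, h]
    simp
  exact ⟨key (by rw [show ψ - φ = -(φ - ψ) by ring, sin_neg, h, neg_zero]), key h⟩

lemma sin_eq_zero_iff_exists_angle {d : ℕ} (hd : 1 ≤ d) (μ φ : ℝ) :
    sin (d * φ + phase μ) = 0 ↔ ∃ s ∈ idx d, sin (φ - angle d μ s) = 0 := by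
  obtain ⟨c, hc, h⟩ := prod_sin_sub_angle hd μ
  rw [← Finset.prod_eq_zero_iff, h, mul_eq_zero, or_iff_right hc]

lemma sin_sub_eq_zero_trans {a b c : ℝ} (h : sin (a - b) = 0) (h' : sin (b - c) = 0) :
    sin (a - c) = 0 := by
  rw [show a - c = (a - b) + (b - c) by ring, sin_add, h, h']; simp

lemma sin_sub_eq_zero_symm {a b : ℝ} (h : sin (a - b) = 0) : sin (b - a) = 0 := by
  rw [show b - a = -(a - b) by ring, sin_neg, h, neg_zero]

lemma isLineThrough_angle {d : ℕ} (hd : 1 ≤ d) {μ : ℝ} {s : ℤ} {p : ℝ × ℝ} (hs : s ∈ idx d)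
    (h : tangentForm (angle d μ s) p = 0) : IsLineThrough d (phase μ) (angle d μ s) p :=
  ⟨(sin_eq_zero_iff_exists_angle hd μ _).2 ⟨s, hs, by simp⟩, h⟩

lemma mem_crossings_iff {d : ℕ} (hd : 1 ≤ d) {μ : ℝ} {p : ℝ × ℝ} :
    p ∈ crossings d (phase μ) ↔ ∃ s ∈ idx d, ∃ r ∈ idx d, s < r ∧
      p = crossPoint (angle d μ s) (angle d μ r) := by
  constructor
  · rintro ⟨φ, ψ, hne, ⟨h1, h2⟩, ⟨h3, h4⟩⟩
    obtain ⟨s, hs, hs'⟩ := (sin_eq_zero_iff_exists_angle hd μ φ).1 h1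
    obtain ⟨r, hr, hr'⟩ := (sin_eq_zero_iff_exists_angle hd μ ψ).1 h3
    have hp : p = crossPoint (angle d μ s) (angle d μ r) :=
      (eq_crossPoint hne h2 h4).trans (crossPoint_congr hs' hr')
    rcases lt_trichotomy s r with h | h | h
    · exact ⟨s, hs, r, hr, h, hp⟩
    · subst h
      exact absurd (sin_sub_eq_zero_trans hs' (sin_sub_eq_zero_symm hr')) hne
    · exact ⟨r, hr, s, hs, h, by rw [crossPoint_comm]; exact hp⟩
  · rintro ⟨s, hs, r, hr, hsr, rfl⟩
    exact ⟨_, _, sin_sub_angle_ne_zero hd μ hs hr hsr.ne,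
      isLineThrough_angle hd hs (tangentForm_crossPoint_left _ _),
      isLineThrough_angle hd hr (tangentForm_crossPoint_right _ _)⟩

/-! ### Trigonometric relations at a triple point -/

namespace IsTriplePoint

variable {d : ℕ} {κ φ₁ φ₂ φ₃ : ℝ} {p : ℝ × ℝ}

lemma rotate (h : IsTriplePoint d κ φ₁ φ₂ φ₃ p) : IsTriplePoint d κ φ₂ φ₃ φ₁ p :=
  ⟨h.ne₂₃, h.ne₃₁, h.ne₁₂, h.line₂, h.line₃, h.line₁⟩

lemma eq_crossPoint (h : IsTriplePoint d κ φ₁ φ₂ φ₃ p) : p = crossPoint φ₁ φ₂ :=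
  DeltoidHamiltonian.eq_crossPoint h.ne₁₂ h.line₁.2 h.line₂.2

lemma sin_sum (h : IsTriplePoint d κ φ₁ φ₂ φ₃ p) : sin (φ₁ + φ₂ + φ₃) = 0 := by
  have h3 := h.line₃.2
  rw [h.eq_crossPoint, tangentForm_crossPoint] at h3
  have h1 := h.ne₃₁
  have h2 : sin (φ₃ - φ₂) ≠ 0 := fun h0 => h.ne₂₃ (sin_sub_eq_zero_symm h0)
  simpa [h1, h2] using h3

lemma sin_mul_sum (h : IsTriplePoint d κ φ₁ φ₂ φ₃ p) : sin (d * (φ₁ + φ₂ + φ₃)) = 0 := by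
  obtain ⟨n, hn⟩ := sin_eq_zero_iff.1 h.sin_sum
  rw [← hn, sin_eq_zero_iff]
  exact ⟨d * n, by push_cast; ring⟩

/-- Add the three conditions dφᵢ + κ ∈ πℤ and subtract d(φ₁ + φ₂ + φ₃) ∈ πℤ. -/
lemma sin_three_mul_phase (h : IsTriplePoint d κ φ₁ φ₂ φ₃ p) : sin (3 * κ) = 0 := by
  rw [show 3 * κ = (d * φ₁ + κ) + (d * φ₂ + κ) + (d * φ₃ + κ) - d * (φ₁ + φ₂ + φ₃) by ring,
    sin_sub, sin_add, sin_add, h.sin_mul_sum, h.line₁.1, h.line₂.1, h.line₃.1]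
  simp

lemma sin_three_mul (h : IsTriplePoint d κ φ₁ φ₂ φ₃ p) : sin (3 * (d * φ₁)) = 0 := by
  have h1 : sin (2 * (d * φ₁ + κ)) = 0 := by rw [sin_two_mul, h.line₁.1]; simp
  rw [show 3 * (d * φ₁) = (d * φ₁ + κ) + 2 * (d * φ₁ + κ) - 3 * κ by ring, sin_sub, sin_add,
    h.sin_three_mul_phase, h.line₁.1, h1]
  simp

lemma congr_phase {κ' : ℝ} (h : IsTriplePoint d κ φ₁ φ₂ φ₃ p) (hκ : sin (κ' - κ) = 0) :
    IsTriplePoint d κ' φ₁ φ₂ φ₃ p := by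
  have key : ∀ {φ}, IsLineThrough d κ φ p → IsLineThrough d κ' φ p := fun {φ} hl =>
    ⟨by rw [show d * φ + κ' = (d * φ + κ) + (κ' - κ) by ring, sin_add, hl.1, hκ]; simp, hl.2⟩
  exact ⟨h.ne₁₂, h.ne₂₃, h.ne₃₁, key h.line₁, key h.line₂, key h.line₃⟩

/-- The deltoid has class three: no fourth tangent passes through the point. -/
lemma eq_line (h : IsTriplePoint d κ φ₁ φ₂ φ₃ p) {ψ : ℝ} (hψ : tangentForm ψ p = 0) :
    sin (ψ - φ₁) = 0 ∨ sin (ψ - φ₂) = 0 ∨ sin (ψ - φ₃) = 0 := by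
  rw [h.eq_crossPoint, tangentForm_crossPoint] at hψ
  have h3 : sin (φ₁ + φ₂ + ψ) = 0 → sin (ψ - φ₃) = 0 := by
    intro h4
    rw [show ψ - φ₃ = (φ₁ + φ₂ + ψ) - (φ₁ + φ₂ + φ₃) by ring, sin_sub, h4, h.sin_sum]
    simp
  simp only [mul_eq_zero, neg_eq_zero, OfNat.ofNat_ne_zero, false_or] at hψ
  tauto

/-- Any line of phase κ' through the point is one of its three tangents, whose direction already
fixes the phase modulo π. -/
lemma phase_eq (h : IsTriplePoint d κ φ₁ φ₂ φ₃ p) {κ' ψ : ℝ} (hψ : IsLineThrough d κ' ψ p) :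
    sin (κ' - κ) = 0 := by
  have key : ∀ {φ}, IsLineThrough d κ φ p → sin (ψ - φ) = 0 → sin (κ' - κ) = 0 := by
    intro φ hl h0
    obtain ⟨n, hn⟩ := sin_eq_zero_iff.1 h0
    have h1 : sin (d * (ψ - φ)) = 0 := by
      rw [← hn, sin_eq_zero_iff]; exact ⟨d * n, by push_cast; ring⟩
    rw [show κ' - κ = (d * ψ + κ') - (d * φ + κ) - d * (ψ - φ) by ring, sin_sub, sin_sub, h1, hl.1,
      hψ.1]
    simp
  rcases h.eq_line hψ.2 with h0 | h0 | h0
  · exact key h.line₁ h0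
  · exact key h.line₂ h0
  · exact key h.line₃ h0

lemma eq_chord (h : IsTriplePoint d κ φ₁ φ₂ φ₃ p) : p = chord φ₁ (cos (φ₁ + 2 * φ₂)) := by
  rw [chord_eq_crossPoint, h.eq_crossPoint]

/-- The point has parameter cos χ on its first line, with χ = φ₁ + 2φ₂ = (φ₁ + φ₂ + φ₃) + (φ₂ − φ₃).
So sin χ ≠ 0; together with `sin_mul_chord` this makes cos χ a zero of the derivative of T_d. -/
lemma sin_chord_sq (h : IsTriplePoint d κ φ₁ φ₂ φ₃ p) :
    sin (φ₁ + 2 * φ₂) ^ 2 = sin (φ₂ - φ₃) ^ 2 := by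
  have h1 := sin_sq_add_cos_sq (φ₁ + φ₂ + φ₃)
  rw [show φ₁ + 2 * φ₂ = (φ₁ + φ₂ + φ₃) + (φ₂ - φ₃) by ring, sin_add, h.sin_sum]
  rw [h.sin_sum] at h1
  linear_combination sin (φ₂ - φ₃) ^ 2 * h1

lemma sin_mul_chord (h : IsTriplePoint d κ φ₁ φ₂ φ₃ p) : sin (d * (φ₁ + 2 * φ₂)) = 0 := by
  rw [show d * (φ₁ + 2 * φ₂) = d * (φ₁ + φ₂ + φ₃) + ((d * φ₂ + κ) - (d * φ₃ + κ)) by ring,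
    sin_add, sin_sub, h.sin_mul_sum, h.line₂.1, h.line₃.1]
  simp

/-- The right-hand side is symmetric in the three lines. This symmetry makes the second derivatives
along them comparable in `hessian_definite`. -/
lemma cos_mul_sin (h : IsTriplePoint d κ φ₁ φ₂ φ₃ p) (κ' : ℝ) :
    cos (d * (φ₁ + 2 * φ₂)) * sin (d * φ₁ + κ') = cos (d * (φ₁ + φ₂ + φ₃)) *
      (cos (d * φ₁ + κ) * cos (d * φ₂ + κ) * cos (d * φ₃ + κ)) * sin (κ' - κ) := by
  rw [show d * (φ₁ + 2 * φ₂) = d * (φ₁ + φ₂ + φ₃) + ((d * φ₂ + κ) - (d * φ₃ + κ)) by ring,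
    show d * φ₁ + κ' = (d * φ₁ + κ) + (κ' - κ) by ring, cos_add, cos_sub, sin_add (d * φ₁ + κ),
    h.sin_mul_sum, h.line₁.1, h.line₂.1, h.line₃.1]
  ring

end IsTriplePoint

/-- Every line through a triple point satisfies sin(3dφ) = 0, whatever the phase, so modulo π only
3d directions occur. -/
lemma allTriplePoints_finite {d : ℕ} (hd : 1 ≤ d) : (allTriplePoints d).Finite := by
  have hdr : (d : ℝ) ≠ 0 := by positivity
  have key : ∀ φ : ℝ, sin (3 * (d * φ)) = 0 →
      ∃ k ∈ Finset.range (3 * d), sin (φ - (k : ℕ) * (π / (3 * d))) = 0 := by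
    intro φ h
    obtain ⟨n, hn⟩ := sin_eq_zero_iff.1 h
    have hpos : (0 : ℤ) < 3 * d := by positivity
    refine ⟨(n % (3 * d)).toNat, ?_, ?_⟩
    · have h1 := Int.emod_lt_of_pos n hpos
      have h2 := Int.emod_nonneg n hpos.ne'
      rw [Finset.mem_range]; omega
    · have h2 := Int.emod_nonneg n hpos.ne'
      have h3 : (((n % (3 * d)).toNat : ℕ) : ℝ) = ((n % (3 * d) : ℤ) : ℝ) := by
        rw [← Int.cast_natCast, Int.toNat_of_nonneg h2]
      rw [h3, sin_eq_zero_iff]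
      refine ⟨n / (3 * d), ?_⟩
      have h4 := Int.emod_add_mul_ediv n (3 * d)
      have h5 : (((n % (3 * d) : ℤ) : ℝ)) + (3 * d) * ((n / (3 * d) : ℤ) : ℝ) = n := by
        exact_mod_cast h4
      have h6 : φ = n * π / (3 * d) := by field_simp; linarith
      rw [h6, ← h5]
      field_simp
      ring
  refine Set.Finite.subset ((Finset.finite_toSet (Finset.range (3 * d) ×ˢ Finset.range (3 * d))).image
    fun k => crossPoint (k.1 * (π / (3 * d))) (k.2 * (π / (3 * d)))) ?_
  rintro p ⟨κ, φ₁, φ₂, φ₃, h⟩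
  obtain ⟨k₁, hk₁, h₁⟩ := key _ h.sin_three_mul
  obtain ⟨k₂, hk₂, h₂⟩ := key _ h.rotate.sin_three_mul
  refine ⟨(k₁, k₂), by simpa using ⟨Finset.mem_range.1 hk₁, Finset.mem_range.1 hk₂⟩, ?_⟩
  rw [h.eq_crossPoint, crossPoint_congr h₁ h₂]

/-! ### Stationary points -/

/-- The Chebyshev polynomial of the first kind as a real function. -/
def cheb (d : ℕ) (t : ℝ) : ℝ := (Polynomial.Chebyshev.T ℝ d).eval t

/-- The derivative of `cheb`. -/
def chebDeriv (d : ℕ) (t : ℝ) : ℝ := (Polynomial.derivative (Polynomial.Chebyshev.T ℝ d)).eval t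

/-- The second derivative of `cheb`. -/
def chebDeriv₂ (d : ℕ) (t : ℝ) : ℝ :=
  (Polynomial.derivative (Polynomial.derivative (Polynomial.Chebyshev.T ℝ d))).eval t

lemma hasDerivAt_cheb (d : ℕ) (t : ℝ) : HasDerivAt (cheb d) (chebDeriv d t) t :=
  Polynomial.hasDerivAt _ _

lemma hasDerivAt_chebDeriv (d : ℕ) (t : ℝ) : HasDerivAt (chebDeriv d) (chebDeriv₂ d t) t :=
  Polynomial.hasDerivAt _ _

lemma cheb_cos (d : ℕ) (χ : ℝ) : cheb d (cos χ) = cos (d * χ) := by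
  simp [cheb]

lemma chebDeriv_eq {d : ℕ} (hd : 1 ≤ d) (t : ℝ) :
    chebDeriv d t = d * (Polynomial.Chebyshev.U ℝ ((d - 1 : ℕ) : ℤ)).eval t := by
  rw [chebDeriv, Polynomial.Chebyshev.T_derivative_eq_U]
  have : ((d - 1 : ℕ) : ℤ) = (d : ℤ) - 1 := by omega
  simp [this]

lemma chebDeriv_one {d : ℕ} (hd : 1 ≤ d) : chebDeriv d 1 ≠ 0 := by
  rw [chebDeriv_eq hd, Polynomial.Chebyshev.U_eval_one]
  have : (0 : ℝ) < d := by positivity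
  positivity

lemma chebDeriv_cos_eq_zero {d : ℕ} (hd : 1 ≤ d) {χ : ℝ} (h : sin χ ≠ 0) (h' : sin (d * χ) = 0) :
    chebDeriv d (cos χ) = 0 := by
  have h1 := Polynomial.Chebyshev.U_real_cos χ ((d - 1 : ℕ) : ℤ)
  have h2 : (((d - 1 : ℕ) : ℤ) : ℝ) + 1 = d := by
    have : ((d - 1 : ℕ) : ℤ) + 1 = d := by omega
    exact_mod_cast this
  rw [h2, h', mul_eq_zero, or_iff_left h] at h1
  rw [chebDeriv_eq hd, h1, mul_zero]

/-- The derivative is d times the Chebyshev polynomial U of degree d − 1, all of whose roots are the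
cosines cos(kπ/d), 0 < k < d. -/
lemma exists_cos_of_chebDeriv_eq_zero {d : ℕ} (hd : 1 ≤ d) {t : ℝ} (h : chebDeriv d t = 0) :
    ∃ χ, t = cos χ ∧ sin χ ≠ 0 ∧ sin (d * χ) = 0 := by
  have hdr : (d : ℝ) ≠ 0 := by positivity
  rw [chebDeriv_eq hd, mul_eq_zero, or_iff_right hdr] at h
  have hU : Polynomial.Chebyshev.U ℝ ((d - 1 : ℕ) : ℤ) ≠ 0 :=
    Polynomial.Chebyshev.U_ne_zero _ _ (by omega)
  have hmem := (Polynomial.mem_roots hU).2 h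
  rw [Polynomial.Chebyshev.roots_U_real, Finset.mem_val, Finset.mem_image] at hmem
  obtain ⟨k, hk, rfl⟩ := hmem
  rw [Finset.mem_range] at hk
  have h2 : ((d - 1 : ℕ) : ℝ) + 1 = d := by
    have : (d - 1 : ℕ) + 1 = d := by omega
    exact_mod_cast this
  rw [h2]
  have hk' : (k : ℝ) + 1 < d := by
    have : k + 1 < d := by omega
    exact_mod_cast this
  have hd0 : (0 : ℝ) < d := by positivity
  refine ⟨_, rfl, (sin_pos_of_pos_of_lt_pi (by positivity) ?_).ne', ?_⟩
  · rw [div_lt_iff₀ hd0, mul_comm π]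
    exact mul_lt_mul_of_pos_right hk' pi_pos
  · rw [mul_div_cancel₀ _ hdr, sin_eq_zero_iff]
    exact ⟨k + 1, by push_cast; ring⟩

/-- The Chebyshev differential equation at a point where the first derivative vanishes. -/
lemma sin_sq_mul_chebDeriv₂ {d : ℕ} (hd : 1 ≤ d) {χ : ℝ} (h : sin χ ≠ 0) (h' : sin (d * χ) = 0) :
    sin χ ^ 2 * chebDeriv₂ d (cos χ) = -d ^ 2 * cos (d * χ) := by
  have h1 := congrArg (Polynomial.eval (cos χ))
    (Polynomial.Chebyshev.one_sub_X_sq_mul_derivative_derivative_T_eq_poly_in_T (R := ℝ) d)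
  have h2 := chebDeriv_cos_eq_zero hd h h'
  have h3 := cheb_cos d χ
  have h4 := sin_sq_add_cos_sq χ
  simp only [chebDeriv, chebDeriv₂, cheb, Function.iterate_succ, Function.iterate_zero, id,
    Polynomial.eval_mul, Polynomial.eval_sub, Polynomial.eval_pow, Polynomial.eval_X,
    Polynomial.eval_one, Function.comp] at *
  simp [h2, h3] at h1
  rw [show sin χ ^ 2 = 1 - cos χ ^ 2 by linarith]
  linear_combination h1

lemma P_chord_cheb {d : ℕ} (hd : 1 ≤ d) (μ φ t : ℝ) :
    P d μ (chord φ t) = -4 * sin (d * φ + phase μ) * (cheb d t - cos (d * φ - 2 * phase μ)) :=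
  P_chord hd μ φ t

/-- The linear part of `tangentForm`. -/
def tangentCLM (φ : ℝ) : ℝ × ℝ →L[ℝ] ℝ :=
  cos φ • ContinuousLinearMap.snd ℝ ℝ ℝ - sin φ • ContinuousLinearMap.fst ℝ ℝ ℝ

lemma tangentCLM_apply (φ : ℝ) (v : ℝ × ℝ) : tangentCLM φ v = cos φ * v.2 - sin φ * v.1 := by
  simp [tangentCLM]

lemma tangentForm_add (φ : ℝ) (p v : ℝ × ℝ) :
    tangentForm φ (p + v) = tangentForm φ p + tangentCLM φ v := by
  simp [tangentForm, tangentCLM_apply]; ring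

lemma contDiff_tangentForm (φ : ℝ) {n : WithTop ℕ∞} : ContDiff ℝ n (tangentForm φ) := by
  unfold tangentForm; fun_prop

lemma hasFDerivAt_tangentForm (φ : ℝ) (p : ℝ × ℝ) :
    HasFDerivAt (tangentForm φ) (tangentCLM φ) p := by
  have : tangentForm φ = fun q => tangentCLM φ q + sin (3 * φ) := by
    funext q; simp [tangentForm, tangentCLM_apply]
  rw [this]
  exact (tangentCLM φ).hasFDerivAt.add_const _

lemma tangentCLM_ne_zero (φ : ℝ) : tangentCLM φ ≠ 0 := by
  intro h
  have h1 := congrArg (fun L => L (0, 1)) h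
  have h2 := congrArg (fun L => L (1, 0)) h
  simp [tangentCLM_apply] at h1 h2
  have := sin_sq_add_cos_sq φ
  simp [h1, h2] at this

lemma contDiff_P {d : ℕ} (hd : 1 ≤ d) (μ : ℝ) {n : WithTop ℕ∞} : ContDiff ℝ n (P d μ) := by
  obtain ⟨c, hc, h, hP⟩ := exists_P_eq_prod hd μ
  rw [funext hP]
  exact contDiff_const.mul (contDiff_prod fun s _ => contDiff_tangentForm _)

lemma hamiltonianField_eq_zero_iff {H : ℝ × ℝ → ℝ} {p : ℝ × ℝ} :
    hamiltonianField H p = 0 ↔ fderiv ℝ H p = 0 := by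
  constructor
  · intro h
    have h1 : fderiv ℝ H p (0, 1) = 0 := congrArg Prod.fst h
    have h2 : fderiv ℝ H p (1, 0) = 0 := neg_eq_zero.1 (congrArg Prod.snd h)
    ext <;> simp [h1, h2]
  · intro h
    simp [hamiltonianField, h]

lemma mem_stationaryPoints {d : ℕ} {μ : ℝ} {p : ℝ × ℝ} :
    p ∈ stationaryPoints (system d μ) ↔ fderiv ℝ (P d μ) p = 0 := hamiltonianField_eq_zero_iff

/-- Splitting off the factor of one line. -/
lemma exists_P_eq_mul {d : ℕ} (hd : 1 ≤ d) (μ : ℝ) {S : Finset ℤ} (hS : S ⊆ idx d) :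
    ∃ G : ℝ × ℝ → ℝ, ContDiff ℝ ∞ G ∧
      (∀ p, P d μ p = (∏ s ∈ S, tangentForm (angle d μ s) p) * G p) ∧
      ∀ p, G p = 0 ↔ ∃ s ∈ idx d \ S, tangentForm (angle d μ s) p = 0 := by
  obtain ⟨c, hc, h, hP⟩ := exists_P_eq_prod hd μ
  refine ⟨fun p => -2 / c * ∏ s ∈ idx d \ S, tangentForm (angle d μ s) p,
    contDiff_const.mul (contDiff_prod fun s _ => contDiff_tangentForm _), fun p => ?_, fun p => ?_⟩
  · rw [hP, ← Finset.prod_sdiff hS]; ring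
  · rw [mul_eq_zero, or_iff_right (by simp [hc]), Finset.prod_eq_zero_iff]

/-- At a point of one line the gradient is the gradient of that form times the cofactor, so the
cofactor vanishes there too. -/
lemma mem_crossings_of_stationary {d : ℕ} (hd : 1 ≤ d) {μ φ : ℝ} {p : ℝ × ℝ}
    (h : fderiv ℝ (P d μ) p = 0) (hl : IsLineThrough d (phase μ) φ p) :
    p ∈ crossings d (phase μ) := by
  obtain ⟨s, hs, hs'⟩ := (sin_eq_zero_iff_exists_angle hd μ φ).1 hl.1
  have hN := (tangentForm_congr hs' p).1 hl.2
  obtain ⟨G, hG, hP, hG0⟩ := exists_P_eq_mul hd μ (Finset.singleton_subset_iff.2 hs)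
  have h1 := (hasFDerivAt_tangentForm (angle d μ s) p).mul
    (hG.differentiable (by simp)).differentiableAt.hasFDerivAt
  have h2 : P d μ = tangentForm (angle d μ s) * G := by funext q; simp [hP]
  rw [h2, h1.fderiv, hN] at h
  simp only [zero_smul, zero_add, smul_eq_zero, tangentCLM_ne_zero, or_false] at h
  obtain ⟨r, hr, hr'⟩ := (hG0 p).1 h
  simp only [Finset.mem_sdiff, Finset.mem_singleton] at hr
  exact ⟨_, _, sin_sub_angle_ne_zero hd μ hr.1 hs hr.2, isLineThrough_angle hd hr.1 hr',
    isLineThrough_angle hd hs hN⟩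

lemma stationary_of_mem_crossings {d : ℕ} (hd : 1 ≤ d) {μ : ℝ} {p : ℝ × ℝ}
    (h : p ∈ crossings d (phase μ)) : fderiv ℝ (P d μ) p = 0 := by
  obtain ⟨s, hs, r, hr, hsr, rfl⟩ := (mem_crossings_iff hd).1 h
  set p := crossPoint (angle d μ s) (angle d μ r)
  obtain ⟨G, hG, hP, -⟩ := exists_P_eq_mul hd μ (S := {s, r})
    (by intro x hx; simp only [Finset.mem_insert, Finset.mem_singleton] at hx; rcases hx with rfl | rfl <;> assumption)
  have h1 := ((hasFDerivAt_tangentForm (angle d μ s) p).mul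
    (hasFDerivAt_tangentForm (angle d μ r) p)).mul
    (hG.differentiable (by simp)).differentiableAt.hasFDerivAt
  have h2 : P d μ = tangentForm (angle d μ s) * tangentForm (angle d μ r) * G := by
    funext q; simp [hP, Finset.prod_pair hsr.ne]
  rw [h2, h1.fderiv]
  simp [p, tangentForm_crossPoint_left, tangentForm_crossPoint_right]

lemma hasDerivAt_chord (φ t : ℝ) : HasDerivAt (chord φ) (2 * cos φ, 2 * sin φ) t := by
  unfold chord
  refine HasDerivAt.prodMk ?_ ?_
  · simpa using (((hasDerivAt_id t).const_mul 2).mul_const (cos φ)).const_add (cos (2 * φ))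
  · simpa using (((hasDerivAt_id t).const_mul 2).mul_const (sin φ)).const_add (-sin (2 * φ))

lemma fderiv_P_chord {d : ℕ} (hd : 1 ≤ d) (μ φ t : ℝ) :
    fderiv ℝ (P d μ) (chord φ t) (2 * cos φ, 2 * sin φ) =
      -4 * sin (d * φ + phase μ) * chebDeriv d t := by
  have h1 := ((contDiff_P hd μ (n := 1)).differentiable (by simp) (chord φ t)).hasFDerivAt.comp_hasDerivAt t
    (hasDerivAt_chord φ t)
  have h2 : HasDerivAt (fun t => -4 * sin (d * φ + phase μ) * (cheb d t - cos (d * φ - 2 * phase μ)))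
    (-4 * sin (d * φ + phase μ) * chebDeriv d t) t :=
    ((hasDerivAt_cheb d t).sub_const _).const_mul _
  have h3 : P d μ ∘ chord φ = fun t => -4 * sin (d * φ + phase μ) * (cheb d t - cos (d * φ - 2 * phase μ)) := by
    funext t; exact P_chord_cheb hd μ φ t
  rw [h3] at h1
  exact h1.unique h2

/-- Differentiate `P_chord_cheb` in φ with t fixed; this complements the condition that the
derivative of T_d vanishes, which comes from varying t. -/
lemma cheb_mul_cos_of_stationary {d : ℕ} (hd : 1 ≤ d) {μ φ t : ℝ}
    (h : fderiv ℝ (P d μ) (chord φ t) = 0) :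
    cheb d t * cos (d * φ + phase μ) = cos (2 * (d * φ) - phase μ) := by
  have hdr : (d : ℝ) ≠ 0 := by positivity
  have hc : DifferentiableAt ℝ (fun φ => chord φ t) φ := by unfold chord; fun_prop
  have h1 := ((contDiff_P hd μ (n := 1)).differentiable (by simp) (chord φ t)).hasFDerivAt.comp_hasDerivAt φ
    hc.hasDerivAt
  rw [h] at h1
  have h3 : P d μ ∘ (fun φ => chord φ t) =
      fun φ => -4 * sin (d * φ + phase μ) * (cheb d t - cos (d * φ - 2 * phase μ)) := by
    funext φ; exact P_chord_cheb hd μ φ t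
  rw [h3] at h1
  have ha : HasDerivAt (fun φ => d * φ + phase μ) (d : ℝ) φ := by
    simpa using ((hasDerivAt_id φ).const_mul (d : ℝ)).add_const (phase μ)
  have hb : HasDerivAt (fun φ => d * φ - 2 * phase μ) (d : ℝ) φ := by
    simpa using ((hasDerivAt_id φ).const_mul (d : ℝ)).sub_const (2 * phase μ)
  have h2 := (ha.sin.const_mul (-4)).mul (hb.cos.const_sub (cheb d t))
  have h4 := h2.unique h1
  simp only [zero_apply] at h4
  rw [show 2 * (d * φ) - phase μ = (d * φ + phase μ) + (d * φ - 2 * phase μ) by ring,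
    cos_add (d * φ + phase μ)]
  have h5 : (d : ℝ) * (cheb d t * cos (d * φ + phase μ) -
    (cos (d * φ + phase μ) * cos (d * φ - 2 * phase μ) - sin (d * φ + phase μ) * sin (d * φ - 2 * phase μ))) = 0 := by
    linear_combination (-1/4) * h4
  rw [mul_eq_zero, or_iff_right hdr] at h5
  linarith

/-- Here t = cos 3φ is the point of contact with the deltoid, and e^{−2iψ} + 2e^{iψ} with ψ = −2φ is
the deltoid's own parametrisation. -/
lemma chord_cos_three_mul (φ : ℝ) : chord φ (cos (3 * φ)) = chord (-2 * φ) 1 := by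
  rw [show 3 * φ = φ + 2 * φ by ring, chord_eq_crossPoint]
  simp only [crossPoint, chord]
  rw [show 2 * φ + 2 * φ = -(2 * (-2 * φ)) by ring, cos_neg, sin_neg, show -2 * φ = -(2 * φ) by ring,
    cos_neg (2 * φ), sin_neg (2 * φ)]
  ext <;> simp only <;> ring

/-- Off the lines, T_d has derivative zero at the parameter of p on every tangent through p. Once
one tangent is chosen, the condition from varying its direction determines the other two and puts
all three in one system. -/
lemma stationary_subset {d : ℕ} (hd : 1 ≤ d) {μ : ℝ} {p : ℝ × ℝ} (h : fderiv ℝ (P d μ) p = 0)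
    (hl : ∀ φ, ¬ IsLineThrough d (phase μ) φ p) : p ∈ allTriplePoints d := by
  have hchord : ∀ φ t, p = chord φ t → chebDeriv d t = 0 := by
    rintro φ t rfl
    have h1 := fderiv_P_chord hd μ φ t
    rw [h] at h1
    have h2 : sin (d * φ + phase μ) ≠ 0 := fun h2 => hl φ ⟨h2, by rw [tangentForm_chord]; simp⟩
    simpa [h2] using h1.symm
  obtain ⟨φ, t, hp⟩ := exists_eq_chord p
  obtain ⟨χ, rfl, hχ, hdχ⟩ := exists_cos_of_chebDeriv_eq_zero hd (hchord φ t hp)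
  -- Equality would put p on the deltoid, hence at parameter 1 of another chord, where the
  -- derivative of T_d is not zero.
  have hne : cos χ ≠ cos (3 * φ) := by
    intro h0
    rw [h0, chord_cos_three_mul] at hp
    exact chebDeriv_one hd (hchord _ _ hp)
  have h1 := h
  rw [hp] at h1
  have h2 := cheb_mul_cos_of_stationary hd h1
  have h3 : cheb d (cos χ) * cos (d * φ + phase μ) = cos (d * φ + phase μ + d * χ) := by
    rw [cheb_cos, cos_add _ (d * χ), hdχ]; ring
  rw [h3, cos_eq_cos_iff] at h2
  have hline : ∀ ψ, φ + 2 * ψ = χ ∨ φ + 2 * ψ = -χ → tangentForm ψ p = 0 := by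
    intro ψ hψ
    rw [hp, tangentForm_chord]
    rcases hψ with hψ | hψ <;> rw [hψ] <;> simp
  -- The other tangents through p have directions (−φ ± χ)/2. One alternative makes (−φ + χ)/2 a
  -- line of the given system, which is excluded. The other reads 3dφ + dχ ∈ 2πℤ and makes all three
  -- tangents lines of phase −dφ.
  obtain ⟨k, hk | hk⟩ := h2
  · exact absurd ⟨by
      rw [show d * ((-φ + χ) / 2) + phase μ = ((-k : ℤ) : ℝ) * π by push_cast; linarith]
      exact sin_int_mul_pi _, hline ((-φ + χ) / 2) (Or.inl (by ring))⟩ (hl ((-φ + χ) / 2))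
  · have hz : ∀ x, sin ((3 * φ + x) / 2) = 0 → cos x = cos (3 * φ) := by
      intro x hx
      obtain ⟨n, hn⟩ := sin_eq_zero_iff.1 hx
      rw [show x = n * (2 * π) - 3 * φ by linarith, cos_int_mul_two_pi_sub]
    refine ⟨-(d * φ), φ, (-φ + χ) / 2, (-φ - χ) / 2, ?_, ?_, ?_, ⟨by simp, ?_⟩,
      ⟨?_, hline _ (Or.inl (by ring))⟩, ⟨?_, hline _ (Or.inr (by ring))⟩⟩
    · intro h0
      refine hne ?_
      rw [← cos_neg χ]
      exact hz _ (by rw [← h0]; ring_nf)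
    · rwa [show (-φ + χ) / 2 - (-φ - χ) / 2 = χ by ring]
    · intro h0
      refine hne (hz _ ?_)
      rw [← neg_eq_zero, ← sin_neg, ← h0]; ring_nf
    · rw [hp, tangentForm_chord]; simp
    · obtain ⟨j, hj⟩ := sin_eq_zero_iff.1 hdχ
      rw [show d * ((-φ + χ) / 2) + -(d * φ) = ((j - k : ℤ) : ℝ) * π by push_cast; linarith]
      exact sin_int_mul_pi _
    · rw [show d * ((-φ - χ) / 2) + -(d * φ) = ((-k : ℤ) : ℝ) * π by push_cast; linarith]
      exact sin_int_mul_pi _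

lemma direction_combination (φ₁ φ₂ φ₃ : ℝ) :
    sin (φ₂ - φ₃) • (cos φ₁, sin φ₁) + sin (φ₃ - φ₁) • (cos φ₂, sin φ₂) +
      sin (φ₁ - φ₂) • (cos φ₃, sin φ₃) = (0 : ℝ × ℝ) := by
  ext <;> simp [sin_sub] <;> ring

lemma eq_zero_of_directions {φ₁ φ₂ : ℝ} (h : sin (φ₁ - φ₂) ≠ 0) (L : ℝ × ℝ →L[ℝ] ℝ)
    (h₁ : L (cos φ₁, sin φ₁) = 0) (h₂ : L (cos φ₂, sin φ₂) = 0) : L = 0 := by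
  have key : ∀ φ₃, L (cos φ₃, sin φ₃) = 0 := by
    intro φ₃
    have := congrArg L (direction_combination φ₁ φ₂ φ₃)
    rw [map_add, map_add, map_smul, map_smul, map_smul, h₁, h₂, map_zero] at this
    simpa [h] using this
  have e1 := key 0
  have e2 := key (π / 2)
  simp at e1 e2
  ext <;> simp [e1, e2]

/-- The phase κ of the triple point need not be that of μ: along each of the three tangents P is an
affine function of T_d(t), and the derivative of T_d vanishes at the parameter of p. Two independent
directions suffice. -/
lemma stationary_of_isTriplePoint {d : ℕ} (hd : 1 ≤ d) (μ : ℝ) {κ φ₁ φ₂ φ₃ : ℝ} {p : ℝ × ℝ}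
    (h : IsTriplePoint d κ φ₁ φ₂ φ₃ p) : fderiv ℝ (P d μ) p = 0 := by
  have key : ∀ {φ₁ φ₂ φ₃}, IsTriplePoint d κ φ₁ φ₂ φ₃ p →
      fderiv ℝ (P d μ) p (cos φ₁, sin φ₁) = 0 := by
    intro φ₁ φ₂ φ₃ h
    have h1 := fderiv_P_chord hd μ φ₁ (cos (φ₁ + 2 * φ₂))
    have h0 : sin (φ₁ + 2 * φ₂) ≠ 0 := fun h0 => by
      have := h.sin_chord_sq; rw [h0] at this; exact h.ne₂₃ (by simpa using this.symm)
    rw [← h.eq_chord, chebDeriv_cos_eq_zero hd h0 h.sin_mul_chord, mul_zero,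
      show ((2 * cos φ₁, 2 * sin φ₁) : ℝ × ℝ) = (2 : ℝ) • (cos φ₁, sin φ₁) by ext <;> simp,
      map_smul] at h1
    simpa using h1
  exact eq_zero_of_directions h.ne₁₂ _ (key h) (key h.rotate)

theorem stationaryPoints_system {d : ℕ} (hd : 1 ≤ d) (μ : ℝ) :
    stationaryPoints (system d μ) = crossings d (phase μ) ∪ allTriplePoints d := by
  ext p
  rw [mem_stationaryPoints, mem_union]
  constructor
  · intro h
    by_cases hl : ∃ φ, IsLineThrough d (phase μ) φ p
    · obtain ⟨φ, hφ⟩ := hl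
      exact Or.inl (mem_crossings_of_stationary hd h hφ)
    · exact Or.inr (stationary_subset hd h (not_exists.1 hl))
  · rintro (h | ⟨κ, φ₁, φ₂, φ₃, h⟩)
    · exact stationary_of_mem_crossings hd h
    · exact stationary_of_isTriplePoint hd μ h

/-! ### Counting stationary points -/

/-- Pairs of distinct lines. -/
def linePairs (d : ℕ) : Finset (ℤ × ℤ) := (idx d ×ˢ idx d).filter fun x => x.1 < x.2

lemma mem_linePairs {d : ℕ} {x : ℤ × ℤ} : x ∈ linePairs d ↔ x.1 ∈ idx d ∧ x.2 ∈ idx d ∧ x.1 < x.2 := by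
  simp [linePairs, and_assoc]

lemma crossings_eq_image {d : ℕ} (hd : 1 ≤ d) (μ : ℝ) : crossings d (phase μ) =
    (fun x : ℤ × ℤ => crossPoint (angle d μ x.1) (angle d μ x.2)) '' (linePairs d : Set (ℤ × ℤ)) := by
  ext p
  rw [mem_crossings_iff hd]
  constructor
  · rintro ⟨s, hs, r, hr, hsr, rfl⟩
    exact ⟨(s, r), by simpa [mem_linePairs] using ⟨hs, hr, hsr⟩, rfl⟩
  · rintro ⟨⟨s, r⟩, h, rfl⟩
    have h := mem_linePairs.1 h
    exact ⟨s, h.1, r, h.2.1, h.2.2, rfl⟩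

lemma isTriplePoint_angle {d : ℕ} (hd : 1 ≤ d) {μ : ℝ} {s r u : ℤ} {p : ℝ × ℝ} (hs : s ∈ idx d)
    (hr : r ∈ idx d) (hu : u ∈ idx d) (hsr : s ≠ r) (hru : r ≠ u) (hus : u ≠ s)
    (h₁ : tangentForm (angle d μ s) p = 0) (h₂ : tangentForm (angle d μ r) p = 0)
    (h₃ : tangentForm (angle d μ u) p = 0) :
    IsTriplePoint d (phase μ) (angle d μ s) (angle d μ r) (angle d μ u) p :=
  ⟨sin_sub_angle_ne_zero hd μ hs hr hsr, sin_sub_angle_ne_zero hd μ hr hu hru,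
    sin_sub_angle_ne_zero hd μ hu hs hus, isLineThrough_angle hd hs h₁,
    isLineThrough_angle hd hr h₂, isLineThrough_angle hd hu h₃⟩

/-- Two different pairs involve at least three lines; this is why crossings are counted without
repetition in the absence of triple points. -/
lemma mem_triplePoints_of_crossPoint_eq {d : ℕ} (hd : 1 ≤ d) {μ : ℝ} {x y : ℤ × ℤ}
    (hx : x ∈ linePairs d) (hy : y ∈ linePairs d) (hne : x ≠ y)
    (h : crossPoint (angle d μ x.1) (angle d μ x.2) = crossPoint (angle d μ y.1) (angle d μ y.2)) :
    crossPoint (angle d μ x.1) (angle d μ x.2) ∈ triplePoints d (phase μ) := by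
  obtain ⟨s, r⟩ := x
  obtain ⟨s', r'⟩ := y
  rw [mem_linePairs] at hx hy
  simp only at *
  have h1 := tangentForm_crossPoint_left (angle d μ s) (angle d μ r)
  have h2 := tangentForm_crossPoint_right (angle d μ s) (angle d μ r)
  have h3 := tangentForm_crossPoint_left (angle d μ s') (angle d μ r')
  have h4 := tangentForm_crossPoint_right (angle d μ s') (angle d μ r')
  rw [← h] at h3 h4
  have hu : ∃ u ∈ idx d, r ≠ u ∧ u ≠ s ∧
      tangentForm (angle d μ u) (crossPoint (angle d μ s) (angle d μ r)) = 0 := by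
    by_cases c1 : s' ≠ s ∧ s' ≠ r
    · exact ⟨s', hy.1, c1.2.symm, c1.1, h3⟩
    · refine ⟨r', hy.2.1, ?_, ?_, h4⟩
      · rintro rfl
        apply hne
        have : s' = s := by
          by_contra hc; exact c1 ⟨hc, hy.2.2.ne⟩
        rw [this]
      · rintro rfl
        have := hy.2.2
        have := hx.2.2
        omega
  obtain ⟨u, hu, hru, hus, h5⟩ := hu
  exact ⟨_, _, _, isTriplePoint_angle hd hx.1 hx.2.1 hu hx.2.2.ne hru hus h1 h2 h5⟩

lemma triplePoints_subset_crossings (d : ℕ) (κ : ℝ) : triplePoints d κ ⊆ crossings d κ :=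
  fun _ ⟨_, _, _, h⟩ => ⟨_, _, h.ne₁₂, h.line₁, h.line₂⟩

/-- By `phase_eq`, a line of phase κ through a triple point forces the phase of that triple point to
be κ modulo π. -/
lemma crossings_inter_allTriplePoints (d : ℕ) (κ : ℝ) :
    crossings d κ ∩ allTriplePoints d = triplePoints d κ := by
  apply Subset.antisymm
  · rintro p ⟨⟨φ, ψ, -, hl, -⟩, κ', φ₁, φ₂, φ₃, h⟩
    exact ⟨_, _, _, h.congr_phase (h.phase_eq hl)⟩
  · exact fun p hp => ⟨triplePoints_subset_crossings d κ hp, κ, hp⟩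

lemma encard_crossings_le {d : ℕ} (hd : 1 ≤ d) (μ : ℝ) :
    (crossings d (phase μ)).encard ≤ (linePairs d).card := by
  rw [crossings_eq_image hd, ← encard_coe_eq_coe_finsetCard]
  exact encard_image_le _ _

lemma encard_crossings {d : ℕ} (hd : 1 ≤ d) {μ : ℝ} (h : triplePoints d (phase μ) = ∅) :
    (crossings d (phase μ)).encard = (linePairs d).card := by
  rw [crossings_eq_image hd, ← encard_coe_eq_coe_finsetCard]
  refine InjOn.encard_image fun x hx y hy hxy => ?_
  by_contra hne
  have := mem_triplePoints_of_crossPoint_eq hd hx hy hne hxy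
  rw [h] at this
  exact this

lemma encard_stationaryPoints {d : ℕ} (hd : 1 ≤ d) {μ : ℝ} (h : triplePoints d (phase μ) = ∅) :
    (stationaryPoints (system d μ)).encard = (linePairs d).card + (allTriplePoints d).encard := by
  rw [stationaryPoints_system hd, encard_union_eq, encard_crossings hd h]
  rw [disjoint_iff_inter_eq_empty, crossings_inter_allTriplePoints, h]

/-- Inclusion–exclusion: the crossings number at most the pairs of lines, and a nonempty
intersection is lost in addition. -/
lemma encard_stationaryPoints_lt {d : ℕ} (hd : 1 ≤ d) {μ : ℝ} (h : (triplePoints d (phase μ)).Nonempty) :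
    (stationaryPoints (system d μ)).encard < (linePairs d).card + (allTriplePoints d).encard := by
  rw [stationaryPoints_system hd]
  have h1 := encard_union_add_encard_inter (crossings d (phase μ)) (allTriplePoints d)
  rw [crossings_inter_allTriplePoints] at h1
  have h2 : 1 ≤ (triplePoints d (phase μ)).encard := one_le_encard_iff_nonempty.2 h
  have h3 : (crossings d (phase μ) ∪ allTriplePoints d).encard ≠ ⊤ := by
    rw [encard_ne_top_iff, crossings_eq_image hd]
    exact ((Finset.finite_toSet _).image _).union (allTriplePoints_finite hd)
  calc _ < (crossings d (phase μ) ∪ allTriplePoints d).encard + (triplePoints d (phase μ)).encard := by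
        refine lt_of_lt_of_le ?_ (add_le_add_right h2 _)
        exact (ENat.lt_add_one_iff h3).2 le_rfl
    _ = _ := h1
    _ ≤ _ := add_le_add_left (encard_crossings_le hd μ) _

lemma triplePoints_eq_empty {d : ℕ} {κ : ℝ} (h : sin (3 * κ) ≠ 0) : triplePoints d κ = ∅ := by
  rw [eq_empty_iff_forall_notMem]
  rintro p ⟨_, _, _, hp⟩
  exact h hp.sin_three_mul_phase

/-! ### Bifurcation points -/

lemma eventually_sin_ne_zero (μ₀ : ℝ) : ∀ᶠ μ in 𝓝[≠] μ₀, sin (3 * phase μ) ≠ 0 := by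
  have h1 : HasDerivAt (fun μ => 3 * phase μ) 3 μ₀ := by
    unfold phase
    simpa using ((hasDerivAt_id μ₀).add_const (π / 6)).const_mul 3
  by_cases h : sin (3 * phase μ₀) = 0
  · have h2 := sin_sq_add_cos_sq (3 * phase μ₀)
    refine h1.sin.eventually_ne (fun h0 => ?_)
    have h3 : cos (3 * phase μ₀) = 0 := by linarith
    simp [h, h3] at h2
  · exact (h1.sin.continuousAt.eventually_ne h).filter_mono nhdsWithin_le_nhds

/-- Zeros of sin 3κ are isolated, so the generic count holds on a punctured neighbourhood of every
μ₀; only the count at μ₀ itself is in question. -/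
theorem isBifurcationPoint_iff {d : ℕ} (hd : 1 ≤ d) (μ₀ : ℝ) :
    IsBifurcationPoint (system d) μ₀ ↔ (triplePoints d (phase μ₀)).Nonempty := by
  have hev : ∀ᶠ μ in 𝓝[≠] μ₀, (stationaryPoints (system d μ)).encard =
      (linePairs d).card + (allTriplePoints d).encard :=
    (eventually_sin_ne_zero μ₀).mono fun μ h => encard_stationaryPoints hd (triplePoints_eq_empty h)
  constructor
  · intro h
    by_contra hne
    rw [not_nonempty_iff_eq_empty] at hne
    apply h
    rw [eventually_nhdsWithin_iff] at hev
    filter_upwards [hev] with μ hμ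
    by_cases hc : μ = μ₀
    · rw [hc]
    · rw [hμ hc, encard_stationaryPoints hd hne]
  · intro h hc
    obtain ⟨μ, h1, h2⟩ := (hev.and (hc.filter_mono nhdsWithin_le_nhds)).exists
    have := encard_stationaryPoints_lt hd h
    rw [← h2, h1] at this
    exact lt_irrefl _ this

/-- The triple (0, 1, n − 1) fails only for n ≡ 1 or n ≡ 2 modulo d, and then (0, 2, n − 2) or (1,
2, n − 3) works, since d ≥ 4 divides no nonzero integer of absolute value at most 3. -/
lemma exists_three_incongruent {d : ℕ} (hd : 4 ≤ d) (n : ℤ) : ∃ a b c : ℤ, a + b + c = n ∧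
    ¬ (d : ℤ) ∣ a - b ∧ ¬ (d : ℤ) ∣ b - c ∧ ¬ (d : ℤ) ∣ c - a := by
  have small : ∀ k : ℤ, k ≠ 0 → -3 ≤ k → k ≤ 3 → ¬ (d : ℤ) ∣ k := by
    intro k hk h1 h2 hdvd
    exact hk (Int.eq_zero_of_abs_lt_dvd hdvd (by rw [abs_lt]; omega))
  have shift : ∀ m k : ℤ, (d : ℤ) ∣ m → k ≠ 0 → -3 ≤ k → k ≤ 3 → ¬ (d : ℤ) ∣ m + k := by
    intro m k hm hk h1 h2 h3
    exact small k hk h1 h2 ((Int.dvd_add_right hm).1 h3)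
  by_cases c1 : (d : ℤ) ∣ n - 1
  · refine ⟨0, 2, n - 2, by ring, small _ (by norm_num) (by norm_num) (by norm_num), ?_, ?_⟩
    · rw [← dvd_neg, show -(2 - (n - 2)) = n - 1 + -3 by ring]
      exact shift _ _ c1 (by norm_num) (by norm_num) (by norm_num)
    · rw [show n - 2 - 0 = n - 1 + -1 by ring]
      exact shift _ _ c1 (by norm_num) (by norm_num) (by norm_num)
  by_cases c2 : (d : ℤ) ∣ n - 2
  · refine ⟨1, 2, n - 3, by ring, small _ (by norm_num) (by norm_num) (by norm_num), ?_, ?_⟩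
    · rw [← dvd_neg, show -(2 - (n - 3)) = n - 2 + -3 by ring]
      exact shift _ _ c2 (by norm_num) (by norm_num) (by norm_num)
    · rw [show n - 3 - 1 = n - 2 + -2 by ring]
      exact shift _ _ c2 (by norm_num) (by norm_num) (by norm_num)
  · refine ⟨0, 1, n - 1, by ring, small _ (by norm_num) (by norm_num) (by norm_num), ?_, ?_⟩
    · rwa [← dvd_neg, show -(1 - (n - 1)) = n - 2 by ring]
    · rwa [sub_zero]

lemma triplePoints_nonempty {d : ℕ} (hd : 4 ≤ d) {μ : ℝ} (h : sin (3 * phase μ) = 0) :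
    (triplePoints d (phase μ)).Nonempty := by
  have hd1 : 1 ≤ d := by omega
  have hdr : (d : ℝ) ≠ 0 := by positivity
  obtain ⟨n, hn⟩ := sin_eq_zero_iff.1 h
  -- With 3κ = nπ, indices of sum n give directions of sum zero, hence concurrent lines.
  obtain ⟨a, b, c, habc, h1, h2, h3⟩ := exists_three_incongruent hd n
  have hne : ∀ s r : ℤ, ¬ (d : ℤ) ∣ s - r → sin (angle d μ s - angle d μ r) ≠ 0 := by
    intro s r hsr h0
    obtain ⟨k, hk⟩ := sin_eq_zero_iff.1 h0
    have e : (d * k : ℝ) * π = (s - r) * π := by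
      linear_combination d * hk + mul_angle hd1 μ s - mul_angle hd1 μ r
    have e2 : (d : ℤ) * k = s - r := by exact_mod_cast mul_right_cancel₀ pi_ne_zero e
    exact hsr ⟨k, e2.symm⟩
  have hl : ∀ s : ℤ, sin (d * angle d μ s + phase μ) = 0 := by
    intro s; rw [mul_angle hd1]; simp [sin_int_mul_pi]
  have hsum : angle d μ a + angle d μ b + angle d μ c = 0 := by
    have e : (a + b + c : ℝ) = n := by exact_mod_cast habc
    have : d * (angle d μ a + angle d μ b + angle d μ c) = 0 := by
      rw [mul_add, mul_add, mul_angle hd1, mul_angle hd1, mul_angle hd1]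
      linear_combination π * e + hn
    exact (mul_eq_zero.1 this).resolve_left hdr
  refine ⟨crossPoint (angle d μ a) (angle d μ b), _, _, angle d μ c, hne _ _ h1, hne _ _ h2,
    hne _ _ h3, ⟨hl _, tangentForm_crossPoint_left _ _⟩, ⟨hl _, tangentForm_crossPoint_right _ _⟩,
    hl _, ?_⟩
  rw [tangentForm_crossPoint, hsum]
  simp

theorem isBifurcationPoint_iff_sin {d : ℕ} (hd : 4 ≤ d) (μ : ℝ) :
    IsBifurcationPoint (system d) μ ↔ sin (3 * phase μ) = 0 := by
  rw [isBifurcationPoint_iff (by omega)]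
  refine ⟨?_, triplePoints_nonempty hd⟩
  rintro ⟨p, _, _, _, h⟩
  exact h.sin_three_mul_phase

lemma sin_three_mul_phase_eq_zero_iff (μ : ℝ) :
    sin (3 * phase μ) = 0 ↔ ∃ l : ℤ, μ = (2 * l + 1) * π / 6 := by
  rw [sin_eq_zero_iff]
  constructor
  · rintro ⟨n, hn⟩
    exact ⟨n - 1, by rw [phase] at hn; push_cast; linarith⟩
  · rintro ⟨l, rfl⟩
    exact ⟨l + 1, by rw [phase]; push_cast; ring⟩

/-! ### Rotations -/

/-- `rotation θ` as a continuous linear map. -/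
def rotationCLM (θ : ℝ) : ℝ × ℝ →L[ℝ] ℝ × ℝ :=
  (cos θ • ContinuousLinearMap.fst ℝ ℝ ℝ - sin θ • ContinuousLinearMap.snd ℝ ℝ ℝ).prod
    (sin θ • ContinuousLinearMap.fst ℝ ℝ ℝ + cos θ • ContinuousLinearMap.snd ℝ ℝ ℝ)

lemma rotationCLM_apply (θ : ℝ) (p : ℝ × ℝ) : rotationCLM θ p = rotation θ p := by
  simp [rotationCLM, rotation]

lemma rotation_chord {θ : ℝ} (hθ : cos (3 * θ) = 1) (φ t : ℝ) :
    rotation θ (chord φ t) = chord (φ + θ) t := by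
  have hs : sin (3 * θ) = 0 := by
    have := sin_sq_add_cos_sq (3 * θ); rw [hθ] at this; simpa using this
  simp only [rotation, chord]
  rw [show 2 * (φ + θ) = (2 * φ - θ) + 3 * θ by ring, cos_add (2 * φ - θ), sin_add (2 * φ - θ), hθ, hs,
    cos_sub, sin_sub, cos_add, sin_add]
  ext <;> simp only <;> ring

/-- A rotation by a multiple of 2π/3 keeps t and moves φ to φ + θ; both trigonometric terms of
`P_chord` then change by full periods. -/
lemma P_rotation {d : ℕ} (hd : 1 ≤ d) {μ ν θ : ℝ} {j n : ℤ} (hθ : 3 * θ = j * (2 * π))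
    (h : phase ν + d * θ = phase μ + n * (2 * π)) (p : ℝ × ℝ) :
    P d ν (rotation θ p) = P d μ p := by
  obtain ⟨φ, t, rfl⟩ := exists_eq_chord p
  rw [rotation_chord (by rw [hθ, cos_int_mul_two_pi]), P_chord hd, P_chord hd]
  rw [show d * (φ + θ) + phase ν = d * φ + phase μ + n * (2 * π) by linear_combination h,
    show d * (φ + θ) - 2 * phase ν = d * φ - 2 * phase μ + ((d * j - 2 * n : ℤ) : ℝ) * (2 * π) by
      push_cast; linear_combination d * hθ - 2 * h,
    sin_add_int_mul_two_pi, cos_add_int_mul_two_pi]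

lemma fderiv_comp_rotation {H : ℝ × ℝ → ℝ} (hH : Differentiable ℝ H) (θ : ℝ) (p : ℝ × ℝ) :
    HasFDerivAt (fun q => H (rotation θ q)) (fderiv ℝ H (rotation θ p) ∘L rotationCLM θ) p := by
  have h1 : HasFDerivAt (rotation θ) (rotationCLM θ) p := by
    rw [show rotation θ = rotationCLM θ from (funext (rotationCLM_apply θ)).symm]
    exact (rotationCLM θ).hasFDerivAt
  exact (hH (rotation θ p)).hasFDerivAt.comp p h1

lemma clm_apply_eq (L : ℝ × ℝ →L[ℝ] ℝ) (v : ℝ × ℝ) : L v = v.1 * L (1, 0) + v.2 * L (0, 1) := by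
  conv_lhs => rw [show v = v.1 • ((1 : ℝ), (0 : ℝ)) + v.2 • ((0 : ℝ), (1 : ℝ)) by ext <;> simp]
  rw [map_add, map_smul, map_smul]; rfl

/-- Rotations commute with the quarter turn relating gradient and Hamiltonian field. -/
lemma hamiltonianField_rotation_iff {H K : ℝ × ℝ → ℝ}
    (hK : Differentiable ℝ K) (θ : ℝ) (p : ℝ × ℝ) :
    hamiltonianField K (rotation θ p) = rotation θ (hamiltonianField H p) ↔
      fderiv ℝ (fun q => K (rotation θ q)) p = fderiv ℝ H p := by
  rw [(fderiv_comp_rotation hK θ p).fderiv]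
  have e1 : (fderiv ℝ K (rotation θ p) ∘L rotationCLM θ) (1, 0) =
      cos θ * fderiv ℝ K (rotation θ p) (1, 0) + sin θ * fderiv ℝ K (rotation θ p) (0, 1) := by
    rw [ContinuousLinearMap.comp_apply, rotationCLM_apply, clm_apply_eq]; simp [rotation]
  have e2 : (fderiv ℝ K (rotation θ p) ∘L rotationCLM θ) (0, 1) =
      -sin θ * fderiv ℝ K (rotation θ p) (1, 0) + cos θ * fderiv ℝ K (rotation θ p) (0, 1) := by
    rw [ContinuousLinearMap.comp_apply, rotationCLM_apply, clm_apply_eq]; simp [rotation]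
  have hsc := sin_sq_add_cos_sq θ
  have hext : (fderiv ℝ K (rotation θ p) ∘L rotationCLM θ = fderiv ℝ H p) ↔
      (fderiv ℝ K (rotation θ p) ∘L rotationCLM θ) (1, 0) = fderiv ℝ H p (1, 0) ∧
      (fderiv ℝ K (rotation θ p) ∘L rotationCLM θ) (0, 1) = fderiv ℝ H p (0, 1) := by
    constructor
    · intro h; rw [h]; exact ⟨rfl, rfl⟩
    · rintro ⟨h1, h2⟩
      ext
      · simpa using h1
      · simpa using h2
  rw [hext, e1, e2]
  simp only [hamiltonianField, rotation, Prod.mk.injEq]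
  generalize fderiv ℝ K (cos θ * p.1 - sin θ * p.2, sin θ * p.1 + cos θ * p.2) (1, 0) = a
  generalize fderiv ℝ K (cos θ * p.1 - sin θ * p.2, sin θ * p.1 + cos θ * p.2) (0, 1) = b
  generalize fderiv ℝ H p (1, 0) = x
  generalize fderiv ℝ H p (0, 1) = y
  constructor
  · rintro ⟨h1, h2⟩
    constructor
    · linear_combination sin θ * h1 - cos θ * h2 + x * hsc
    · linear_combination cos θ * h1 + sin θ * h2 + y * hsc
  · rintro ⟨h1, h2⟩
    constructor
    · linear_combination sin θ * h1 + cos θ * h2 - b * hsc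
    · linear_combination sin θ * h2 - cos θ * h1 + a * hsc

lemma rotationEquivalent_of {d : ℕ} (hd : 1 ≤ d) {μ ν : ℝ} {j n : ℤ}
    (h : ν - μ = (3 * n - d * j) * (2 * π / 3)) : RotationEquivalent (system d μ) (system d ν) := by
  have hdiff : ∀ μ, Differentiable ℝ (P d μ) := fun μ =>
    (contDiff_P hd μ (n := 1)).differentiable (by simp)
  refine ⟨j * (2 * π / 3), fun p => ?_⟩
  refine (hamiltonianField_rotation_iff (hdiff ν) _ p).2 ?_
  congr 1
  funext q
  exact P_rotation hd (j := j) (n := n) (by ring) (by simp only [phase]; linear_combination h) q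

lemma tangentForm_add_direction (ψ φ t : ℝ) (A : ℝ × ℝ) :
    tangentForm ψ (A + (2 * t) • (cos φ, sin φ)) = tangentForm ψ A + 2 * t * sin (φ - ψ) := by
  rw [tangentForm_add, tangentCLM_apply, sin_sub]; simp; ring

/-- A line along which the potential is constant and whose direction is `φ` is a tangent line. -/
lemma tangentForm_eq_zero_of_const {d : ℕ} (hd : 2 ≤ d) {ν φ c : ℝ} {A : ℝ × ℝ}
    (h : ∀ t : ℝ, P d ν (A + (2 * t) • (cos φ, sin φ)) = c) : c = 0 ∧ tangentForm φ A = 0 := by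
  have hd1 : 1 ≤ d := by omega
  obtain ⟨K, hK, -, hP⟩ := exists_P_eq_prod hd1 ν
  have hP' : ∀ t, -2 / K * ∏ s ∈ idx d, (tangentForm (angle d ν s) A + 2 * t * sin (φ - angle d ν s)) = c := by
    intro t
    rw [← h t, hP]
    simp only [tangentForm_add_direction]
  -- At least one of the d ≥ 2 lines is not parallel to direction φ, so P vanishes somewhere on the
  -- line considered.
  have hc : c = 0 := by
    obtain ⟨s, hs, r, hr, hsr⟩ := Finset.one_lt_card.1 (show 1 < (idx d).card by rw [card_idx hd1]; omega)
    obtain ⟨u, hu, hu'⟩ : ∃ u ∈ idx d, sin (φ - angle d ν u) ≠ 0 := by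
      by_contra! hall
      exact sin_sub_angle_ne_zero hd1 ν hs hr hsr
        (sin_sub_eq_zero_trans (sin_sub_eq_zero_symm (hall s hs)) (hall r hr))
    rw [← hP' (-tangentForm (angle d ν u) A / (2 * sin (φ - angle d ν u))),
      Finset.prod_eq_zero hu (by field_simp; ring), mul_zero]
  refine ⟨hc, ?_⟩
  -- A product of affine functions of t vanishes identically only if one factor does.
  obtain ⟨s, hs, hs'⟩ : ∃ s ∈ idx d, ∀ t, tangentForm (angle d ν s) A + 2 * t * sin (φ - angle d ν s) = 0 := by
    by_contra! hall
    have hfin : (⋃ s ∈ idx d, {t : ℝ | tangentForm (angle d ν s) A + 2 * t * sin (φ - angle d ν s) = 0}).Finite := by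
      refine Set.Finite.biUnion (Finset.finite_toSet _) fun s hs => Set.Subsingleton.finite ?_
      intro t ht t' ht'
      simp only [mem_ofPred_eq] at ht ht'
      obtain ⟨t₀, ht₀⟩ := hall s hs
      by_contra hne
      have h1 : (t - t') * sin (φ - angle d ν s) = 0 := by linarith
      have h2 : sin (φ - angle d ν s) = 0 := (mul_eq_zero.1 h1).resolve_left (sub_ne_zero.2 hne)
      rw [h2] at ht ht₀
      exact ht₀ (by linarith)
    refine Set.infinite_univ (hfin.subset fun t _ => ?_)
    have h1 := hP' t
    rw [hc, mul_eq_zero, or_iff_right (by simp [hK]), Finset.prod_eq_zero_iff] at h1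
    simpa using h1
  have h0 := hs' 0
  have h1 := hs' 1
  simp only [mul_zero, zero_mul, add_zero] at h0
  rw [h0] at h1
  refine (tangentForm_congr (φ := φ) (ψ := angle d ν s) ?_ A).2 h0
  linarith

/-- The potentials agree up to the rotation and a constant c. Constancy along rotated lines gives c
= 0 and tangency of these lines to the deltoid; two neighbouring lines then force 3θ ∈ 2πℤ, after
which the amplitudes in `P_chord` can be compared. -/
lemma exists_of_rotationEquivalent {d : ℕ} (hd : 4 ≤ d) {μ ν : ℝ}
    (h : RotationEquivalent (system d μ) (system d ν)) :
    ∃ j n : ℤ, ν - μ = (3 * n - d * j) * (2 * π / 3) := by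
  have hd1 : 1 ≤ d := by omega
  have hdr : (0 : ℝ) < d := by positivity
  have hdiff : ∀ μ, Differentiable ℝ (P d μ) := fun μ =>
    (contDiff_P hd1 μ (n := 1)).differentiable (by simp)
  obtain ⟨θ, hθ⟩ := h
  have hder : ∀ p, fderiv ℝ (fun q => P d ν (rotation θ q) - P d μ q) p = 0 := by
    intro p
    rw [fderiv_fun_sub (fderiv_comp_rotation (hdiff ν) θ p).differentiableAt (hdiff μ p),
      (hamiltonianField_rotation_iff (hdiff ν) θ p).1 (hθ p), sub_self]
  have hd2 : Differentiable ℝ (fun q => P d ν (rotation θ q) - P d μ q) := fun p =>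
    (fderiv_comp_rotation (hdiff ν) θ p).differentiableAt.sub (hdiff μ p)
  obtain ⟨c, hc⟩ : ∃ c, ∀ p, P d ν (rotation θ p) = P d μ p + c := by
    refine ⟨P d ν (rotation θ 0) - P d μ 0, fun p => ?_⟩
    have := is_const_of_fderiv_eq_zero hd2 hder p 0
    linarith
  -- The rotated line passes through e^{i(θ−2φ)} with direction φ + θ, and its tangency condition is
  -- sin(3φ + 3θ) = sin 3φ.
  have hline : ∀ φ, sin (d * φ + phase μ) = 0 → c = 0 ∧ sin (3 * φ + 3 * θ) = sin (3 * φ) := by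
    intro φ hφ
    have h1 : ∀ t : ℝ, P d ν ((cos (2 * φ - θ), -sin (2 * φ - θ)) + (2 * t) • (cos (φ + θ), sin (φ + θ))) = c := by
      intro t
      have h2 := hc (chord φ t)
      rw [P_chord hd1 μ, hφ] at h2
      rw [show c = -4 * 0 * (Polynomial.eval t (Polynomial.Chebyshev.T ℝ d) - cos (d * φ - 2 * phase μ)) + c
        by ring, ← h2]
      congr 1
      simp only [rotation, chord, cos_sub, sin_sub, cos_add, sin_add]
      ext <;> simp <;> ring
    obtain ⟨h2, h3⟩ := tangentForm_eq_zero_of_const (by omega) h1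
    refine ⟨h2, ?_⟩
    rw [tangentForm] at h3
    have h4 := sin_add (φ + θ) (2 * φ - θ)
    rw [show φ + θ + (2 * φ - θ) = 3 * φ by ring] at h4
    rw [show 3 * φ + 3 * θ = 3 * (φ + θ) by ring]
    linarith
  have e0 : sin (d * (-phase μ / d) + phase μ) = 0 := by
    rw [mul_div_cancel₀ _ hdr.ne']; simp
  have e1 : sin (d * (-phase μ / d + π / d) + phase μ) = 0 := by
    rw [mul_add, mul_div_cancel₀ _ hdr.ne', mul_div_cancel₀ _ hdr.ne']; simp
  obtain ⟨hc0, l0⟩ := hline _ e0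
  obtain ⟨-, l1⟩ := hline _ e1
  -- The bound d ≥ 4 is essential here: for d = 3 the sine is zero and the two lines impose the same
  -- condition on θ.
  have hη : sin (3 * (π / d)) ≠ 0 := by
    apply (sin_pos_of_pos_of_lt_pi (by positivity) ?_).ne'
    rw [← mul_div_assoc, div_lt_iff₀ hdr, mul_comm]
    apply mul_lt_mul_of_pos_left _ pi_pos
    have : (4 : ℝ) ≤ d := by exact_mod_cast hd
    linarith
  have hcs : cos (3 * θ) = 1 := by
    rw [mul_add] at l1
    generalize 3 * (-phase μ / d) = x at *
    rw [sin_add] at l0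
    rw [sin_add (x + _)] at l1
    rw [sin_add, cos_add] at l1
    have h1 : sin (3 * (π / d)) * (cos (3 * θ) - 1) = 0 := by
      linear_combination cos x * l1 + (sin x * sin (3 * (π / d)) - cos x * cos (3 * (π / d))) * l0 -
        sin (3 * (π / d)) * (cos (3 * θ) - 1) * sin_sq_add_cos_sq x
    linarith [(mul_eq_zero.1 h1).resolve_left hη]
  -- T_d takes the values 1 and −1 at t = 1 and t = cos(π/d); subtracting eliminates the cosine
  -- term.
  have hsin : ∀ φ, sin (d * (φ + θ) + phase ν) = sin (d * φ + phase μ) := by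
    intro φ
    have h1 := hc (chord φ 1)
    have h2 := hc (chord φ (cos (π / d)))
    have hT : cheb d (cos (π / d)) = -1 := by
      rw [cheb_cos, mul_div_cancel₀ _ hdr.ne', cos_pi]
    have hT1 : cheb d 1 = 1 := by simp [cheb]
    rw [rotation_chord hcs, P_chord_cheb hd1, P_chord_cheb hd1, hT1] at h1
    rw [rotation_chord hcs, P_chord_cheb hd1, P_chord_cheb hd1, hT] at h2
    linear_combination (h2 - h1) / 8
  have s0 := hsin (-phase μ / d)
  have s1 := hsin ((π / 2 - phase μ) / d)
  rw [e0] at s0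
  rw [mul_div_cancel₀ _ hdr.ne', sub_add_cancel, sin_pi_div_two, mul_add, mul_div_cancel₀ _ hdr.ne',
    show π / 2 - phase μ + d * θ + phase ν = (d * θ + phase ν - phase μ) + π / 2 by ring,
    sin_add_pi_div_two] at s1
  obtain ⟨j, hj⟩ := (cos_eq_one_iff _).1 hcs
  obtain ⟨n, hn⟩ := (cos_eq_one_iff _).1 s1
  refine ⟨j, n, ?_⟩
  simp only [phase] at hn
  linear_combination (-1 : ℝ) * hn + d / 3 * hj

/-! ### Rotation classes of bifurcation points -/

theorem system_add_two_pi {d : ℕ} (hd : 1 ≤ d) (μ : ℝ) : system d (μ + 2 * π) = system d μ := by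
  have : P d (μ + 2 * π) = P d μ := by
    funext p
    have := P_rotation hd (μ := μ) (ν := μ + 2 * π) (θ := 0) (j := 0) (n := 1) (by simp)
      (by simp [phase]; ring) p
    simpa [rotation] using this
  rw [system, this, system]

/-- As 3 and d are coprime, 3n − dj takes every integer value, so the equivalences are exactly the
shifts by multiples of 2π/3. Such a step changes l in (2l + 1)π/6 by 2, and the class is the parity
of l. -/
theorem rotation_classification_of_not_three_dvd {d : ℕ} (hd : 4 ≤ d) (h3 : ¬ 3 ∣ d) :
    (∀ μ : ℝ, RotationEquivalent (system d μ) (system d (μ + 2 * π / 3))) ∧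
      {μ : ℝ | μ ∈ Set.Ico 0 (2 * π / 3) ∧ IsBifurcationPoint (system d) μ} = {π / 6, π / 2} ∧
      ∀ μ : ℝ, IsBifurcationPoint (system d) μ → ∃! ν : ℝ, ν ∈ ({π / 6, π / 2} : Set ℝ) ∧
          RotationEquivalent (system d μ) (system d ν) := by
  have hd1 : 1 ≤ d := by omega
  have hpi := pi_pos
  have hbez : ∃ j n : ℤ, 3 * n - d * j = 1 := by
    obtain h | h : d % 3 = 1 ∨ d % 3 = 2 := by omega
    · exact ⟨-1, -(d / 3 : ℕ), by push_cast; omega⟩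
    · exact ⟨1, (d / 3 : ℕ) + 1, by push_cast; omega⟩
  obtain ⟨j, n, hjn⟩ := hbez
  have hjn' : (3 * n - d * j : ℝ) = 1 := by exact_mod_cast hjn
  have hequiv : ∀ (μ : ℝ) (k : ℤ), RotationEquivalent (system d μ) (system d (μ + k * (2 * π / 3))) := by
    intro μ k
    refine rotationEquivalent_of hd1 (j := k * j) (n := k * n) ?_
    push_cast
    linear_combination (-(k * (2 * π / 3) : ℝ)) * hjn'
  refine ⟨fun μ => by simpa [mul_div_assoc] using hequiv μ 1, ?_, ?_⟩
  · ext μ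
    simp only [mem_ofPred_eq, isBifurcationPoint_iff_sin hd, sin_three_mul_phase_eq_zero_iff, mem_Ico,
      mem_insert_iff, mem_singleton_iff]
    constructor
    · rintro ⟨⟨h0, h1⟩, l, rfl⟩
      have a1 : (0 : ℝ) ≤ 2 * l + 1 := by
        by_contra hc; push Not at hc; nlinarith
      have a2 : (2 * l + 1 : ℝ) < 4 := by
        by_contra hc; push Not at hc; nlinarith
      have b1 : 0 ≤ 2 * l + 1 := by exact_mod_cast a1
      have b2 : 2 * l + 1 < 4 := by exact_mod_cast a2
      obtain rfl | rfl : l = 0 ∨ l = 1 := by omega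
      · left; simp
      · right; push_cast; ring
    · rintro (rfl | rfl)
      · exact ⟨⟨by positivity, by linarith⟩, 0, by simp⟩
      · exact ⟨⟨by positivity, by linarith⟩, 1, by push_cast; ring⟩
  · intro μ hμ
    rw [isBifurcationPoint_iff_sin hd, sin_three_mul_phase_eq_zero_iff] at hμ
    obtain ⟨l, rfl⟩ := hμ
    have hmem : ∀ ν : ℝ, ν ∈ ({π / 6, π / 2} : Set ℝ) ↔
        ∃ r : ℤ, (r = 0 ∨ r = 1) ∧ ν = (2 * r + 1) * π / 6 := by
      intro ν
      simp only [mem_insert_iff, mem_singleton_iff]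
      constructor
      · rintro (rfl | rfl)
        · exact ⟨0, by simp, by simp⟩
        · exact ⟨1, by simp, by push_cast; ring⟩
      · rintro ⟨r, rfl | rfl, rfl⟩
        · left; simp
        · right; push_cast; ring
    refine ⟨(2 * ((l % 2 : ℤ) : ℝ) + 1) * π / 6, ⟨(hmem _).2 ⟨l % 2, by omega, rfl⟩, ?_⟩, ?_⟩
    · have h1 := hequiv ((2 * l + 1) * π / 6) (-(l / 2))
      convert! h1 using 2
      have h2 : ((l % 2 : ℤ) : ℝ) + 2 * ((l / 2 : ℤ) : ℝ) = l := by exact_mod_cast Int.emod_add_mul_ediv l 2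
      push_cast
      linear_combination π / 3 * h2
    · rintro ν ⟨hν, heq⟩
      obtain ⟨r, hr, rfl⟩ := (hmem ν).1 hν
      obtain ⟨j', n', hjn2⟩ := exists_of_rotationEquivalent hd heq
      have h2 : ((r - l : ℤ) : ℝ) = ((2 * (3 * n' - d * j') : ℤ) : ℝ) := by
        apply mul_right_cancel₀ pi_ne_zero
        push_cast
        linear_combination 3 * hjn2
      have h3 : r - l = 2 * (3 * n' - d * j') := by exact_mod_cast h2
      have : r = l % 2 := by omega
      rw [this]

/-- Now 3n − dj is always a multiple of 3, so only shifts by multiples of 2π occur and l counts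
modulo 6. -/
theorem rotation_classification_of_three_dvd {d : ℕ} (hd : 4 ≤ d) (h3 : 3 ∣ d) :
    (∀ μ : ℝ, system d (μ + 2 * π) = system d μ) ∧
      {μ : ℝ | μ ∈ Set.Ico 0 (2 * π) ∧ IsBifurcationPoint (system d) μ} =
        {μ : ℝ | ∃ l : ℕ, l ≤ 5 ∧ μ = (2 * (l : ℝ) + 1) * π / 6} ∧
      ∀ μ : ℝ, IsBifurcationPoint (system d) μ →
        ∃! ν : ℝ, (∃ l : ℕ, l ≤ 5 ∧ ν = (2 * (l : ℝ) + 1) * π / 6) ∧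
          RotationEquivalent (system d μ) (system d ν) := by
  have hd1 : 1 ≤ d := by omega
  have hpi := pi_pos
  refine ⟨system_add_two_pi hd1, ?_, ?_⟩
  · ext μ
    simp only [mem_ofPred_eq, isBifurcationPoint_iff_sin hd, sin_three_mul_phase_eq_zero_iff, mem_Ico]
    constructor
    · rintro ⟨⟨h0, h1⟩, l, rfl⟩
      have a1 : (0 : ℝ) ≤ 2 * l + 1 := by
        by_contra hc; push Not at hc; nlinarith
      have a2 : (2 * l + 1 : ℝ) < 12 := by
        by_contra hc; push Not at hc; nlinarith
      have b1 : 0 ≤ 2 * l + 1 := by exact_mod_cast a1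
      have b2 : 2 * l + 1 < 12 := by exact_mod_cast a2
      refine ⟨l.toNat, by omega, ?_⟩
      have : ((l.toNat : ℕ) : ℝ) = (l : ℝ) := by
        rw [← Int.cast_natCast, Int.toNat_of_nonneg (by omega)]
      rw [this]
    · rintro ⟨l, hl, rfl⟩
      have : (l : ℝ) ≤ 5 := by exact_mod_cast hl
      exact ⟨⟨by positivity, by nlinarith⟩, l, by simp⟩
  · intro μ hμ
    rw [isBifurcationPoint_iff_sin hd, sin_three_mul_phase_eq_zero_iff] at hμ
    obtain ⟨l, rfl⟩ := hμ
    have hpos : 0 ≤ l % 6 := by omega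
    have hcast : (((l % 6).toNat : ℕ) : ℝ) = ((l % 6 : ℤ) : ℝ) := by
      rw [← Int.cast_natCast, Int.toNat_of_nonneg hpos]
    refine ⟨(2 * (((l % 6).toNat : ℕ) : ℝ) + 1) * π / 6, ⟨⟨(l % 6).toNat, by omega, rfl⟩, ?_⟩, ?_⟩
    · refine rotationEquivalent_of hd1 (j := 0) (n := -(l / 6)) ?_
      have h2 : ((l % 6 : ℤ) : ℝ) + 6 * ((l / 6 : ℤ) : ℝ) = l := by exact_mod_cast Int.emod_add_mul_ediv l 6
      rw [hcast]
      push_cast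
      linear_combination π / 3 * h2
    · rintro ν ⟨⟨r, hr, rfl⟩, heq⟩
      obtain ⟨j', n', hjn2⟩ := exists_of_rotationEquivalent hd heq
      obtain ⟨e, rfl⟩ := h3
      have h2 : ((r - l : ℤ) : ℝ) = ((6 * (n' - e * j') : ℤ) : ℝ) := by
        apply mul_right_cancel₀ pi_ne_zero
        push_cast at hjn2 ⊢
        linear_combination 3 * hjn2
      have h3 : (r : ℤ) - l = 6 * (n' - e * j') := by exact_mod_cast h2
      have : r = (l % 6).toNat := by omega
      rw [this]

/-! ### Nondegenerate extrema are centers -/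

/-- A positive periodic function `W` is the reciprocal speed of a solution of `dΘ/dt = 1 / W(Θ)`. -/
lemma exists_angular_solution {W : ℝ → ℝ} (hW : Continuous W) {w : ℝ} (hw : 0 < w)
    (hle : ∀ θ, w ≤ W θ) (hper : Function.Periodic W (2 * π)) (θ₀ : ℝ) :
    ∃ (Θ : ℝ → ℝ) (τ : ℝ), 0 < τ ∧ Θ 0 = θ₀ ∧ Function.Surjective Θ ∧
      (∀ t, HasDerivAt Θ (W (Θ t))⁻¹ t) ∧ ∀ t, Θ (t + τ) = Θ t + 2 * π := by
  -- T is the time needed to reach the angle θ; the solution is its inverse. The bound W ≥ w makes T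
  -- surjective, and periodicity of W gives the period of the motion.
  set T : ℝ → ℝ := fun θ => ∫ x in θ₀..θ, W x with hT
  have hder : ∀ θ, HasDerivAt T (W θ) θ := fun θ => (hW.integral_hasStrictDerivAt θ₀ θ).hasDerivAt
  have hcont : Continuous T := continuous_iff_continuousAt.2 fun θ => (hder θ).continuousAt
  have hpos : ∀ θ, 0 < W θ := fun θ => hw.trans_le (hle θ)
  have hmono : StrictMono T := strictMono_of_deriv_pos fun θ => by rw [(hder θ).deriv]; exact hpos θ
  have hT0 : T θ₀ = 0 := by simp [hT]
  have hlow : Monotone fun θ => T θ - w * θ := by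
    have h1 : ∀ θ, HasDerivAt (fun θ => T θ - w * θ) (W θ - w) θ := fun θ => by
      have h2 := (hder θ).sub ((hasDerivAt_id θ).const_mul w)
      rwa [mul_one] at h2
    exact monotone_of_deriv_nonneg (fun θ => (h1 θ).differentiableAt) fun θ => by
      rw [(h1 θ).deriv]; linarith [hle θ]
  have hsurj : Function.Surjective T := by
    intro y
    have hy : 0 ≤ |y| / w := by positivity
    have hyw : w * (|y| / w) = |y| := by field_simp
    refine mem_range_of_exists_le_of_exists_ge hcont ⟨θ₀ - |y| / w, ?_⟩ ⟨θ₀ + |y| / w, ?_⟩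
    · have := hlow (show θ₀ - |y| / w ≤ θ₀ by linarith)
      simp only [hT0] at this
      have := neg_abs_le y
      linarith
    · have := hlow (show θ₀ ≤ θ₀ + |y| / w by linarith)
      simp only [hT0] at this
      have := le_abs_self y
      linarith
  set e := hmono.orderIsoOfSurjective T hsurj with he
  have heT : ∀ θ, e θ = T θ := fun θ => rfl
  have hTe : ∀ t, T (e.symm t) = t := fun t => by rw [← heT, e.apply_symm_apply]
  have hshift : ∀ θ, T (θ + 2 * π) = T θ + (T (θ₀ + 2 * π) - T θ₀) := by
    have h1 : ∀ θ, HasDerivAt (fun θ => T (θ + 2 * π) - T θ) 0 θ := fun θ => by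
      have h2 := ((hder (θ + 2 * π)).comp_add_const θ (2 * π)).sub (hder θ)
      rwa [hper θ, sub_self] at h2
    intro θ
    have := is_const_of_deriv_eq_zero (fun θ => (h1 θ).differentiableAt) (fun θ => (h1 θ).deriv) θ θ₀
    linarith
  refine ⟨e.symm, T (θ₀ + 2 * π) - T θ₀, ?_, ?_, e.symm.surjective, fun t => ?_, fun t => ?_⟩
  · have := hmono (show θ₀ < θ₀ + 2 * π by linarith [pi_pos])
    linarith
  · rw [← hT0, ← heT, e.symm_apply_apply]
  · exact (hder (e.symm t)).of_local_left_inverse e.symm.continuous.continuousAt (hpos _).ne'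
      (Eventually.of_forall hTe)
  · rw [e.symm_apply_eq, heT, hshift (e.symm t), hTe]

/-- The unit vector of direction `θ`. -/
def unitVec (θ : ℝ) : ℝ × ℝ := (cos θ, sin θ)

lemma hasDerivAt_unitVec (θ : ℝ) : HasDerivAt unitVec (-sin θ, cos θ) θ :=
  (hasDerivAt_cos θ).prodMk (hasDerivAt_sin θ)

lemma unitVec_periodic (θ : ℝ) : unitVec (θ + 2 * π) = unitVec θ := by simp [unitVec]

lemma norm_unitVec_le (θ : ℝ) : ‖unitVec θ‖ ≤ 1 := by
  simp only [unitVec, Prod.norm_def, Real.norm_eq_abs]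
  exact max_le (abs_cos_le_one θ) (abs_sin_le_one θ)

lemma half_le_norm_unitVec_sq (θ : ℝ) : 1 / 2 ≤ ‖unitVec θ‖ ^ 2 := by
  have h1 : |cos θ| ≤ ‖unitVec θ‖ := le_max_left _ _
  have h2 : |sin θ| ≤ ‖unitVec θ‖ := le_max_right _ _
  have h3 := sin_sq_add_cos_sq θ
  have h4 := pow_le_pow_left₀ (abs_nonneg _) h1 2
  have h5 := pow_le_pow_left₀ (abs_nonneg _) h2 2
  rw [sq_abs] at h4 h5
  linarith

lemma exists_polar {v : ℝ × ℝ} (hv : v ≠ 0) : ∃ r θ, 0 < r ∧ r ^ 2 = v.1 ^ 2 + v.2 ^ 2 ∧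
    v = r • unitVec θ := by
  set z : ℂ := ⟨v.1, v.2⟩ with hz
  have hz0 : z ≠ 0 := fun h => hv (by
    have h1 := congrArg Complex.re h
    have h2 := congrArg Complex.im h
    ext <;> assumption)
  refine ⟨‖z‖, z.arg, norm_pos_iff.2 hz0, ?_, ?_⟩
  · rw [Complex.sq_norm, Complex.normSq_apply]; simp only [hz]; ring
  · ext
    · exact (Complex.norm_mul_cos_arg z).symm
    · exact (Complex.norm_mul_sin_arg z).symm

/-- First-order expansion of the differential at p: the radial derivative is r times the Hessian
form plus o(r), uniformly in the direction. -/
lemma exists_radial_bounds {H : ℝ × ℝ → ℝ} (hH : ContDiff ℝ ∞ H) {p : ℝ × ℝ}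
    (h0 : fderiv ℝ H p = 0) (hpos : ∀ v ≠ 0, 0 < fderiv ℝ (fderiv ℝ H) p v v) :
    ∃ r₀ c C : ℝ, 0 < r₀ ∧ 0 < c ∧ 0 < C ∧ ∀ θ r, 0 ≤ r → r ≤ r₀ →
      c * r ≤ fderiv ℝ H (p + r • unitVec θ) (unitVec θ) ∧
      fderiv ℝ H (p + r • unitVec θ) (unitVec θ) ≤ C * r := by
  set B := fderiv ℝ (fderiv ℝ H) p with hB
  have hBd : HasFDerivAt (fderiv ℝ H) B p :=
    ((hH.fderiv_right (m := 1) (by norm_cast)).differentiable (by simp) p).hasFDerivAt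
  obtain ⟨m, hm, hmB⟩ : ∃ m : ℝ, 0 < m ∧ ∀ v, m * ‖v‖ ^ 2 ≤ B v v := by
    have hcont : Continuous fun v : ℝ × ℝ => B v v := by fun_prop
    obtain ⟨v₀, hv₀, hmin⟩ := (isCompact_sphere (0 : ℝ × ℝ) 1).exists_isMinOn
      (NormedSpace.sphere_nonempty.2 zero_le_one) hcont.continuousOn
    have hv₀' : v₀ ≠ 0 := by
      rintro rfl; simp at hv₀
    refine ⟨B v₀ v₀, hpos v₀ hv₀', fun v => ?_⟩
    by_cases hv : v = 0
    · simp [hv]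
    · have hn : ‖v‖ ≠ 0 := norm_ne_zero_iff.2 hv
      have h1 : B v₀ v₀ ≤ B (‖v‖⁻¹ • v) (‖v‖⁻¹ • v) := hmin (by simp [norm_smul, hn])
      simp only [map_smul, smul_apply, smul_eq_mul] at h1
      have h2 : 0 < ‖v‖ := norm_pos_iff.2 hv
      rw [← mul_assoc, ← mul_inv, inv_mul_eq_div, le_div_iff₀ (by positivity)] at h1
      nlinarith
  have hlit := (hasFDerivAt_iff_isLittleO_nhds_zero.1 hBd).def (show 0 < m / 4 by positivity)
  obtain ⟨δ, hδ, hball⟩ := Metric.eventually_nhds_iff.1 hlit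
  -- In the maximum norm ‖u‖² ≥ 1/2 for Euclidean unit vectors, so the form is at least m/2; the
  -- remainder takes away at most m/4.
  refine ⟨δ / 2, m / 4, ‖B‖ + m / 4, by positivity, by positivity, by positivity, fun θ r hr hr' => ?_⟩
  have hu := norm_unitVec_le θ
  have hu2 := half_le_norm_unitVec_sq θ
  have hnr : ‖r • unitVec θ‖ ≤ r := by
    rw [norm_smul, Real.norm_eq_abs, abs_of_nonneg hr]; exact mul_le_of_le_one_right hr hu
  have h1 := hball (y := r • unitVec θ) (by rw [dist_zero_right]; linarith)
  rw [h0, sub_zero] at h1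
  have h2 : |fderiv ℝ H (p + r • unitVec θ) (unitVec θ) - r * B (unitVec θ) (unitVec θ)| ≤ m / 4 * r := by
    have h3 := ContinuousLinearMap.le_opNorm
      (fderiv ℝ H (p + r • unitVec θ) - B (r • unitVec θ)) (unitVec θ)
    have e : (fderiv ℝ H (p + r • unitVec θ) - B (r • unitVec θ)) (unitVec θ) =
        fderiv ℝ H (p + r • unitVec θ) (unitVec θ) - r * B (unitVec θ) (unitVec θ) := by simp
    rw [e, Real.norm_eq_abs] at h3
    refine h3.trans ?_
    calc _ ≤ ‖fderiv ℝ H (p + r • unitVec θ) - B (r • unitVec θ)‖ * 1 := by gcongr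
      _ ≤ m / 4 * ‖r • unitVec θ‖ := by rw [mul_one]; exact h1
      _ ≤ m / 4 * r := by gcongr
  have h4 : m / 2 ≤ B (unitVec θ) (unitVec θ) := by
    have := hmB (unitVec θ); nlinarith
  have h5 : B (unitVec θ) (unitVec θ) ≤ ‖B‖ := by
    have h6 := B.le_opNorm₂ (unitVec θ) (unitVec θ)
    have h7 : ‖B‖ * ‖unitVec θ‖ * ‖unitVec θ‖ ≤ ‖B‖ * 1 * 1 := by gcongr
    have := (le_abs_self _).trans h6
    linarith
  have := abs_le.1 h2
  constructor
  · nlinarith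
  · nlinarith

lemma exists_level_radius {H : ℝ × ℝ → ℝ} (hH : ContDiff ℝ ∞ H) {p : ℝ × ℝ} {r₀ h : ℝ} (hr₀ : 0 < r₀)
    (hmono : ∀ θ, StrictMonoOn (fun r : ℝ => H (p + r • unitVec θ)) (Icc 0 r₀))
    (hder : ∀ θ r, 0 < r → r ≤ r₀ → 0 < fderiv ℝ H (p + r • unitVec θ) (unitVec θ))
    (h₁ : H p < h) (h₂ : ∀ θ, h < H (p + r₀ • unitVec θ)) :
    ∃ ρ : ℝ → ℝ, (∀ θ, 0 < ρ θ ∧ ρ θ < r₀ ∧ H (p + ρ θ • unitVec θ) = h) ∧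
      (∀ θ r, 0 ≤ r → r ≤ r₀ → H (p + r • unitVec θ) = h → r = ρ θ) ∧
      Differentiable ℝ ρ ∧ Function.Periodic ρ (2 * π) := by
  have hex : ∀ θ, ∃ r, 0 < r ∧ r < r₀ ∧ H (p + r • unitVec θ) = h := by
    intro θ
    have hc : ContinuousOn (fun r : ℝ => H (p + r • unitVec θ)) (Icc 0 r₀) := by
      have := hH.continuous
      exact Continuous.continuousOn (by fun_prop)
    obtain ⟨r, hr, hr'⟩ := intermediate_value_Ioo hr₀.le hc
      (show h ∈ Ioo _ _ from ⟨by simpa using h₁, h₂ θ⟩)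
    exact ⟨r, hr.1, hr.2, hr'⟩
  choose ρ hρ using hex
  have huniq : ∀ θ r, 0 ≤ r → r ≤ r₀ → H (p + r • unitVec θ) = h → r = ρ θ := by
    intro θ r hr hr' hh
    exact (hmono θ).injOn ⟨hr, hr'⟩ ⟨(hρ θ).1.le, (hρ θ).2.1.le⟩ (hh.trans (hρ θ).2.2.symm)
  refine ⟨ρ, hρ, huniq, fun θ₀ => ?_, fun θ => ?_⟩
  · set F : ℝ × ℝ → ℝ := fun x => H (p + x.2 • unitVec x.1) with hF
    have hFc : ContDiff ℝ ∞ F := by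
      refine hH.comp (contDiff_const.add (contDiff_snd.smul ?_))
      exact (contDiff_cos.prodMk contDiff_sin).comp contDiff_fst
    have hs : HasStrictFDerivAt F (fderiv ℝ F (θ₀, ρ θ₀)) (θ₀, ρ θ₀) :=
      hFc.contDiffAt.hasStrictFDerivAt (by simp)
    set L := fderiv ℝ F (θ₀, ρ θ₀) ∘L ContinuousLinearMap.inr ℝ ℝ ℝ with hL
    have hL1 : L 1 = fderiv ℝ H (p + ρ θ₀ • unitVec θ₀) (unitVec θ₀) := by
      have e1 : HasDerivAt (fun r : ℝ => F (θ₀, r)) (L 1) (ρ θ₀) := by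
        have e2 : HasDerivAt (fun r : ℝ => (θ₀, r)) ((0 : ℝ), (1 : ℝ)) (ρ θ₀) :=
          (hasDerivAt_const _ _).prodMk (hasDerivAt_id _)
        have e3 := hs.hasFDerivAt.comp_hasDerivAt (ρ θ₀) e2
        exact e3
      have e4 : HasDerivAt (fun r : ℝ => p + r • unitVec θ₀) (unitVec θ₀) (ρ θ₀) := by
        simpa using ((hasDerivAt_id (ρ θ₀)).smul_const (unitVec θ₀)).const_add p
      have e5 := (hH.differentiable (by simp) (p + ρ θ₀ • unitVec θ₀)).hasFDerivAt.comp_hasDerivAt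
        (ρ θ₀) e4
      exact e1.unique e5
    have hL0 : L 1 ≠ 0 := by rw [hL1]; exact (hder θ₀ _ (hρ θ₀).1 (hρ θ₀).2.1.le).ne'
    have hinv : L.IsInvertible := by
      refine ⟨ContinuousLinearEquiv.unitsEquivAut ℝ (Units.mk0 _ hL0), ?_⟩
      ext; simp
    have hψ := hs.hasStrictFDerivAt_implicitFunctionOfProdDomain hinv
    have ht := hs.tendsto_implicitFunctionOfProdDomain hinv
    have hev := hs.eventually_apply_implicitFunctionOfProdDomain hinv
    refine (hψ.hasFDerivAt.differentiableAt).congr_of_eventuallyEq ?_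
    -- The implicit solution stays in (0, r₀) near θ₀, so uniqueness of the level radius identifies
    -- it with ρ and transfers differentiability.
    have hIoo : ∀ᶠ x in 𝓝 θ₀, hs.implicitFunctionOfProdDomain hinv x ∈ Ioo 0 r₀ :=
      ht.eventually (Ioo_mem_nhds (hρ θ₀).1 (hρ θ₀).2.1)
    filter_upwards [hIoo, hev] with x hx hx'
    exact (huniq x _ hx.1.le hx.2.le (hx'.trans (hρ θ₀).2.2)).symm
  · refine huniq _ _ (hρ _).1.le (hρ _).2.1.le ?_
    have := (hρ (θ + 2 * π)).2.2
    rwa [unitVec_periodic] at this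

lemma smul_unitVec_sq (r θ : ℝ) :
    (r • unitVec θ).1 ^ 2 + (r • unitVec θ).2 ^ 2 = r ^ 2 := by
  simp only [unitVec, Prod.smul_mk, smul_eq_mul]
  linear_combination r ^ 2 * sin_sq_add_cos_sq θ

/-- Near a strict minimum the level sets are closed curves r = ρ(θ) about p. The flow preserves the
level and its angular speed has absolute value R/ρ, with R > 0 the radial derivative of H, so it
runs around the whole curve periodically. -/
theorem isCenter_of_posDef {H : ℝ × ℝ → ℝ} (hH : ContDiff ℝ ∞ H) {p : ℝ × ℝ}
    (h0 : fderiv ℝ H p = 0) (hpos : ∀ v ≠ 0, 0 < fderiv ℝ (fderiv ℝ H) p v v) :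
    IsCenter (hamiltonianField H) p := by
  obtain ⟨r₀, c, C, hr₀, hc, hC, hbd⟩ := exists_radial_bounds hH h0 hpos
  have hdiff : Differentiable ℝ H := hH.differentiable (by simp)
  have hrad : ∀ θ r : ℝ, HasDerivAt (fun r : ℝ => H (p + r • unitVec θ))
      (fderiv ℝ H (p + r • unitVec θ) (unitVec θ)) r := by
    intro θ r
    have e4 : HasDerivAt (fun r : ℝ => p + r • unitVec θ) (unitVec θ) r := by
      simpa using ((hasDerivAt_id r).smul_const (unitVec θ)).const_add p
    exact (hdiff _).hasFDerivAt.comp_hasDerivAt r e4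
  have hquad : ∀ θ, MonotoneOn (fun r : ℝ => H (p + r • unitVec θ) - c / 2 * r ^ 2) (Icc 0 r₀) := by
    intro θ
    have e : ∀ r, HasDerivAt (fun r : ℝ => H (p + r • unitVec θ) - c / 2 * r ^ 2)
        (fderiv ℝ H (p + r • unitVec θ) (unitVec θ) - c * r) r := by
      intro r
      have := (hrad θ r).sub ((hasDerivAt_pow 2 r).const_mul (c / 2))
      convert! this using 1
      push_cast; ring
    refine monotoneOn_of_deriv_nonneg (convex_Icc 0 r₀)
      (fun r _ => (e r).continuousAt.continuousWithinAt)
      (fun r _ => (e r).differentiableAt.differentiableWithinAt) fun r hr => ?_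
    rw [interior_Icc] at hr
    rw [(e r).deriv]
    linarith [(hbd θ r hr.1.le hr.2.le).1]
  have hmono : ∀ θ, StrictMonoOn (fun r : ℝ => H (p + r • unitVec θ)) (Icc 0 r₀) := by
    intro θ r hr s hs hrs
    have h1 := hquad θ hr hs hrs.le
    have h2 : r ^ 2 < s ^ 2 := pow_lt_pow_left₀ hrs hr.1 (by norm_num)
    simp only at h1 ⊢
    nlinarith
  have hout : ∀ θ, H p + c / 2 * r₀ ^ 2 ≤ H (p + r₀ • unitVec θ) := by
    intro θ
    have := hquad θ (left_mem_Icc.2 hr₀.le) (right_mem_Icc.2 hr₀.le) hr₀.le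
    simp at this
    linarith
  refine ⟨hamiltonianField_eq_zero_iff.2 h0, ?_⟩
  have hev1 : ∀ᶠ q in 𝓝 p, H q < H p + c / 2 * r₀ ^ 2 :=
    hH.continuous.continuousAt.eventually_lt continuousAt_const (by simp; positivity)
  have hev2 : ∀ᶠ q : ℝ × ℝ in 𝓝 p, (q - p).1 ^ 2 + (q - p).2 ^ 2 < r₀ ^ 2 :=
    ContinuousAt.eventually_lt (by fun_prop) continuousAt_const (by simp; positivity)
  rw [eventually_nhdsWithin_iff]
  filter_upwards [hev1, hev2] with q hq1 hq2 hqp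
  obtain ⟨r, θ₀, hr, hrsq, hqr⟩ := exists_polar (sub_ne_zero.2 hqp)
  have hrr₀ : r < r₀ := by
    rw [← hrsq] at hq2
    exact lt_of_pow_lt_pow_left₀ 2 hr₀.le hq2
  have hq : q = p + r • unitVec θ₀ := by rw [← hqr]; simp
  have hpq : H p < H q := by
    have := hmono θ₀ (left_mem_Icc.2 hr₀.le) ⟨hr.le, hrr₀.le⟩ hr
    simpa [← hq] using this
  obtain ⟨ρ, hρ, huniq, hρd, hρper⟩ := exists_level_radius hH hr₀ hmono
    (fun θ r hr hr' => lt_of_lt_of_le (by positivity) (hbd θ r hr.le hr').1) hpq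
    (fun θ => hq1.trans_le (hout θ))
  have hρ₀ : ρ θ₀ = r := (huniq θ₀ r hr.le hrr₀.le (by rw [← hq])).symm
  set x : ℝ → ℝ × ℝ := fun θ => p + ρ θ • unitVec θ with hx
  set R : ℝ → ℝ := fun θ => fderiv ℝ H (x θ) (unitVec θ) with hR
  have hRpos : ∀ θ, 0 < R θ := fun θ =>
    lt_of_lt_of_le (mul_pos hc (hρ θ).1) (hbd θ _ (hρ θ).1.le (hρ θ).2.1.le).1
  have hxd : ∀ θ, HasDerivAt x (deriv ρ θ • unitVec θ + ρ θ • (-sin θ, cos θ)) θ := by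
    intro θ
    have := ((hρd θ).hasDerivAt.smul (hasDerivAt_unitVec θ)).const_add p
    rwa [add_comm] at this
  have hxper : ∀ θ, x (θ + 2 * π) = x θ := fun θ => by
    simp only [hx, hρper θ, unitVec_periodic]
  have hxc : Continuous x := continuous_iff_continuousAt.2 fun θ => (hxd θ).continuousAt
  have huc : Continuous unitVec := continuous_iff_continuousAt.2 fun θ => (hasDerivAt_unitVec θ).continuousAt
  have hRc : Continuous R :=
    ((hH.continuous_fderiv (by simp)).comp hxc).clm_apply huc
  have hrel : ∀ θ, deriv ρ θ * R θ + ρ θ * fderiv ℝ H (x θ) (-sin θ, cos θ) = 0 := by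
    intro θ
    have h1 := (hdiff (x θ)).hasFDerivAt.comp_hasDerivAt θ (hxd θ)
    have h2 : H ∘ x = fun _ => H q := funext fun θ => (hρ θ).2.2
    rw [h2] at h1
    have h3 := h1.unique (hasDerivAt_const θ (H q))
    rw [map_add, map_smul, map_smul] at h3
    exact h3
  obtain ⟨Θ, τ, hτ, hΘ0, hΘs, hΘd, hΘτ⟩ := exists_angular_solution (W := fun θ => ρ θ / R θ)
    (hρd.continuous.div hRc fun θ => (hRpos θ).ne') (w := C⁻¹) (by positivity)
    (fun θ => by
      rw [inv_eq_one_div, div_le_div_iff₀ hC (hRpos θ)]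
      linarith [(hbd θ _ (hρ θ).1.le (hρ θ).2.1.le).2])
    (fun θ => by simp only [hR, hρper θ, hxper, unitVec_periodic]) θ₀
  have hrange : range (fun t => x (Θ (-t))) = range x := by
    apply Subset.antisymm
    · rintro _ ⟨t, rfl⟩; exact ⟨_, rfl⟩
    · rintro _ ⟨θ, rfl⟩
      obtain ⟨t, rfl⟩ := hΘs θ
      exact ⟨-t, by simp⟩
  have hlevel : ∀ y, y ∈ range x ↔ (y - p).1 ^ 2 + (y - p).2 ^ 2 ≤ r₀ ^ 2 ∧ H y = H q := by
    intro y
    constructor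
    · rintro ⟨θ, rfl⟩
      refine ⟨?_, (hρ θ).2.2⟩
      rw [show x θ - p = ρ θ • unitVec θ by simp [hx], smul_unitVec_sq]
      exact pow_le_pow_left₀ (hρ θ).1.le (hρ θ).2.1.le 2
    · rintro ⟨h1, h2⟩
      have hyp : y ≠ p := by rintro rfl; exact hpq.ne h2
      obtain ⟨s, θ, hs, hssq, hy⟩ := exists_polar (sub_ne_zero.2 hyp)
      have hy' : y = p + s • unitVec θ := by rw [← hy]; simp
      rw [← hssq] at h1
      have hs' : s ≤ r₀ := le_of_sq_le_sq h1 hr₀.le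
      refine ⟨θ, ?_⟩
      rw [hy', huniq θ s hs.le hs' (by rw [← hy', h2])]
  have hpn : p ∉ range x := fun h => hpq.ne ((hlevel p).1 h).2
  -- Time is reversed because (∂_y H, −∂_x H) turns clockwise around a minimum.
  refine ⟨fun t => x (Θ (-t)), ?_, ?_, ⟨τ, hτ, fun t => ?_⟩, ?_, ?_⟩
  · simp only [neg_zero, hΘ0, hx, hρ₀]; exact hq.symm
  · intro t
    have h1 : HasDerivAt (fun t => Θ (-t)) (-(ρ (Θ (-t)) / R (Θ (-t)))⁻¹) t := by
      have := (hΘd (-t)).scomp t (hasDerivAt_neg t)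
      simpa [Function.comp_def] using this
    have h2 := (hxd (Θ (-t))).scomp t h1
    convert! h2 using 1
    change hamiltonianField H (x (Θ (-t))) = _
    generalize Θ (-t) = θ
    have h3 := hrel θ
    have h4 := (hRpos θ).ne'
    have h5 := (hρ θ).1.ne'
    have e1 : R θ = cos θ * fderiv ℝ H (x θ) (1, 0) + sin θ * fderiv ℝ H (x θ) (0, 1) := by
      simp only [hR]; rw [clm_apply_eq]; simp [unitVec]
    have e2 : fderiv ℝ H (x θ) (-sin θ, cos θ) =
        -sin θ * fderiv ℝ H (x θ) (1, 0) + cos θ * fderiv ℝ H (x θ) (0, 1) := by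
      rw [clm_apply_eq]
    have h6 : deriv ρ θ = -ρ θ * fderiv ℝ H (x θ) (-sin θ, cos θ) / R θ := by
      field_simp; linarith
    rw [h6, e2]
    have hsc := sin_sq_add_cos_sq θ
    simp only [hamiltonianField, unitVec]
    ext
    · simp only [Prod.smul_mk, smul_eq_mul, Prod.mk_add_mk]
      field_simp
      rw [e1]
      linear_combination (-fderiv ℝ H (x θ) (0, 1)) * hsc
    · simp only [Prod.smul_mk, smul_eq_mul, Prod.mk_add_mk]
      field_simp
      rw [e1]
      linear_combination (fderiv ℝ H (x θ) (1, 0)) * hsc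
  · have := hΘτ (-(t + τ))
    rw [show -(t + τ) + τ = -t by ring] at this
    simp only [this, hxper]
  · rw [hrange]; exact hpn
  · rw [hrange]
    set N : ℝ × ℝ → ℝ := fun y => (y - p).1 ^ 2 + (y - p).2 ^ 2 with hN
    have hNc : Continuous N := by simp only [hN]; fun_prop
    have hU : IsOpen {y | N y < r₀ ^ 2 ∧ H y < H q} :=
      (isOpen_lt hNc continuous_const).inter (isOpen_lt hH.continuous continuous_const)
    have hV : IsOpen {y | N y ≤ r₀ ^ 2 ∧ H y ≤ H q}ᶜ :=
      ((isClosed_le hNc continuous_const).inter (isClosed_le hH.continuous continuous_const)).isOpen_compl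
    have hdisj : Disjoint {y | N y < r₀ ^ 2 ∧ H y < H q} {y | N y ≤ r₀ ^ 2 ∧ H y ≤ H q}ᶜ := by
      rw [disjoint_compl_right_iff_subset]
      exact fun y hy => ⟨hy.1.le, hy.2.le⟩
    -- Off the level curve, the two open sets could miss only points of the circle of radius r₀ with
    -- H < H q, and there H ≥ H p + (c/2)r₀² > H q. So the component of p stays inside the disc.
    have hsub : (range x)ᶜ ⊆ {y | N y < r₀ ^ 2 ∧ H y < H q} ∪ {y | N y ≤ r₀ ^ 2 ∧ H y ≤ H q}ᶜ := by
      intro y hy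
      by_contra hcon
      simp only [mem_union, mem_compl_iff, not_or, not_not] at hcon
      obtain ⟨h1, h2, h3⟩ := hcon
      have hne : H y ≠ H q := fun h => hy ((hlevel y).2 ⟨h2, h⟩)
      have hlt := lt_of_le_of_ne h3 hne
      have hNr : N y = r₀ ^ 2 := by
        by_contra hN'
        exact h1 ⟨lt_of_le_of_ne h2 hN', hlt⟩
      have hyp : y ≠ p := by
        rintro rfl
        simp only [hN, sub_self, Prod.fst_zero, Prod.snd_zero] at hNr
        nlinarith
      obtain ⟨s, θ, hs, hssq, hy'⟩ := exists_polar (sub_ne_zero.2 hyp)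
      have hs₀ : s = r₀ := by
        have : s ^ 2 = r₀ ^ 2 := hssq.trans hNr
        exact (pow_left_inj₀ hs.le hr₀.le (by norm_num)).1 this
      have := hout θ
      rw [← hs₀, ← hy', add_sub_cancel, hs₀] at this
      linarith
    have hpU : p ∈ {y | N y < r₀ ^ 2 ∧ H y < H q} := ⟨by simp [hN]; positivity, hpq⟩
    have hcomp : connectedComponentIn (range x)ᶜ p ⊆ {y | N y < r₀ ^ 2 ∧ H y < H q} :=
      isPreconnected_connectedComponentIn.subset_left_of_subset_union hU hV hdisj
        ((connectedComponentIn_subset _ _).trans hsub) ⟨p, mem_connectedComponentIn hpn, hpU⟩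
    refine (Metric.isBounded_closedBall (x := p) (r := r₀)).subset fun y hy => ?_
    have h1 := (hcomp hy).1
    simp only [hN] at h1
    rw [Metric.mem_closedBall, dist_eq_norm, Prod.norm_def]
    refine max_le (abs_le_of_sq_le_sq ?_ hr₀.le) (abs_le_of_sq_le_sq ?_ hr₀.le)
    · nlinarith [sq_nonneg (y - p).2]
    · nlinarith [sq_nonneg (y - p).1]

/-- Time reversal leaves the orbits unchanged as sets. -/
lemma IsCenter.of_neg {f : ℝ × ℝ → ℝ × ℝ} {p : ℝ × ℝ} (h : IsCenter (fun q => -f q) p) :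
    IsCenter f p := by
  refine ⟨neg_eq_zero.1 h.1, h.2.mono fun q => ?_⟩
  rintro ⟨γ, h0, hd, ⟨T, hT, hper⟩, hp, hb⟩
  have hr : range (fun t => γ (-t)) = range γ := by
    ext y
    exact ⟨fun ⟨t, ht⟩ => ⟨-t, ht⟩, fun ⟨t, ht⟩ => ⟨-t, by simpa using ht⟩⟩
  refine ⟨fun t => γ (-t), by simpa using h0, fun t => ?_, ⟨T, hT, fun t => ?_⟩, ?_, ?_⟩
  · have := (hd (-t)).scomp t (hasDerivAt_neg t)
    simpa [Function.comp_def] using this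
  · have := hper (-(t + T))
    rw [show -(t + T) + T = -t by ring] at this
    exact this.symm
  · rwa [hr]
  · rwa [hr]

theorem isCenter_of_negDef {H : ℝ × ℝ → ℝ} (hH : ContDiff ℝ ∞ H) {p : ℝ × ℝ}
    (h0 : fderiv ℝ H p = 0) (hneg : ∀ v ≠ 0, fderiv ℝ (fderiv ℝ H) p v v < 0) :
    IsCenter (hamiltonianField H) p := by
  have h1 : fderiv ℝ (fun q => -H q) = fun q => -fderiv ℝ H q := by
    funext q; exact fderiv_fun_neg
  have h2 := isCenter_of_posDef hH.neg (p := p) (by simp [h0]) (fun v hv => by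
    rw [h1, fderiv_fun_neg]
    simpa using hneg v hv)
  refine IsCenter.of_neg ?_
  have h3 : (fun q => -hamiltonianField H q) = hamiltonianField fun q => -H q := by
    funext q
    simp [hamiltonianField]
  rwa [h3]

/-! ### Hessians at crossings and triple points -/

lemma tangentCLM_unitVec (ψ φ : ℝ) : tangentCLM ψ (unitVec φ) = sin (φ - ψ) := by
  rw [tangentCLM_apply, unitVec, sin_sub]; ring

lemma hasFDerivAt_fderiv {H : ℝ × ℝ → ℝ} (hH : ContDiff ℝ ∞ H) (p : ℝ × ℝ) :
    HasFDerivAt (fderiv ℝ H) (fderiv ℝ (fderiv ℝ H) p) p :=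
  ((hH.fderiv_right (m := 1) (by norm_cast)).differentiable (by simp) p).hasFDerivAt

lemma exists_eq_smul_unitVec {φ ψ : ℝ} (h : sin (φ - ψ) ≠ 0) (v : ℝ × ℝ) :
    ∃ a b : ℝ, v = a • unitVec φ + b • unitVec ψ := by
  have h' : sin φ * cos ψ - cos φ * sin ψ ≠ 0 := by rwa [← sin_sub]
  refine ⟨(v.2 * cos ψ - v.1 * sin ψ) / sin (φ - ψ), (v.1 * sin φ - v.2 * cos φ) / sin (φ - ψ), ?_⟩
  rw [sin_sub]
  ext <;> simp only [unitVec, Prod.smul_mk, smul_eq_mul, Prod.mk_add_mk] <;>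
    rw [div_mul_eq_mul_div, div_mul_eq_mul_div, ← add_div, eq_div_iff h'] <;> ring

/-- Second derivative of `P_chord_cheb` in t; the chord has speed 2, which absorbs the factor 4. -/
lemma hessian_unitVec {d : ℕ} (hd : 1 ≤ d) (μ φ t : ℝ) :
    fderiv ℝ (fderiv ℝ (P d μ)) (chord φ t) (unitVec φ) (unitVec φ) =
      -(sin (d * φ + phase μ) * chebDeriv₂ d t) := by
  have h1 := (hasFDerivAt_fderiv (contDiff_P hd μ) (chord φ t)).comp_hasDerivAt t (hasDerivAt_chord φ t)
  have h2 := h1.clm_apply (hasDerivAt_const t ((2 * cos φ, 2 * sin φ) : ℝ × ℝ))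
  have h3 : (fun t => (fderiv ℝ (P d μ) ∘ chord φ) t (2 * cos φ, 2 * sin φ)) =
      fun t => -4 * sin (d * φ + phase μ) * chebDeriv d t := funext fun t => fderiv_P_chord hd μ φ t
  rw [h3] at h2
  have h4 := h2.unique ((hasDerivAt_chebDeriv d t).const_mul (-4 * sin (d * φ + phase μ)))
  have h5 : ((2 * cos φ, 2 * sin φ) : ℝ × ℝ) = (2 : ℝ) • unitVec φ := by ext <;> simp [unitVec]
  rw [h5] at h4
  simp only [map_smul, smul_apply, smul_eq_mul, map_zero, add_zero] at h4
  linarith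

/-- The vectors wᵢ = sin(φⱼ − φₖ)·e^{iφᵢ} (i, j, k cyclic) sum to zero, and the Hessian has the same
value k on each of them. Hence it is k(a² − ab + b²) on a·w₁ + b·w₂, and k ≠ 0 as long as the phase
of μ differs from κ modulo π. -/
lemma hessian_definite {d : ℕ} (hd : 1 ≤ d) {μ κ φ₁ φ₂ φ₃ : ℝ} {p : ℝ × ℝ}
    (h : IsTriplePoint d κ φ₁ φ₂ φ₃ p) (hκ : sin (phase μ - κ) ≠ 0) :
    (∀ v ≠ 0, 0 < fderiv ℝ (fderiv ℝ (P d μ)) p v v) ∨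
      ∀ v ≠ 0, fderiv ℝ (fderiv ℝ (P d μ)) p v v < 0 := by
  set B := fderiv ℝ (fderiv ℝ (P d μ)) p with hB
  set k : ℝ := d ^ 2 * (cos (d * (φ₁ + φ₂ + φ₃)) *
      (cos (d * φ₁ + κ) * cos (d * φ₂ + κ) * cos (d * φ₃ + κ)) * sin (phase μ - κ)) with hk
  have hdr : (d : ℝ) ≠ 0 := by positivity
  have hcos : ∀ x : ℝ, sin x = 0 → cos x ≠ 0 := fun x h1 h2 => by
    have := sin_sq_add_cos_sq x; simp [h1, h2] at this
  have hk0 : k ≠ 0 := by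
    have h1 := hcos _ h.sin_mul_sum
    have h2 := hcos _ h.line₁.1
    have h3 := hcos _ h.line₂.1
    have h4 := hcos _ h.line₃.1
    simp only [hk]
    positivity
  have key : ∀ {φ₁ φ₂ φ₃}, IsTriplePoint d κ φ₁ φ₂ φ₃ p →
      B (sin (φ₂ - φ₃) • unitVec φ₁) (sin (φ₂ - φ₃) • unitVec φ₁) =
      d ^ 2 * (cos (d * (φ₁ + φ₂ + φ₃)) *
      (cos (d * φ₁ + κ) * cos (d * φ₂ + κ) * cos (d * φ₃ + κ)) * sin (phase μ - κ)) := by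
    intro φ₁ φ₂ φ₃ h
    have h0 : sin (φ₁ + 2 * φ₂) ≠ 0 := fun h0 => by
      have := h.sin_chord_sq; rw [h0] at this; exact h.ne₂₃ (by simpa using this.symm)
    have h1 := hessian_unitVec hd μ φ₁ (cos (φ₁ + 2 * φ₂))
    rw [← h.eq_chord] at h1
    have h2 := sin_sq_mul_chebDeriv₂ hd h0 h.sin_mul_chord
    have h3 := h.cos_mul_sin (phase μ)
    simp only [map_smul, smul_apply, smul_eq_mul]
    rw [hB, h1, ← h3]
    have h4 := h.sin_chord_sq
    linear_combination (-sin (d * φ₁ + phase μ)) * h2 +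
      sin (d * φ₁ + phase μ) * chebDeriv₂ d (cos (φ₁ + 2 * φ₂)) * h4
  have k1 := key h
  have k2 := key h.rotate
  have k3 := key h.rotate.rotate
  rw [← hk] at k1
  rw [show φ₂ + φ₃ + φ₁ = φ₁ + φ₂ + φ₃ by ring,
    show cos (d * φ₂ + κ) * cos (d * φ₃ + κ) * cos (d * φ₁ + κ) =
      cos (d * φ₁ + κ) * cos (d * φ₂ + κ) * cos (d * φ₃ + κ) by ring, ← hk] at k2
  rw [show φ₃ + φ₁ + φ₂ = φ₁ + φ₂ + φ₃ by ring,
    show cos (d * φ₃ + κ) * cos (d * φ₁ + κ) * cos (d * φ₂ + κ) =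
      cos (d * φ₁ + κ) * cos (d * φ₂ + κ) * cos (d * φ₃ + κ) by ring, ← hk] at k3
  have hsum : sin (φ₁ - φ₂) • unitVec φ₃ =
      -(sin (φ₂ - φ₃) • unitVec φ₁ + sin (φ₃ - φ₁) • unitVec φ₂) := by
    rw [eq_neg_iff_add_eq_zero, add_comm]; exact direction_combination φ₁ φ₂ φ₃
  rw [hsum] at k3
  have hquad : ∀ v : ℝ × ℝ, v ≠ 0 → ∃ e : ℝ, 0 < e ∧ B v v = k * e := by
    intro v hv
    obtain ⟨a, b, hab⟩ := exists_eq_smul_unitVec h.ne₁₂ v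
    set w₁ := sin (φ₂ - φ₃) • unitVec φ₁
    set w₂ := sin (φ₃ - φ₁) • unitVec φ₂
    set a' := a / sin (φ₂ - φ₃)
    set b' := b / sin (φ₃ - φ₁)
    have hv' : v = a' • w₁ + b' • w₂ := by
      simp only [hab, a', b', w₁, w₂, smul_smul]
      rw [div_mul_cancel₀ _ h.ne₂₃, div_mul_cancel₀ _ h.ne₃₁]
    simp only [map_neg, map_add, neg_apply, add_apply] at k3
    refine ⟨a' ^ 2 - a' * b' + b' ^ 2, ?_, ?_⟩
    · by_contra hc
      have h1 : a' = 0 ∧ b' = 0 := by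
        constructor <;> nlinarith [sq_nonneg (a' - b'), sq_nonneg (a' + b'), sq_nonneg a', sq_nonneg b']
      rw [hv', h1.1, h1.2] at hv
      simp at hv
    · rw [hv']
      simp only [map_add, map_smul, add_apply, smul_apply, smul_eq_mul]
      linear_combination (a' ^ 2 - a' * b') * k1 + (b' ^ 2 - a' * b') * k2 + a' * b' * k3
  rcases hk0.lt_or_gt with hk' | hk'
  · right
    intro v hv
    obtain ⟨e, he, hBe⟩ := hquad v hv
    rw [hBe]; exact mul_neg_of_neg_of_pos hk' he
  · left
    intro v hv
    obtain ⟨e, he, hBe⟩ := hquad v hv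
    rw [hBe]; exact mul_pos hk' he

lemma isCenter_of_isTriplePoint {d : ℕ} (hd : 1 ≤ d) {μ κ φ₁ φ₂ φ₃ : ℝ} {p : ℝ × ℝ}
    (h : IsTriplePoint d κ φ₁ φ₂ φ₃ p) (hκ : sin (phase μ - κ) ≠ 0) : IsCenter (system d μ) p := by
  have h0 := stationary_of_isTriplePoint hd μ h
  rcases hessian_definite hd h hκ with hpos | hneg
  · exact isCenter_of_posDef (contDiff_P hd μ) h0 hpos
  · exact isCenter_of_negDef (contDiff_P hd μ) h0 hneg

/-! ### Saddles and degenerate critical points -/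

lemma hessian_mul {φ ψ : ℝ} {G : ℝ × ℝ → ℝ} (hG : ContDiff ℝ ∞ G) {p : ℝ × ℝ}
    (h₁ : tangentForm φ p = 0) (h₂ : tangentForm ψ p = 0) (v w : ℝ × ℝ) :
    fderiv ℝ (fderiv ℝ fun q => tangentForm φ q * tangentForm ψ q * G q) p v w =
      G p * (tangentCLM φ v * tangentCLM ψ w + tangentCLM ψ v * tangentCLM φ w) := by
  have hGd : Differentiable ℝ G := hG.differentiable (by simp)
  have hfd : fderiv ℝ (fun q => tangentForm φ q * tangentForm ψ q * G q) = fun q =>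
      (tangentForm φ q * tangentForm ψ q) • fderiv ℝ G q +
        G q • (tangentForm φ q • tangentCLM ψ + tangentForm ψ q • tangentCLM φ) := by
    funext q
    exact (((hasFDerivAt_tangentForm φ q).mul (hasFDerivAt_tangentForm ψ q)).mul
      (hGd q).hasFDerivAt).fderiv
  have e1 := (hasFDerivAt_tangentForm φ p).mul (hasFDerivAt_tangentForm ψ p)
  have e2 := e1.smul (hasFDerivAt_fderiv hG p)
  have e3 := ((hasFDerivAt_tangentForm φ p).smul_const (tangentCLM ψ)).add
    ((hasFDerivAt_tangentForm ψ p).smul_const (tangentCLM φ))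
  have e4 := e2.add ((hGd p).hasFDerivAt.smul e3)
  rw [hfd]
  refine (congrArg (fun L : ℝ × ℝ →L[ℝ] ℝ × ℝ →L[ℝ] ℝ => L v w) (HasFDerivAt.fderiv e4)).trans ?_
  simp [h₁, h₂, mul_add]

/-- The linearization of a Hamiltonian field has trace zero, so its eigenvalues are ±√(b² − ac). -/
lemma isSaddle_of_hessian {H : ℝ × ℝ → ℝ} (hH : ContDiff ℝ ∞ H) {p : ℝ × ℝ}
    (h0 : fderiv ℝ H p = 0) {a b c : ℝ}
    (ha : fderiv ℝ (fderiv ℝ H) p (1, 0) (1, 0) = a) (hb : fderiv ℝ (fderiv ℝ H) p (1, 0) (0, 1) = b)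
    (hb' : fderiv ℝ (fderiv ℝ H) p (0, 1) (1, 0) = b) (hc : fderiv ℝ (fderiv ℝ H) p (0, 1) (0, 1) = c)
    (hdet : a * c - b ^ 2 < 0) : IsSaddle (hamiltonianField H) p := by
  set B := fderiv ℝ (fderiv ℝ H) p with hB
  have hBd := hasFDerivAt_fderiv hH p
  have hf : HasFDerivAt (hamiltonianField H)
      ((B.flip (0, 1)).prod (-B.flip (1, 0))) p := by
    refine HasFDerivAt.prodMk ?_ (HasFDerivAt.neg ?_)
    · have := hBd.clm_apply (hasFDerivAt_const ((0 : ℝ), (1 : ℝ)) p)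
      simpa using this
    · have := hBd.clm_apply (hasFDerivAt_const ((1 : ℝ), (0 : ℝ)) p)
      simpa using this
  have happ : ∀ v : ℝ × ℝ, fderiv ℝ (hamiltonianField H) p v =
      (v.1 * b + v.2 * c, -(v.1 * a + v.2 * b)) := by
    intro v
    rw [hf.fderiv]
    have hv : v = v.1 • ((1 : ℝ), (0 : ℝ)) + v.2 • ((0 : ℝ), (1 : ℝ)) := by ext <;> simp
    have e1 : B v (0, 1) = v.1 * b + v.2 * c := by
      conv_lhs => rw [hv]
      rw [map_add, map_smul, map_smul, add_apply, smul_apply, smul_apply, hb, hc]; rfl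
    have e2 : B v (1, 0) = v.1 * a + v.2 * b := by
      conv_lhs => rw [hv]
      rw [map_add, map_smul, map_smul, add_apply, smul_apply, smul_apply, ha, hb']; rfl
    simp [e1, e2]
  have heig : ∀ l : ℝ, l ≠ 0 → l ^ 2 = b ^ 2 - a * c → Module.End.HasEigenvalue
      (fderiv ℝ (hamiltonianField H) p : (ℝ × ℝ) →ₗ[ℝ] (ℝ × ℝ)) l := by
    intro l hl hl2
    have key : ∀ w : ℝ × ℝ, w ≠ 0 → fderiv ℝ (hamiltonianField H) p w = l • w →
        Module.End.HasEigenvalue (fderiv ℝ (hamiltonianField H) p : (ℝ × ℝ) →ₗ[ℝ] (ℝ × ℝ)) l :=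
      fun w hw h => Module.End.hasEigenvalue_of_hasEigenvector
        ⟨Module.End.mem_eigenspace_iff.2 h, hw⟩
    -- The generic eigenvector (b + l, −a) may vanish when b = −l; then (c, l − b) has second entry
    -- 2l ≠ 0.
    by_cases hbl : b + l = 0
    · refine key (c, l - b) ?_ ?_
      · intro h
        have : l - b = 0 := congrArg Prod.snd h
        apply hl; linarith
      · rw [happ]
        ext
        · simp; ring
        · simp; linear_combination (-1 : ℝ) * hl2
    · refine key (b + l, -a) ?_ ?_
      · intro h
        exact hbl (congrArg Prod.fst h)
      · rw [happ]
        ext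
        · simp; linear_combination (-1 : ℝ) * hl2
        · simp; ring
  have hs : 0 < √(b ^ 2 - a * c) := Real.sqrt_pos.2 (by linarith)
  have hsq : √(b ^ 2 - a * c) ^ 2 = b ^ 2 - a * c := Real.sq_sqrt (by linarith)
  exact ⟨hamiltonianField_eq_zero_iff.2 h0, hf.differentiableAt, -√(b ^ 2 - a * c), √(b ^ 2 - a * c),
    by linarith, hs, heig _ (by linarith) (by rw [neg_sq, hsq]), heig _ hs.ne' hsq⟩

/-- At a crossing of two lines the potential is the product of two forms and a cofactor. -/
lemma exists_P_eq_mul_pair {d : ℕ} (hd : 1 ≤ d) (μ : ℝ) {s r : ℤ} (hs : s ∈ idx d) (hr : r ∈ idx d)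
    (hsr : s ≠ r) : ∃ G : ℝ × ℝ → ℝ, ContDiff ℝ ∞ G ∧
      (P d μ = fun p => tangentForm (angle d μ s) p * tangentForm (angle d μ r) p * G p) ∧
      ∀ p, G p = 0 ↔ ∃ u ∈ idx d, u ≠ s ∧ u ≠ r ∧ tangentForm (angle d μ u) p = 0 := by
  obtain ⟨G, hG, hP, hG0⟩ := exists_P_eq_mul hd μ (S := {s, r})
    (Finset.insert_subset hs (Finset.singleton_subset_iff.2 hr))
  refine ⟨G, hG, ?_, fun p => ?_⟩
  · funext p; rw [hP, Finset.prod_pair hsr]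
  · rw [hG0]
    simp [and_assoc]

lemma cofactor_ne_zero {d : ℕ} (hd : 1 ≤ d) {μ : ℝ} {s r : ℤ} (hs : s ∈ idx d) (hr : r ∈ idx d)
    (hsr : s ≠ r) (h : crossPoint (angle d μ s) (angle d μ r) ∉ triplePoints d (phase μ)) :
    ¬ ∃ u ∈ idx d, u ≠ s ∧ u ≠ r ∧
      tangentForm (angle d μ u) (crossPoint (angle d μ s) (angle d μ r)) = 0 := by
  rintro ⟨u, hu, hus, hur, h0⟩
  exact h ⟨_, _, _, isTriplePoint_angle hd hs hr hu hsr hur.symm hus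
    (tangentForm_crossPoint_left _ _) (tangentForm_crossPoint_right _ _) h0⟩

/-- At a simple crossing the Hessian is G(p) times the symmetrised product of two independent linear
forms, with determinant −(G(p) sin(φ_s − φ_r))². -/
lemma isSaddle_crossPoint {d : ℕ} (hd : 1 ≤ d) {μ : ℝ} {s r : ℤ} (hs : s ∈ idx d) (hr : r ∈ idx d)
    (hsr : s ≠ r) (h : crossPoint (angle d μ s) (angle d μ r) ∉ triplePoints d (phase μ)) :
    IsSaddle (system d μ) (crossPoint (angle d μ s) (angle d μ r)) := by
  obtain ⟨G, hG, hP, hG0⟩ := exists_P_eq_mul_pair hd μ hs hr hsr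
  set p := crossPoint (angle d μ s) (angle d μ r) with hp
  have hGp : G p ≠ 0 := fun h0 => cofactor_ne_zero hd hs hr hsr h ((hG0 p).1 h0)
  have h1 : tangentForm (angle d μ s) p = 0 := tangentForm_crossPoint_left _ _
  have h2 : tangentForm (angle d μ r) p = 0 := tangentForm_crossPoint_right _ _
  have hstat : fderiv ℝ (P d μ) p = 0 := stationary_of_mem_crossings hd
    ⟨_, _, sin_sub_angle_ne_zero hd μ hs hr hsr, isLineThrough_angle hd hs h1,
      isLineThrough_angle hd hr h2⟩
  have hB := hessian_mul hG h1 h2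
  rw [← hP] at hB
  have hne := sin_sub_angle_ne_zero hd μ hs hr hsr
  refine isSaddle_of_hessian (contDiff_P hd μ) hstat (hB _ _) (hB _ _) ?_ (hB _ _) ?_
  · rw [hB]; ring
  · simp only [tangentCLM_apply]
    have h3 : 0 < (G p * sin (angle d μ s - angle d μ r)) ^ 2 := by positivity
    rw [sin_sub] at h3
    nlinarith

/-- Simple crossings have indefinite nondegenerate Hessian, and triple points of another phase have
definite Hessian, so nothing else is left. -/
lemma mem_triplePoints_of_degenerate {d : ℕ} (hd : 1 ≤ d) {μ : ℝ} {p : ℝ × ℝ}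
    (h : IsDegenerateCriticalPoint (P d μ) p) : p ∈ triplePoints d (phase μ) := by
  have hst : p ∈ stationaryPoints (system d μ) := mem_stationaryPoints.2 h.1
  rw [stationaryPoints_system hd] at hst
  by_contra hnt
  apply h.2
  rw [injective_iff_map_eq_zero]
  intro v hv
  rcases hst with hcr | ⟨κ, φ₁, φ₂, φ₃, ht⟩
  · obtain ⟨s, hs, r, hr, hsr, rfl⟩ := (mem_crossings_iff hd).1 hcr
    obtain ⟨G, hG, hP, hG0⟩ := exists_P_eq_mul_pair hd μ hs hr hsr.ne
    set p := crossPoint (angle d μ s) (angle d μ r) with hp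
    have hGp : G p ≠ 0 := fun h0 => cofactor_ne_zero hd hs hr hsr.ne hnt ((hG0 p).1 h0)
    have hB := hessian_mul hG (tangentForm_crossPoint_left _ _) (tangentForm_crossPoint_right _ _) v
      (p := p)
    rw [← hP, hv] at hB
    have hne := sin_sub_angle_ne_zero hd μ hs hr hsr.ne
    have hne' := sin_sub_angle_ne_zero hd μ hr hs hsr.ne'
    have e1 := hB (unitVec (angle d μ s))
    have e2 := hB (unitVec (angle d μ r))
    simp only [tangentCLM_unitVec, sub_self, sin_zero, mul_zero, add_zero, zero_add,
      zero_apply] at e1 e2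
    have f1 : tangentCLM (angle d μ s) v = 0 := by simpa [hGp, hne] using e1.symm
    have f2 : tangentCLM (angle d μ r) v = 0 := by simpa [hGp, hne'] using e2.symm
    obtain ⟨a, b, rfl⟩ := exists_eq_smul_unitVec hne v
    simp only [map_add, map_smul, tangentCLM_unitVec, sub_self, sin_zero, smul_eq_mul, mul_zero,
      zero_add, add_zero, mul_eq_zero, hne, hne', or_false] at f1 f2
    simp [f1, f2]
  · have hκ : sin (phase μ - κ) ≠ 0 := fun h0 => hnt ⟨_, _, _, ht.congr_phase h0⟩
    by_contra hv0
    rcases hessian_definite hd ht hκ with hpos | hneg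
    · have := hpos v hv0; rw [hv] at this; simp at this
    · have := hneg v hv0; rw [hv] at this; simp at this

lemma exists_idx_of_mem_triplePoints {d : ℕ} (hd : 1 ≤ d) {μ : ℝ} {p : ℝ × ℝ}
    (h : p ∈ triplePoints d (phase μ)) : ∃ s ∈ idx d, ∃ r ∈ idx d, ∃ u ∈ idx d,
      s ≠ r ∧ r ≠ u ∧ u ≠ s ∧
      IsTriplePoint d (phase μ) (angle d μ s) (angle d μ r) (angle d μ u) p := by
  obtain ⟨φ₁, φ₂, φ₃, h⟩ := h
  obtain ⟨s, hs, hs'⟩ := (sin_eq_zero_iff_exists_angle hd μ φ₁).1 h.line₁.1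
  obtain ⟨r, hr, hr'⟩ := (sin_eq_zero_iff_exists_angle hd μ φ₂).1 h.line₂.1
  obtain ⟨u, hu, hu'⟩ := (sin_eq_zero_iff_exists_angle hd μ φ₃).1 h.line₃.1
  have h1 : s ≠ r := by
    rintro rfl; exact h.ne₁₂ (sin_sub_eq_zero_trans hs' (sin_sub_eq_zero_symm hr'))
  have h2 : r ≠ u := by
    rintro rfl; exact h.ne₂₃ (sin_sub_eq_zero_trans hr' (sin_sub_eq_zero_symm hu'))
  have h3 : u ≠ s := by
    rintro rfl; exact h.ne₃₁ (sin_sub_eq_zero_trans hu' (sin_sub_eq_zero_symm hs'))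
  exact ⟨s, hs, r, hr, u, hu, h1, h2, h3, isTriplePoint_angle hd hs hr hu h1 h2 h3
    ((tangentForm_congr hs' p).1 h.line₁.2) ((tangentForm_congr hr' p).1 h.line₂.2)
    ((tangentForm_congr hu' p).1 h.line₃.2)⟩

/-- The third line makes the cofactor of the first two vanish at p, so the whole Hessian is zero. -/
lemma isDegenerateCriticalPoint_of_mem_triplePoints {d : ℕ} (hd : 1 ≤ d) {μ : ℝ} {p : ℝ × ℝ}
    (h : p ∈ triplePoints d (phase μ)) : IsDegenerateCriticalPoint (P d μ) p := by
  obtain ⟨s, hs, r, hr, u, hu, hsr, hru, hus, ht⟩ := exists_idx_of_mem_triplePoints hd h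
  refine ⟨stationary_of_isTriplePoint hd μ ht, fun hinj => ?_⟩
  obtain ⟨G, hG, hP, hG0⟩ := exists_P_eq_mul_pair hd μ hs hr hsr
  have hGp : G p = 0 := (hG0 p).2 ⟨u, hu, hus, hru.symm, ht.line₃.2⟩
  have hB := hessian_mul hG ht.line₁.2 ht.line₂.2
  rw [← hP, hGp] at hB
  have h1 : fderiv ℝ (fderiv ℝ (P d μ)) p ((1, 0) : ℝ × ℝ) = 0 := by
    refine ContinuousLinearMap.ext fun w => ?_
    rw [hB]; simp
  have h2 := hinj (h1.trans (map_zero _).symm)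
  simp at h2

/-! ### The singularity `D₄` and its splitting -/

/-- Since L(q − p) vanishes at p, the differential of q ↦ b(q)·L(q − p) there is b(p)·L, and the
inverse function theorem supplies the chart. -/
lemma isD4_of_smul {H b : ℝ × ℝ → ℝ} {p : ℝ × ℝ} {U : Set (ℝ × ℝ)} (hU : IsOpen U) (hp : p ∈ U)
    (hb : ContDiffOn ℝ ∞ b U) (hbp : b p ≠ 0) (L : (ℝ × ℝ) ≃L[ℝ] (ℝ × ℝ))
    (hH : ∀ q ∈ U, H q = H p + ((b q • L (q - p)).1 ^ 2 * (b q • L (q - p)).2 -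
      (b q • L (q - p)).2 ^ 3)) : IsD4 H p := by
  set F : ℝ × ℝ → ℝ × ℝ := fun q => b q • L (q - p) with hF
  have hFc : ContDiffOn ℝ ∞ F U :=
    hb.smul (L.contDiff.comp (contDiff_id.sub contDiff_const)).contDiffOn
  have hFat : ∀ q ∈ U, ContDiffAt ℝ ∞ F q := fun q hq => hFc.contDiffAt (hU.mem_nhds hq)
  set L' : (ℝ × ℝ) ≃L[ℝ] (ℝ × ℝ) :=
    L.trans (ContinuousLinearEquiv.smulLeft (Units.mk0 (b p) hbp)) with hL'
  have hderiv : HasFDerivAt F (L' : ℝ × ℝ →L[ℝ] ℝ × ℝ) p := by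
    have h1 : HasFDerivAt b (fderiv ℝ b p) p :=
      ((hb.contDiffAt (hU.mem_nhds hp)).differentiableAt (by simp)).hasFDerivAt
    have h2 : HasFDerivAt (fun q => L (q - p)) (L : ℝ × ℝ →L[ℝ] ℝ × ℝ) p :=
      L.hasFDerivAt.comp p ((hasFDerivAt_id p).sub_const p)
    have h3 := h1.smul h2
    convert! h3 using 1
    ext <;> simp [hL']
  set e := (hFat p hp).toOpenPartialHomeomorph F hderiv (by simp) with he
  have hecoe : (e : ℝ × ℝ → ℝ × ℝ) = F := rfl
  have hpe : p ∈ e.source := (hFat p hp).mem_toOpenPartialHomeomorph_source hderiv (by simp)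
  -- Smoothness of the inverse on the whole target needs an invertible differential at every point
  -- of the source.
  set V : Set (ℝ × ℝ) := U ∩ fderiv ℝ F ⁻¹' range
    ((↑) : ((ℝ × ℝ) ≃L[ℝ] (ℝ × ℝ)) → (ℝ × ℝ →L[ℝ] ℝ × ℝ)) with hV
  have hVo : IsOpen V :=
    (hFc.continuousOn_fderiv_of_isOpen hU (by simp)).isOpen_inter_preimage hU
      ContinuousLinearEquiv.isOpen
  have hpV : p ∈ V := ⟨hp, L', hderiv.fderiv.symm⟩
  refine ⟨e.restrOpen V hVo, ⟨hpe, hpV⟩, ?_, ?_, ?_, ?_⟩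
  · change F p = 0
    simp [hF]
  · exact hFc.mono fun q hq => hq.2.1
  · intro y hy
    have hy1 : y ∈ e.target := hy.1
    have hx : e.symm y ∈ V := by
      have := (e.restrOpen V hVo).map_target hy
      exact this.2
    obtain ⟨M, hM⟩ := hx.2
    have h1 : HasFDerivAt e (M : ℝ × ℝ →L[ℝ] ℝ × ℝ) (e.symm y) := by
      rw [hM]
      exact ((hFat _ hx.1).differentiableAt (by simp)).hasFDerivAt
    exact (e.contDiffAt_symm hy1 h1 (hFat _ hx.1)).contDiffWithinAt
  · intro q hq
    exact hH q hq.2.1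

lemma exists_cube_root (y : ℝ) : ∃ x : ℝ, x ^ 3 = y := by
  refine mem_range_of_exists_le_of_exists_ge (f := fun x : ℝ => x ^ 3) (by fun_prop)
    ⟨-(1 + |y|), ?_⟩ ⟨1 + |y|, ?_⟩
  · have := neg_abs_le y
    have h := abs_nonneg y
    nlinarith [mul_nonneg h h, mul_nonneg h (mul_nonneg h h)]
  · have := le_abs_self y
    have h := abs_nonneg y
    nlinarith [mul_nonneg h h, mul_nonneg h (mul_nonneg h h)]

lemma exists_smooth_cube_root {g : ℝ × ℝ → ℝ} (hg : ContDiff ℝ ∞ g) {p : ℝ × ℝ} (hp : g p ≠ 0) :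
    ∃ (U : Set (ℝ × ℝ)) (b : ℝ × ℝ → ℝ), IsOpen U ∧ p ∈ U ∧ ContDiffOn ℝ ∞ b U ∧ b p ≠ 0 ∧
      ∀ q ∈ U, b q ^ 3 = g q := by
  obtain ⟨β, hβ⟩ := exists_cube_root (g p)
  have hβ0 : β ≠ 0 := by rintro rfl; exact hp (by rw [← hβ]; norm_num)
  refine ⟨{q | 0 < g q / g p}, fun q => β * exp (log (g q / g p) / 3),
    isOpen_lt continuous_const (hg.continuous.div_const _), by simp [hp], ?_, ?_, ?_⟩
  · have h1 : ContDiffOn ℝ ∞ (fun q => g q / g p) {q | 0 < g q / g p} :=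
      (hg.div_const _).contDiffOn
    exact contDiffOn_const.mul ((h1.log fun q hq => ne_of_gt hq).div_const 3).exp
  · exact mul_ne_zero hβ0 (exp_ne_zero _)
  · intro q hq
    rw [mul_pow, hβ, ← exp_nat_mul]
    rw [show ((3 : ℕ) : ℝ) * (log (g q / g p) / 3) = log (g q / g p) by push_cast; ring,
      exp_log hq]
    field_simp

/-- Rescale the three forms to ℓ₁ + ℓ₂ + ℓ₃ = 0. With X = (ℓ₁ − ℓ₂)/2 and Y = (ℓ₁ + ℓ₂)/2 one gets
X²Y − Y³ = Y(X − Y)(X + Y) = ℓ₁ℓ₂ℓ₃/2. -/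
theorem isD4_of_mem_triplePoints {d : ℕ} (hd : 1 ≤ d) {μ : ℝ} {p : ℝ × ℝ}
    (h : p ∈ triplePoints d (phase μ)) : IsD4 (P d μ) p := by
  obtain ⟨s, hs, r, hr, u, hu, hsr, hru, hus, ht⟩ := exists_idx_of_mem_triplePoints hd h
  obtain ⟨G, hG, hP, hG0⟩ := exists_P_eq_mul hd μ (S := {s, r, u}) (by
    intro x hx
    simp only [Finset.mem_insert, Finset.mem_singleton] at hx
    rcases hx with rfl | rfl | rfl <;> assumption)
  have hGp : G p ≠ 0 := by
    intro h0
    obtain ⟨x, hx, hx0⟩ := (hG0 p).1 h0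
    simp only [Finset.mem_sdiff, Finset.mem_insert, Finset.mem_singleton, not_or] at hx
    rcases ht.eq_line hx0 with h1 | h1 | h1
    · exact sin_sub_angle_ne_zero hd μ hx.1 hs hx.2.1 h1
    · exact sin_sub_angle_ne_zero hd μ hx.1 hr hx.2.2.1 h1
    · exact sin_sub_angle_ne_zero hd μ hx.1 hu hx.2.2.2 h1
  have hPmul : ∀ q, P d μ q = tangentForm (angle d μ s) q * tangentForm (angle d μ r) q *
      tangentForm (angle d μ u) q * G q := by
    intro q
    rw [hP, Finset.prod_insert (by simp [hsr, hus.symm]), Finset.prod_pair hru]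
    ring
  clear hP hG0
  have z₁ := ht.line₁.2
  have z₂ := ht.line₂.2
  have z₃ := ht.line₃.2
  have n₁₂ := ht.ne₁₂
  have n₂₃ := ht.ne₂₃
  have n₃₁ := ht.ne₃₁
  generalize angle d μ s = φ₁ at *
  generalize angle d μ r = φ₂ at *
  generalize angle d μ u = φ₃ at *
  set D := sin (φ₂ - φ₃) * sin (φ₃ - φ₁) * sin (φ₁ - φ₂) with hD
  have hD0 : D ≠ 0 := mul_ne_zero (mul_ne_zero n₂₃ n₃₁) n₁₂
  -- Rescaling multiplies the product of the forms by D and the normal form contributes 1/2, so the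
  -- cofactor G has to be b³·D/2.
  obtain ⟨U, b, hU, hpU, hb, hbp, hb3⟩ := exists_smooth_cube_root (g := fun q => 2 * G q / D)
    ((contDiff_const.mul hG).div_const _) (p := p) (by positivity)
  set ℓ₁ : ℝ × ℝ →L[ℝ] ℝ := sin (φ₂ - φ₃) • tangentCLM φ₁ with hℓ₁
  set ℓ₂ : ℝ × ℝ →L[ℝ] ℝ := sin (φ₃ - φ₁) • tangentCLM φ₂ with hℓ₂
  set M : ℝ × ℝ →L[ℝ] ℝ × ℝ :=
    ((1 / 2 : ℝ) • (ℓ₁ - ℓ₂)).prod ((1 / 2 : ℝ) • (ℓ₁ + ℓ₂)) with hM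
  have hker : M.ker = ⊥ := by
    rw [LinearMap.ker_eq_bot']
    intro v hv
    have e1 : (1 / 2 : ℝ) * (ℓ₁ v - ℓ₂ v) = 0 := congrArg Prod.fst hv
    have e2 : (1 / 2 : ℝ) * (ℓ₁ v + ℓ₂ v) = 0 := congrArg Prod.snd hv
    have f1 : ℓ₁ v = 0 := by linarith
    have f2 : ℓ₂ v = 0 := by linarith
    have g1 : tangentCLM φ₁ v = 0 := by simpa [hℓ₁, n₂₃] using f1
    have g2 : tangentCLM φ₂ v = 0 := by simpa [hℓ₂, n₃₁] using f2
    obtain ⟨x, y, rfl⟩ := exists_eq_smul_unitVec n₁₂ v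
    have n₂₁ : sin (φ₂ - φ₁) ≠ 0 := fun h => n₁₂ (sin_sub_eq_zero_symm h)
    simp only [map_add, map_smul, tangentCLM_unitVec, sub_self, sin_zero, smul_eq_mul, mul_zero,
      zero_add, add_zero, mul_eq_zero, n₁₂, n₂₁, or_false] at g1 g2
    simp [g1, g2]
  have hsurj : M.range = ⊤ := LinearMap.ker_eq_bot_iff_range_eq_top.1 hker
  set L := ContinuousLinearEquiv.ofBijective M hker hsurj with hL
  have hLv : ∀ v, L v = ((1 / 2 : ℝ) * (ℓ₁ v - ℓ₂ v), (1 / 2 : ℝ) * (ℓ₁ v + ℓ₂ v)) := fun v => rfl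
  refine isD4_of_smul hU hpU hb hbp L fun q hq => ?_
  have h3 := hb3 q hq
  have t₁ := tangentForm_add φ₁ p (q - p)
  have t₂ := tangentForm_add φ₂ p (q - p)
  have t₃ := tangentForm_add φ₃ p (q - p)
  rw [add_sub_cancel] at t₁ t₂ t₃
  rw [z₁, zero_add] at t₁
  rw [z₂, zero_add] at t₂
  rw [z₃, zero_add] at t₃
  rw [hPmul q, hPmul p, z₁, hLv, t₁, t₂, t₃]
  have hlin : sin (φ₂ - φ₃) * tangentCLM φ₁ (q - p) + sin (φ₃ - φ₁) * tangentCLM φ₂ (q - p) +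
      sin (φ₁ - φ₂) * tangentCLM φ₃ (q - p) = 0 := by
    simp only [tangentCLM_apply, sin_sub]; ring
  simp only [Prod.smul_mk, smul_eq_mul, hℓ₁, hℓ₂, smul_apply]
  have hbG : b q ^ 3 * D = 2 * G q := by rw [h3]; field_simp
  generalize tangentCLM φ₁ (q - p) = a₁ at *
  generalize tangentCLM φ₂ (q - p) = a₂ at *
  generalize tangentCLM φ₃ (q - p) = a₃ at *
  generalize sin (φ₂ - φ₃) = S₁ at *
  generalize sin (φ₃ - φ₁) = S₂ at *
  generalize sin (φ₁ - φ₂) = S₃ at *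
  rw [hD] at hbG
  linear_combination (-(a₁ * a₂ * a₃) / 2) * hbG + (b q ^ 3 * S₁ * S₂ * a₁ * a₂ / 2) * hlin

/-! ### The splitting of a triple point -/

lemma continuous_crossPoint_angle (d : ℕ) (x : ℤ × ℤ) :
    Continuous fun μ => crossPoint (angle d μ x.1) (angle d μ x.2) := by
  unfold crossPoint angle; fun_prop

lemma range_vec_three {α : Type*} (a b c : α) : range ![a, b, c] = {a, b, c} := by
  ext y
  constructor
  · rintro ⟨i, rfl⟩
    fin_cases i <;> simp
  · rintro (rfl | rfl | rfl)
    · exact ⟨0, rfl⟩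
    · exact ⟨1, rfl⟩
    · exact ⟨2, rfl⟩

lemma injective_vec_three {α : Type*} {a b c : α} (hab : a ≠ b) (hbc : b ≠ c) (hca : c ≠ a) :
    Function.Injective ![a, b, c] := by
  intro i j hij
  fin_cases i <;> fin_cases j <;> simp_all

/-- Crossings move continuously with μ and the other stationary points stay fixed. Near p one finds
only p itself, now off all lines, and the three crossings of the lines that met there, pairwise
distinct because no triple point survives for μ ≠ μ₀ close to μ₀. -/
theorem splits_of_mem_triplePoints {d : ℕ} (hd : 1 ≤ d) {μ₀ : ℝ} {p : ℝ × ℝ}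
    (h : p ∈ triplePoints d (phase μ₀)) : SplitsIntoThreeSaddlesOneCenter (system d) μ₀ p := by
  obtain ⟨s, hs, r, hr, u, hu, hsr, hru, hus, ht⟩ := exists_idx_of_mem_triplePoints hd h
  set X : ℝ → ℤ × ℤ → ℝ × ℝ := fun μ x => crossPoint (angle d μ x.1) (angle d μ x.2) with hX
  -- Finiteness gives a radius ε₀ separating p from all other limits of crossings and from all other
  -- triple points of any phase.
  have hfin : ((X μ₀ '' ((idx d).offDiag : Set (ℤ × ℤ)) ∪ allTriplePoints d) \ {p}).Finite :=
    (((Finset.finite_toSet _).image _).union (allTriplePoints_finite hd)).sdiff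
  obtain ⟨ε₀, hε₀, hball⟩ := Metric.isOpen_iff.1 hfin.isClosed.isOpen_compl p (by simp)
  have hfar : ∀ y, y ∈ X μ₀ '' ((idx d).offDiag : Set (ℤ × ℤ)) ∪ allTriplePoints d → y ≠ p →
      ε₀ ≤ dist y p := by
    intro y hy hyp
    by_contra hc
    exact hball (Metric.mem_ball.2 (not_le.1 hc)) ⟨hy, hyp⟩
  filter_upwards [Ioo_mem_nhdsGT hε₀] with ε hε
  have hev : ∀ᶠ μ in 𝓝[≠] μ₀, ∀ x ∈ (idx d).offDiag, X μ x ∈ Metric.ball p ε ↔ X μ₀ x = p := by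
    rw [Filter.eventually_all_finset]
    intro x hx
    have hcont : Tendsto (fun μ => dist (X μ x) p) (𝓝 μ₀) (𝓝 (dist (X μ₀ x) p)) :=
      ((continuous_crossPoint_angle d x).dist continuous_const).continuousAt
    refine Filter.Eventually.filter_mono nhdsWithin_le_nhds ?_
    by_cases hxp : X μ₀ x = p
    · filter_upwards [hcont.eventually_lt_const (show dist (X μ₀ x) p < ε by simpa [hxp] using hε.1)]
        with μ hμ
      exact ⟨fun _ => hxp, fun _ => hμ⟩
    · have h1 := hfar _ (Or.inl ⟨x, hx, rfl⟩) hxp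
      filter_upwards [hcont.eventually_const_lt (hε.2.trans_le h1)] with μ hμ
      exact ⟨fun h2 => absurd (Metric.mem_ball.1 h2) (not_lt.2 hμ.le), fun h2 => absurd h2 hxp⟩
  filter_upwards [hev, eventually_sin_ne_zero μ₀] with μ hμ hsin
  have hempty := triplePoints_eq_empty (d := d) hsin
  have hphase : sin (phase μ - phase μ₀) ≠ 0 := by
    intro h0
    have : p ∈ triplePoints d (phase μ) := ⟨_, _, _, ht.congr_phase h0⟩
    rw [hempty] at this
    exact this
  have hno : ∀ {s r u : ℤ}, s ∈ idx d → r ∈ idx d → u ∈ idx d → s ≠ r → r ≠ u → u ≠ s →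
      X μ (s, r) ≠ X μ (r, u) := by
    intro s r u hs hr hu hsr hru hus heq
    have h3 : tangentForm (angle d μ u) (X μ (s, r)) = 0 := by
      rw [heq]; exact tangentForm_crossPoint_right _ _
    have : X μ (s, r) ∈ triplePoints d (phase μ) := ⟨_, _, _, isTriplePoint_angle hd hs hr hu hsr hru hus
      (tangentForm_crossPoint_left _ _) (tangentForm_crossPoint_right _ _) h3⟩
    rw [hempty] at this
    exact this
  have hsad : ∀ {s r : ℤ}, s ∈ idx d → r ∈ idx d → s ≠ r → IsSaddle (system d μ) (X μ (s, r)) := by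
    intro s r hs hr hsr
    exact isSaddle_crossPoint hd hs hr hsr (by rw [hempty]; exact notMem_empty _)
  have hcross : ∀ {s r : ℤ}, s ∈ idx d → r ∈ idx d → s ≠ r → X μ (s, r) ∈ crossings d (phase μ) := by
    intro s r hs hr hsr
    exact ⟨_, _, sin_sub_angle_ne_zero hd μ hs hr hsr,
      isLineThrough_angle hd hs (tangentForm_crossPoint_left _ _),
      isLineThrough_angle hd hr (tangentForm_crossPoint_right _ _)⟩
  have hpall : p ∈ allTriplePoints d := ⟨_, h⟩
  have hpn : p ∉ crossings d (phase μ) := by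
    intro h1
    have : p ∈ triplePoints d (phase μ) := by
      rw [← crossings_inter_allTriplePoints]; exact ⟨h1, hpall⟩
    rw [hempty] at this
    exact this
  have hX₀ : X μ₀ (s, r) = p ∧ X μ₀ (r, u) = p ∧ X μ₀ (u, s) = p :=
    ⟨ht.eq_crossPoint.symm, ht.rotate.eq_crossPoint.symm, ht.rotate.rotate.eq_crossPoint.symm⟩
  have hcomm : ∀ a b, X μ (a, b) = X μ (b, a) := fun a b => crossPoint_comm _ _
  have hrange : range ![X μ (s, r), X μ (r, u), X μ (u, s)] =
      {X μ (s, r), X μ (r, u), X μ (u, s)} :=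
    range_vec_three _ _ _
  refine ⟨![X μ (s, r), X μ (r, u), X μ (u, s)], p, ?_, ?_, ?_, ?_, isCenter_of_isTriplePoint hd ht hphase⟩
  · exact injective_vec_three (hno hs hr hu hsr hru hus) (hno hr hu hs hru hus hsr)
      (hno hu hs hr hus hsr hru)
  · rw [hrange]
    rintro (h1 | h1 | h1)
    · exact hpn (h1 ▸ hcross hs hr hsr)
    · exact hpn (h1 ▸ hcross hr hu hru)
    · exact hpn (h1 ▸ hcross hu hs hus)
  · rw [stationaryPoints_system hd, hrange]
    apply Subset.antisymm
    · rintro y ⟨hy | hy, hyb⟩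
      · right
        obtain ⟨a, ha, b, hb, hab, rfl⟩ := (mem_crossings_iff hd).1 hy
        have h1 : X μ₀ (a, b) = p :=
          (hμ (a, b) (Finset.mem_offDiag.2 ⟨ha, hb, hab.ne⟩)).1 hyb
        have hline : ∀ c ∈ idx d, tangentForm (angle d μ₀ c) p = 0 → c = s ∨ c = r ∨ c = u := by
          intro c hc h2
          by_contra! hcon
          rcases ht.eq_line h2 with h3 | h3 | h3
          · exact sin_sub_angle_ne_zero hd μ₀ hc hs hcon.1 h3
          · exact sin_sub_angle_ne_zero hd μ₀ hc hr hcon.2.1 h3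
          · exact sin_sub_angle_ne_zero hd μ₀ hc hu hcon.2.2 h3
        have ha' := hline a ha (h1 ▸ tangentForm_crossPoint_left _ _)
        have hb' := hline b hb (h1 ▸ tangentForm_crossPoint_right _ _)
        change X μ (a, b) ∈ _
        have hab' := hab.ne
        rcases ha' with rfl | rfl | rfl <;> rcases hb' with rfl | rfl | rfl <;>
          first
          | exact absurd rfl hab'
          | simp [hcomm]
      · left
        by_contra hyp
        have h1 := hfar y (Or.inr hy) hyp
        have h2 := Metric.mem_ball.1 hyb
        linarith [hε.2]
    · rintro y (rfl | rfl | rfl | rfl)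
      · exact ⟨Or.inr hpall, Metric.mem_ball_self hε.1⟩
      · exact ⟨Or.inl (hcross hs hr hsr),
          (hμ (s, r) (Finset.mem_offDiag.2 ⟨hs, hr, hsr⟩)).2 hX₀.1⟩
      · exact ⟨Or.inl (hcross hr hu hru),
          (hμ (r, u) (Finset.mem_offDiag.2 ⟨hr, hu, hru⟩)).2 hX₀.2.1⟩
      · exact ⟨Or.inl (hcross hu hs hus),
          (hμ (u, s) (Finset.mem_offDiag.2 ⟨hu, hs, hus⟩)).2 hX₀.2.2⟩
  · intro i
    fin_cases i
    · exact hsad hs hr hsr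
    · exact hsad hr hu hru
    · exact hsad hu hs hus

end DeltoidHamiltonian

end

/-! ### The three statements combined -/

theorem theorem5p3 (d : ℕ) (hd : 1 ≤ d) :
    (4 ≤ d → ¬ 3 ∣ d →
      (∀ μ : ℝ, DeltoidHamiltonian.RotationEquivalent
        (DeltoidHamiltonian.system d μ)
        (DeltoidHamiltonian.system d (μ + 2 * Real.pi / 3))) ∧
      {μ : ℝ | μ ∈ Set.Ico 0 (2 * Real.pi / 3) ∧
          DeltoidHamiltonian.IsBifurcationPoint (DeltoidHamiltonian.system d) μ} =
        {Real.pi / 6, Real.pi / 2} ∧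
      ∀ μ : ℝ, DeltoidHamiltonian.IsBifurcationPoint (DeltoidHamiltonian.system d) μ →
        ∃! ν : ℝ, ν ∈ ({Real.pi / 6, Real.pi / 2} : Set ℝ) ∧
          DeltoidHamiltonian.RotationEquivalent
            (DeltoidHamiltonian.system d μ) (DeltoidHamiltonian.system d ν)) ∧
    (4 ≤ d → 3 ∣ d →
      (∀ μ : ℝ, DeltoidHamiltonian.system d (μ + 2 * Real.pi) = DeltoidHamiltonian.system d μ) ∧
      {μ : ℝ | μ ∈ Set.Ico 0 (2 * Real.pi) ∧
          DeltoidHamiltonian.IsBifurcationPoint (DeltoidHamiltonian.system d) μ} =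
        {μ : ℝ | ∃ l : ℕ, l ≤ 5 ∧ μ = (2 * (l : ℝ) + 1) * Real.pi / 6} ∧
      ∀ μ : ℝ, DeltoidHamiltonian.IsBifurcationPoint (DeltoidHamiltonian.system d) μ →
        ∃! ν : ℝ, (∃ l : ℕ, l ≤ 5 ∧ ν = (2 * (l : ℝ) + 1) * Real.pi / 6) ∧
          DeltoidHamiltonian.RotationEquivalent
            (DeltoidHamiltonian.system d μ) (DeltoidHamiltonian.system d ν)) ∧
    (∀ μ₀ : ℝ, DeltoidHamiltonian.IsBifurcationPoint (DeltoidHamiltonian.system d) μ₀ →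
      (∃ p : ℝ × ℝ,
        DeltoidHamiltonian.IsDegenerateCriticalPoint (DeltoidHamiltonian.P d μ₀) p) ∧
      ∀ p : ℝ × ℝ,
        DeltoidHamiltonian.IsDegenerateCriticalPoint (DeltoidHamiltonian.P d μ₀) p →
          DeltoidHamiltonian.IsD4 (DeltoidHamiltonian.P d μ₀) p ∧
          DeltoidHamiltonian.SplitsIntoThreeSaddlesOneCenter
            (DeltoidHamiltonian.system d) μ₀ p) := by
  refine ⟨DeltoidHamiltonian.rotation_classification_of_not_three_dvd,
    DeltoidHamiltonian.rotation_classification_of_three_dvd, fun μ₀ hμ₀ => ?_⟩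
  obtain ⟨p, hp⟩ := (DeltoidHamiltonian.isBifurcationPoint_iff hd μ₀).1 hμ₀
  refine ⟨⟨p, DeltoidHamiltonian.isDegenerateCriticalPoint_of_mem_triplePoints hd hp⟩,
    fun q hq => ?_⟩
  have hq' := DeltoidHamiltonian.mem_triplePoints_of_degenerate hd hq
  exact ⟨DeltoidHamiltonian.isD4_of_mem_triplePoints hd hq',
    DeltoidHamiltonian.splits_of_mem_triplePoints hd hq'⟩
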